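/- Theorem 3.2 (Local existence with smooth initial condition). Let $N,k\ge 1$ be integers, $k_1,k_2\in\mathbb R$, $\gamma<1$ and $p_1,p_2>1$, and write points of $\mathbb R^{N+k}$ as $z=(x,y)$ with $x\in\mathbb R^N$, $y\in\mathbb R^k$. Consider $$u_t-\Delta_{\mathcal G}u=k_1\int_0^t(t-s)^{-\gamma}|u|^{p_1-1}u(s)\,ds+k_2|u|^{p_2-1}u,\quad t>0,\ z\in\mathbb R^{N+k},\qquad u(0)=u_0,\tag{$*$}$$ where $\Delta_{\mathcal G}=\frac12(\Delta_x+|x|^2\Delta_y)$. Let $S_{\mathcal G}(0)\varphi=\varphi$ and, for $t>0$, $S_{\mathcal G}(t)\varphi(x,y)=\int_{\mathbb R^{N+k}}K(x,x',y-y';t)\varphi(x',y')\,dx'\,dy'$, where $$K(x,x_0,y;t)=\frac1{(2\pi)^{\frac{N+2k}2}}\int_{\mathbb R^k}\Big(\frac{|\xi|}{\sinh(|\xi|t)}\Big)^{\frac N2}e^{i\xi\cdot y-\frac{|\xi|}2\left((|x|^2+|x_0|^2)\coth(|\xi|t)-2x\cdot x_0\,\mathrm{csch}(|\xi|t)\right)}\,d\xi$$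 is the heat kernel of $\Delta_{\mathcal G}$. Let $C_0=C_0(\mathbb R^{N+k})$ be the space of real continuous functions vanishing at infinity, with the supremum norm. For $0<T\le\infty$, a mild solution of $(*)$ on $[0,T)$ is a function $u\in C([0,T),C_0)$ such that for all $t\in[0,T)$ $$u(t)=S_{\mathcal G}(t)u_0+k_1\int_0^tS_{\mathcal G}(t-s)\int_0^s(s-\tau)^{-\gamma}|u(\tau)|^{p_1-1}u(\tau)\,d\tau\,ds+k_2\int_0^tS_{\mathcal G}(t-s)|u(s)|^{p_2-1}u(s)\,ds.$$ Let $u_0\in C_0(\mathbb R^{N+k})$. Then there are $0<T_{\max}\le\infty$ and a mild solution $u\in C([0,T_{\max}),C_0)$ of $(*)$ that is maximal and unique: if $v$ is a mild solution of $(*)$ on $[0,T)$, then $T\le T_{\max}$ and $v=u$ on $[0,T)$. Moreover: 1. either $T_{\max}=\infty$, or else $T_{\max}<\infty$ and $\|u\|_{L^\infty((0,t)\times\mathbb R^{N+k})}\to\infty$ as $t\to T_{\max}^-$; 2. if in addition $u_0\in L^r(\mathbb R^{N+k})$ for some $1\le r<\infty$, then $u\in C([0,T_{\max}),L^r(\mathbb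 R^{N+k})\cap C_0(\mathbb R^{N+k}))$; 3. if $u_0\ge0$ and $k_1,k_2\ge0$, then $u(t)\ge0$ for all $t\in[0,T_{\max})$. -/

import Mathlib

open MeasureTheory Filter Topology Set
open scoped ZeroAtInfty ENNReal

noncomputable section

namespace Grushin

/-- `ℝ^{N+k}`, with points `z = (x, y)`, `x ∈ ℝ^N`, `y ∈ ℝ^k`; its measure is Lebesgue measure. -/
abbrev Space (N k : ℕ) : Type := EuclideanSpace ℝ (Fin N) × EuclideanSpace ℝ (Fin k)

/-- The heat kernel `K(x, x₀, y; t)` of `Δ_G = (Δ_x + |x|² Δ_y) / 2`, for `t > 0`: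
`(2π)^{-(N+2k)/2} ∫_{ℝ^k} (|ξ| / sinh(|ξ|t))^{N/2}
  exp(i ξ·y - (|ξ|/2) ((|x|² + |x₀|²) coth(|ξ|t) - 2 x·x₀ csch(|ξ|t))) dξ`.
The integral is a real number (`ξ ↦ -ξ` conjugates the integrand); `.re` only changes its type. -/
def heatKernel (N k : ℕ) (x x₀ : EuclideanSpace ℝ (Fin N)) (y : EuclideanSpace ℝ (Fin k))
    (t : ℝ) : ℝ :=
  1 / (2 * Real.pi) ^ (((N : ℝ) + 2 * (k : ℝ)) / 2) *
    (∫ ξ : EuclideanSpace ℝ (Fin k),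
      (((‖ξ‖ / Real.sinh (‖ξ‖ * t)) ^ ((N : ℝ) / 2) : ℝ) : ℂ) *
        Complex.exp (Complex.I * ((inner ℝ ξ y : ℝ) : ℂ) -
          ((‖ξ‖ / 2 * ((‖x‖ ^ 2 + ‖x₀‖ ^ 2) * (Real.cosh (‖ξ‖ * t) / Real.sinh (‖ξ‖ * t)) -
            2 * (inner ℝ x x₀ : ℝ) * (1 / Real.sinh (‖ξ‖ * t))) : ℝ) : ℂ))).re

/-- The Grushin heat semigroup: `S(0) φ = φ`, and for `t > 0`
`(S(t) φ)(x, y) = ∫ K(x, w, y - z; t) φ(w, z) dw dz`. Only `t ≥ 0` is ever used. -/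
def semigroup (N k : ℕ) (t : ℝ) (φ : Space N k → ℝ) (z : Space N k) : ℝ :=
  if 0 < t then ∫ w : Space N k, heatKernel N k z.1 w.1 (z.2 - w.2) t * φ w else φ z

/-- The nonlinearity `a ↦ |a|^{p-1} a`. -/
def power (p a : ℝ) : ℝ := |a| ^ (p - 1) * a

/-- The right-hand side at time `t` of the integral equation of the Grushin heat equation with
memory, evaluated at the point `z`:
`S(t)u₀ + k₁ ∫₀ᵗ S(t-s) ∫₀ˢ (s-τ)^{-γ} |u(τ)|^{p₁-1}u(τ) dτ ds + k₂ ∫₀ᵗ S(t-s) |u(s)|^{p₂-1}u(s) ds`.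
For `u` continuous into `C₀` all integrals converge in `C₀`, so they commute with evaluation. -/
def duhamel (N k : ℕ) (k₁ k₂ γ p₁ p₂ : ℝ) (u₀ : C₀(Space N k, ℝ))
    (u : ℝ → C₀(Space N k, ℝ)) (t : ℝ) (z : Space N k) : ℝ :=
  semigroup N k t u₀ z
    + k₁ * (∫ s in (0 : ℝ)..t,
        semigroup N k (t - s)
          (fun w => ∫ τ in (0 : ℝ)..s, (s - τ) ^ (-γ) * power p₁ (u τ w)) z)
    + k₂ * (∫ s in (0 : ℝ)..t, semigroup N k (t - s) (fun w => power p₂ (u s w)) z)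

/-- The time interval `[0, T)`, where `T = ∞` is allowed. -/
def timeInterval (T : EReal) : Set ℝ := {t : ℝ | 0 ≤ t ∧ (t : EReal) < T}

/-- `u ∈ C([0, T), C₀(ℝ^{N+k}))` is a mild solution with initial value `u₀`. The values of `u`
outside `[0, T)` are irrelevant. -/
structure IsMildSolution (N k : ℕ) (k₁ k₂ γ p₁ p₂ : ℝ) (u₀ : C₀(Space N k, ℝ))
    (T : EReal) (u : ℝ → C₀(Space N k, ℝ)) : Prop where
  continuousOn : ContinuousOn u (timeInterval T)
  eq_duhamel : ∀ t ∈ timeInterval T, ∀ z : Space N k,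
    u t z = duhamel N k k₁ k₂ γ p₁ p₂ u₀ u t z

/-- `u ∈ C([0, T), L^r(ℝ^{N+k}))`. -/
def ContinuousInLp (N k : ℕ) (r : ℝ≥0∞) (T : EReal) (u : ℝ → C₀(Space N k, ℝ)) : Prop :=
  (∀ t ∈ timeInterval T, MemLp (u t) r volume) ∧
    ∀ t ∈ timeInterval T,
      Tendsto (fun s => eLpNorm (fun z => u s z - u t z) r volume)
        (𝓝[timeInterval T] t) (𝓝 0)

/-- The norm of `u` in `L^∞((0, t) × ℝ^{N+k})`. -/
def spaceTimeNorm (N k : ℕ) (u : ℝ → C₀(Space N k, ℝ)) (t : ℝ) : ℝ≥0∞ :=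
  eLpNorm (fun q : ℝ × Space N k => u q.1 q.2) ∞
    (volume.restrict (Ioo (0 : ℝ) t ×ˢ (univ : Set (Space N k))))

end Grushin

end

noncomputable section

namespace Grushin

/-! A Fourier transform in `y` turns the Grushin operator into the harmonic oscillator `(Δ_x -
|ξ|²|x|²)/2`, whose heat kernel is the Mehler kernel of frequency `‖ξ‖`. The heat kernel is thus the
cosine transform in `ξ` of an explicit symbol (`heatKernel_eq_cosTransform`), and everything about
the semigroup is read off from Gaussian integrals.

The one property not visible in the formula is positivity. In a symmetric Trotter splitting of the
oscillator, one step depends on `ξ` only through a factor `exp(-c|ξ|²)`, so cosine transforms of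
products of steps are superpositions of positive Gaussians. Each step is itself an exact Mehler
kernel with modified frequency and phase (`mehler_trotter`); hence the products are explicit and the
limit is elementary. Positivity makes the kernel integrable (`integrable_cosTransform`) and
justifies Fourier inversion. This gives unit mass, the Chapman–Kolmogorov equation and off-diagonal
bounds. Hence the heat operators form a positive, strongly continuous contraction semigroup on `C₀`,
and by Jensen's inequality and symmetry of the kernel also on `C₀ ∩ Lʳ`.

The nonlinear part is abstract. With the powers truncated at level `M` the nonlinearities are
globally Lipschitz, and since `γ < 1` the memory kernel is integrable, so the Volterra equation has
a unique global solution (`MemoryProblem.exists_eq_rhs`, by contraction in an exponentially weighted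
norm). As long as a truncated solution stays below its level it solves the true equation, and
conversely every mild solution is locally a truncated one. Patching all levels yields the maximal
solution and the blow-up alternative (`TruncatedSolutions.exists_maximal`). Integrability persists
because the truncated equation can be solved in `C₀ ∩ Lʳ` as well, and uniqueness in `C₀` identifies
the two solutions. Nonnegativity comes from solving with `max a 0` inside the nonlinearities: that
solution is visibly nonnegative, so the modification is invisible to it. -/

/-- Euclidean space `ℝⁿ`. -/
abbrev Vec (n : ℕ) : Type := EuclideanSpace ℝ (Fin n)

/-! ### Gaussian integrals -/

theorem integrable_exp_neg_mul_sq_add_inner {n : ℕ} {b : ℝ} (hb : 0 < b) (v : Vec n) :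
    Integrable fun w : Vec n => Real.exp (-b * ‖w‖ ^ 2 + inner ℝ v w) := by
  have h := (GaussianFourier.integrable_cexp_neg_mul_sq_norm_add
    (b := (b : ℂ)) (by simpa using hb) 1 v).re
  refine h.congr (Eventually.of_forall fun w => ?_)
  have : Complex.exp (-(b : ℂ) * (‖w‖ : ℂ) ^ 2 + 1 * ((inner ℝ v w : ℝ) : ℂ))
      = ((Real.exp (-b * ‖w‖ ^ 2 + inner ℝ v w) : ℝ) : ℂ) := by push_cast; simp
  simp only [this]
  simp [-Complex.ofReal_exp]

theorem integral_exp_neg_mul_sq_add_inner {n : ℕ} {b : ℝ} (hb : 0 < b) (v : Vec n) :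
    ∫ w : Vec n, Real.exp (-b * ‖w‖ ^ 2 + inner ℝ v w)
      = (Real.pi / b) ^ ((n : ℝ) / 2) * Real.exp (‖v‖ ^ 2 / (4 * b)) := by
  have h := GaussianFourier.integral_cexp_neg_mul_sq_norm_add
    (b := (b : ℂ)) (by simpa using hb) 1 v
  have e : ∀ w : Vec n, Complex.exp (-(b : ℂ) * (‖w‖ : ℂ) ^ 2 + 1 * ((inner ℝ v w : ℝ) : ℂ))
      = ((Real.exp (-b * ‖w‖ ^ 2 + inner ℝ v w) : ℝ) : ℂ) := fun w => by push_cast; simp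
  simp only [e] at h
  rw [integral_complex_ofReal] at h
  apply Complex.ofReal_injective
  rw [h, Complex.ofReal_mul, Complex.ofReal_cpow (by positivity)]
  push_cast
  simp

theorem integrable_exp_neg_mul_sq_norm {n : ℕ} {b : ℝ} (hb : 0 < b) :
    Integrable fun w : Vec n => Real.exp (-b * ‖w‖ ^ 2) := by
  simpa using integrable_exp_neg_mul_sq_add_inner hb (0 : Vec n)

theorem integral_exp_neg_mul_sq_norm {n : ℕ} {b : ℝ} (hb : 0 < b) :
    ∫ w : Vec n, Real.exp (-b * ‖w‖ ^ 2) = (Real.pi / b) ^ ((n : ℝ) / 2) := by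
  simpa using integral_exp_neg_mul_sq_add_inner hb (0 : Vec n)

theorem integral_cos_mul_exp_neg_mul_sq_norm {n : ℕ} {b : ℝ} (hb : 0 < b) (v : Vec n) :
    ∫ w : Vec n, Real.cos (inner ℝ v w) * Real.exp (-b * ‖w‖ ^ 2)
      = (Real.pi / b) ^ ((n : ℝ) / 2) * Real.exp (-(‖v‖ ^ 2 / (4 * b))) := by
  have h := GaussianFourier.integral_cexp_neg_mul_sq_norm_add
    (b := (b : ℂ)) (by simpa using hb) Complex.I v
  have hi := GaussianFourier.integrable_cexp_neg_mul_sq_norm_add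
    (b := (b : ℂ)) (by simpa using hb) Complex.I v
  have e : ∀ w : Vec n, (Complex.exp (-(b : ℂ) * (‖w‖ : ℂ) ^ 2
      + Complex.I * ((inner ℝ v w : ℝ) : ℂ))).re
      = Real.cos (inner ℝ v w) * Real.exp (-b * ‖w‖ ^ 2) := fun w => by
    rw [Complex.exp_re]
    simp [mul_comm, ← Complex.ofReal_pow]
  have h2 := congrArg Complex.re h
  have h3 := integral_re hi
  simp only [RCLike.re_eq_complex_re] at h3
  rw [← h3] at h2
  simp only [e] at h2
  rw [h2]
  have : ((Real.pi : ℂ) / b) ^ ((Module.finrank ℝ (Vec n) : ℂ) / 2)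
      * Complex.exp (Complex.I ^ 2 * ‖v‖ ^ 2 / (4 * b))
      = (((Real.pi / b) ^ ((n : ℝ) / 2) * Real.exp (-(‖v‖ ^ 2 / (4 * b))) : ℝ) : ℂ) := by
    rw [Complex.ofReal_mul, Complex.ofReal_cpow (by positivity)]
    push_cast
    simp [neg_div]
  rw [this, Complex.ofReal_re]

theorem integrable_cos_mul_exp_neg_mul_sq_norm {n : ℕ} {b : ℝ} (hb : 0 < b) (v : Vec n) :
    Integrable fun w : Vec n => Real.cos (inner ℝ v w) * Real.exp (-b * ‖w‖ ^ 2) := by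
  refine (integrable_exp_neg_mul_sq_norm hb).mono' (by fun_prop) (Eventually.of_forall fun w => ?_)
  rw [norm_mul, Real.norm_eq_abs, Real.norm_eq_abs, Real.abs_exp]
  exact mul_le_of_le_one_left (Real.exp_nonneg _) (Real.abs_cos_le_one _)

/-! ### Gaussian kernels -/

/-- The Gaussian kernel `(b/2π)^{n/2} exp(-(a/2)(|x|² + |w|²) + b x·w)`. -/
def gaussKernel {n : ℕ} (a b : ℝ) (x w : Vec n) : ℝ :=
  (b / (2 * Real.pi)) ^ ((n : ℝ) / 2)
    * Real.exp (-(a / 2) * (‖x‖ ^ 2 + ‖w‖ ^ 2) + b * inner ℝ x w)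

section gaussKernel

variable {n : ℕ} {a b a' b' : ℝ}

theorem gaussKernel_comm (a b : ℝ) (x w : Vec n) : gaussKernel a b x w = gaussKernel a b w x := by
  simp only [gaussKernel, real_inner_comm x w, add_comm (‖x‖ ^ 2)]

theorem gaussKernel_nonneg (hb : 0 ≤ b) (x w : Vec n) : 0 ≤ gaussKernel a b x w := by
  unfold gaussKernel; positivity

/-- By Cauchy–Schwarz and `b ≤ a` the exponent is at most `-(b/2)(‖x‖ - ‖w‖)²`. -/
theorem gaussKernel_exponent_nonpos (hb : 0 ≤ b) (hab : b ≤ a) (x w : Vec n) :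
    -(a / 2) * (‖x‖ ^ 2 + ‖w‖ ^ 2) + b * inner ℝ x w ≤ 0 := by
  have h1 := real_inner_le_norm x w
  have h2 : b * inner ℝ x w ≤ b * (‖x‖ * ‖w‖) := mul_le_mul_of_nonneg_left h1 hb
  nlinarith [sq_nonneg (‖x‖ - ‖w‖), sq_nonneg ‖x‖, sq_nonneg ‖w‖]

theorem gaussKernel_le (hb : 0 ≤ b) (hab : b ≤ a) (x w : Vec n) :
    gaussKernel a b x w ≤ (b / (2 * Real.pi)) ^ ((n : ℝ) / 2) := by
  unfold gaussKernel
  refine mul_le_of_le_one_right (by positivity) ?_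
  exact Real.exp_le_one_iff.2 (gaussKernel_exponent_nonpos hb hab x w)

theorem continuous_gaussKernel (a b : ℝ) :
    Continuous fun p : Vec n × Vec n => gaussKernel a b p.1 p.2 := by
  unfold gaussKernel; fun_prop

theorem integrable_gaussKernel (ha : 0 < a) (x : Vec n) :
    Integrable fun w => gaussKernel a b x w := by
  have h := (integrable_exp_neg_mul_sq_add_inner (half_pos ha) (b • x)).const_mul
    ((b / (2 * Real.pi)) ^ ((n : ℝ) / 2) * Real.exp (-(a / 2) * ‖x‖ ^ 2))
  refine h.congr (Eventually.of_forall fun w => ?_)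
  simp only [gaussKernel]
  rw [mul_assoc, ← Real.exp_add, real_inner_smul_left]
  ring_nf

theorem integral_gaussKernel (ha : 0 < a) (hb : 0 ≤ b) (x : Vec n) :
    ∫ w, gaussKernel a b x w
      = (b / a) ^ ((n : ℝ) / 2) * Real.exp (-((a ^ 2 - b ^ 2) / (2 * a)) * ‖x‖ ^ 2) := by
  have h := integral_exp_neg_mul_sq_add_inner (half_pos ha) (b • x)
  have e : ∀ w, gaussKernel a b x w
      = ((b / (2 * Real.pi)) ^ ((n : ℝ) / 2) * Real.exp (-(a / 2) * ‖x‖ ^ 2))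
        * Real.exp (-(a / 2) * ‖w‖ ^ 2 + inner ℝ (b • x) w) := fun w => by
    simp only [gaussKernel]
    rw [mul_assoc, ← Real.exp_add, real_inner_smul_left]
    ring_nf
  simp only [e]
  rw [integral_const_mul, h, mul_mul_mul_comm, ← Real.mul_rpow (by positivity) (by positivity),
    ← Real.exp_add, norm_smul, Real.norm_of_nonneg hb]
  congr 2
  · field_simp
  · field_simp; ring

/-- Completing the square in `w` leaves a Gaussian in `(x, y)` with possibly different coefficients
of `‖x‖²` and `‖y‖²`. They coincide when both factors are Mehler kernels of the same frequency. -/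
theorem integral_gaussKernel_mul_gaussKernel (ha : 0 < a) (hb : 0 ≤ b) (ha' : 0 < a')
    (hb' : 0 ≤ b') (x y : Vec n) :
    ∫ w, gaussKernel a b x w * gaussKernel a' b' w y
      = (b * b' / (a + a') / (2 * Real.pi)) ^ ((n : ℝ) / 2)
        * Real.exp (-((a - b ^ 2 / (a + a')) / 2) * ‖x‖ ^ 2
          - ((a' - b' ^ 2 / (a + a')) / 2) * ‖y‖ ^ 2 + b * b' / (a + a') * inner ℝ x y) := by
  have hs : 0 < (a + a') / 2 := by positivity
  have h := integral_exp_neg_mul_sq_add_inner hs (b • x + b' • y)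
  have e : ∀ w, gaussKernel a b x w * gaussKernel a' b' w y
      = ((b / (2 * Real.pi)) ^ ((n : ℝ) / 2) * (b' / (2 * Real.pi)) ^ ((n : ℝ) / 2)
          * Real.exp (-(a / 2) * ‖x‖ ^ 2 - (a' / 2) * ‖y‖ ^ 2))
        * Real.exp (-((a + a') / 2) * ‖w‖ ^ 2 + inner ℝ (b • x + b' • y) w) := fun w => by
    simp only [gaussKernel]
    rw [mul_mul_mul_comm, ← Real.exp_add, mul_assoc _ (Real.exp _), ← Real.exp_add,
      inner_add_left, real_inner_smul_left, real_inner_smul_left, real_inner_comm w y]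
    ring_nf
  simp only [e]
  rw [integral_const_mul, h, ← Real.mul_rpow (by positivity) (by positivity), mul_mul_mul_comm,
    ← Real.mul_rpow (by positivity) (by positivity), ← Real.exp_add, norm_add_sq_real,
    norm_smul, norm_smul, Real.norm_of_nonneg hb, Real.norm_of_nonneg hb', real_inner_smul_left,
    real_inner_smul_right]
  congr 2
  · field_simp
  · field_simp
    ring

theorem integrable_gaussKernel_mul_gaussKernel (ha : 0 < a) (hb' : 0 ≤ b') (hab' : b' ≤ a')
    (x y : Vec n) : Integrable fun w => gaussKernel a b x w * gaussKernel a' b' w y := by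
  refine (integrable_gaussKernel (b := b) ha x).mul_bdd
    (c := (b' / (2 * Real.pi)) ^ ((n : ℝ) / 2)) ?_ (Eventually.of_forall fun w => ?_)
  · exact ((continuous_gaussKernel a' b').comp
      (continuous_id.prodMk continuous_const)).aestronglyMeasurable
  · rw [Real.norm_of_nonneg (gaussKernel_nonneg hb' _ _)]
    exact gaussKernel_le hb' hab' _ _

end gaussKernel

/-! ### Mehler kernels -/

/-- The Mehler kernel with frequency `Ω` and phase `s`. -/
def mehler {n : ℕ} (Ω s : ℝ) (x w : Vec n) : ℝ :=
  gaussKernel (Ω * (Real.cosh s / Real.sinh s)) (Ω / Real.sinh s) x w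

section mehler

variable {n : ℕ} {Ω s s' : ℝ}

theorem mehler_params (hΩ : 0 < Ω) (hs : 0 < s) : 0 < Ω / Real.sinh s ∧
    Ω / Real.sinh s ≤ Ω * (Real.cosh s / Real.sinh s) := by
  have h := Real.sinh_pos_iff.2 hs
  refine ⟨by positivity, ?_⟩
  rw [← mul_div_assoc]
  have := Real.one_le_cosh s
  gcongr
  nlinarith

theorem mehler_comm (Ω s : ℝ) (x w : Vec n) : mehler Ω s x w = mehler Ω s w x :=
  gaussKernel_comm _ _ _ _

theorem mehler_nonneg (hΩ : 0 < Ω) (hs : 0 < s) (x w : Vec n) : 0 ≤ mehler Ω s x w :=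
  gaussKernel_nonneg (mehler_params hΩ hs).1.le _ _

theorem mehler_le (hΩ : 0 < Ω) (hs : 0 < s) (x w : Vec n) :
    mehler Ω s x w ≤ (Ω / Real.sinh s / (2 * Real.pi)) ^ ((n : ℝ) / 2) :=
  gaussKernel_le (mehler_params hΩ hs).1.le (mehler_params hΩ hs).2 _ _

theorem integrable_mehler (hΩ : 0 < Ω) (hs : 0 < s) (x : Vec n) :
    Integrable fun w => mehler Ω s x w :=
  integrable_gaussKernel ((mehler_params hΩ hs).1.trans_le (mehler_params hΩ hs).2) x

theorem integral_mehler (hΩ : 0 < Ω) (hs : 0 < s) (x : Vec n) :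
    ∫ w, mehler Ω s x w
      = (1 / Real.cosh s) ^ ((n : ℝ) / 2)
        * Real.exp (-(Ω * (Real.sinh s / Real.cosh s) / 2) * ‖x‖ ^ 2) := by
  obtain ⟨h1, h2⟩ := mehler_params hΩ hs
  have hsh := Real.sinh_pos_iff.2 hs
  have hch := Real.cosh_pos s
  unfold mehler
  rw [integral_gaussKernel (h1.trans_le h2) h1.le]
  congr 2
  · field_simp
  · have := Real.cosh_sq s
    field_simp
    rw [this]; ring

theorem integrable_mehler_mul_mehler {Ω' : ℝ} (hΩ : 0 < Ω) (hΩ' : 0 < Ω') (hs : 0 < s)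
    (hs' : 0 < s') (x y : Vec n) : Integrable fun w => mehler Ω s x w * mehler Ω' s' w y :=
  integrable_gaussKernel_mul_gaussKernel ((mehler_params hΩ hs).1.trans_le (mehler_params hΩ hs).2)
    (mehler_params hΩ' hs').1.le (mehler_params hΩ' hs').2 x y

/-- The semigroup property of the Mehler kernels. -/
theorem integral_mehler_mul_mehler (hΩ : 0 < Ω) (hs : 0 < s) (hs' : 0 < s') (x y : Vec n) :
    ∫ w, mehler Ω s x w * mehler Ω s' w y = mehler Ω (s + s') x y := by
  obtain ⟨h1, h2⟩ := mehler_params hΩ hs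
  obtain ⟨h1', h2'⟩ := mehler_params hΩ hs'
  have hsh := Real.sinh_pos_iff.2 hs
  have hsh' := Real.sinh_pos_iff.2 hs'
  have hss := Real.sinh_pos_iff.2 (add_pos hs hs')
  -- `coth s + coth s' = sinh (s + s') / (sinh s * sinh s')`.
  have hsum : Ω * (Real.cosh s / Real.sinh s) + Ω * (Real.cosh s' / Real.sinh s')
      = Ω * Real.sinh (s + s') / (Real.sinh s * Real.sinh s') := by
    rw [Real.sinh_add]; field_simp; ring
  have eb : Ω / Real.sinh s * (Ω / Real.sinh s') / (Ω * (Real.cosh s / Real.sinh s)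
      + Ω * (Real.cosh s' / Real.sinh s')) = Ω / Real.sinh (s + s') := by
    rw [hsum]; field_simp
  -- After `hsum` this is the identity for the coefficient of one quadratic term. It is used twice,
  -- with `s` and `s'` interchanged, for `‖x‖²` and for `‖y‖²`.
  have ea : ∀ {r r' : ℝ}, 0 < Real.sinh r → 0 < Real.sinh r' → 0 < Real.sinh (r + r') →
      Ω * (Real.cosh r / Real.sinh r) - (Ω / Real.sinh r) ^ 2 /
        (Ω * Real.sinh (r + r') / (Real.sinh r * Real.sinh r'))
      = Ω * (Real.cosh (r + r') / Real.sinh (r + r')) := by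
    intro r r' h h' h''
    field_simp
    rw [Real.sinh_add, Real.cosh_add]
    have := Real.cosh_sq r
    linear_combination Real.sinh r' * this
  unfold mehler
  rw [integral_gaussKernel_mul_gaussKernel (h1.trans_le h2) h1.le (h1'.trans_le h2') h1'.le, eb]
  rw [hsum, ea hsh hsh' hss]
  have h3 := ea hsh' hsh (by rwa [add_comm])
  rw [add_comm s' s, mul_comm (Real.sinh s')] at h3
  rw [h3, gaussKernel]
  ring_nf

end mehler

/-- Fatou's lemma: bounded integrals of nonnegative functions bound the integral of the pointwise
limit. -/
theorem integrable_of_tendsto_of_nonneg {α : Type*} [MeasurableSpace α] {μ : Measure α}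
    {F : ℕ → α → ℝ} {f : α → ℝ} {L : ℝ} (hF : ∀ n, Integrable (F n) μ) (h0 : ∀ n x, 0 ≤ F n x)
    (hf : AEStronglyMeasurable f μ) (h : ∀ x, Tendsto (fun n => F n x) atTop (𝓝 (f x)))
    (hL : Tendsto (fun n => ∫ x, F n x ∂μ) atTop (𝓝 L)) : Integrable f μ := by
  refine ⟨hf, ?_⟩
  have h1 : ∫⁻ x, ‖f x‖ₑ ∂μ ≤ liminf (fun n => ∫⁻ x, ‖F n x‖ₑ ∂μ) atTop := by
    refine (lintegral_congr fun x => ((h x).enorm.liminf_eq).symm).trans_le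
      (lintegral_liminf_le' fun n => (hF n).aestronglyMeasurable.enorm)
  have h2 : ∀ n, ∫⁻ x, ‖F n x‖ₑ ∂μ = ENNReal.ofReal (∫ x, F n x ∂μ) := fun n => by
    rw [ofReal_integral_eq_lintegral_ofReal (hF n) (Eventually.of_forall (h0 n))]
    exact lintegral_congr fun x => Real.enorm_of_nonneg (h0 n x)
  simp only [h2] at h1
  rw [(ENNReal.tendsto_ofReal hL).liminf_eq] at h1
  exact h1.trans_lt ENNReal.ofReal_lt_top

/-! ### The cosine transform of a function on `ℝᵏ` -/

/-- The centred Gaussian probability density on `ℝᵏ` with covariance `2c`. -/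
def gaussDensity {k : ℕ} (c : ℝ) (ζ : Vec k) : ℝ :=
  (1 / (4 * Real.pi * c)) ^ ((k : ℝ) / 2) * Real.exp (-(1 / (4 * c)) * ‖ζ‖ ^ 2)

/-- The normalized cosine transform `(2π)^{-k} ∫ G(ξ) cos(ξ·y) dξ`. -/
def cosTransform {k : ℕ} (G : Vec k → ℝ) (y : Vec k) : ℝ :=
  (1 / (2 * Real.pi) ^ (k : ℝ)) * ∫ ξ, G ξ * Real.cos (inner ℝ ξ y)

section cosTransform

variable {k : ℕ} {G : Vec k → ℝ} {c : ℝ}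

theorem gaussDensity_nonneg (hc : 0 < c) (ζ : Vec k) : 0 ≤ gaussDensity c ζ := by
  unfold gaussDensity; positivity

theorem continuous_gaussDensity (c : ℝ) : Continuous (gaussDensity c : Vec k → ℝ) := by
  unfold gaussDensity; fun_prop

theorem integrable_gaussDensity (hc : 0 < c) : Integrable (gaussDensity c : Vec k → ℝ) := by
  unfold gaussDensity
  exact (integrable_exp_neg_mul_sq_norm (by positivity)).const_mul _

theorem integral_gaussDensity (hc : 0 < c) : ∫ ζ : Vec k, gaussDensity c ζ = 1 := by
  unfold gaussDensity
  rw [integral_const_mul, integral_exp_neg_mul_sq_norm (by positivity),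
    ← Real.mul_rpow (by positivity) (by positivity)]
  have : 1 / (4 * Real.pi * c) * (Real.pi / (1 / (4 * c))) = 1 := by field_simp
  rw [this, Real.one_rpow]

theorem gaussDensity_neg (c : ℝ) (ζ : Vec k) : gaussDensity c (-ζ) = gaussDensity c ζ := by
  simp [gaussDensity]

theorem integrable_mul_cos (hG : Integrable G) (y : Vec k) :
    Integrable fun ξ => G ξ * Real.cos (inner ℝ ξ y) :=
  hG.mul_bdd (c := 1) (by fun_prop) (Eventually.of_forall fun ξ => Real.abs_cos_le_one _)

theorem cosTransform_neg (G : Vec k → ℝ) (y : Vec k) :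
    cosTransform G (-y) = cosTransform G y := by
  simp [cosTransform, inner_neg_right]

theorem continuous_cosTransform (hG : Integrable G) : Continuous (cosTransform G) := by
  unfold cosTransform
  refine continuous_const.mul (continuous_of_dominated (bound := fun ξ => ‖G ξ‖)
    (fun y => (integrable_mul_cos hG y).aestronglyMeasurable)
    (fun y => Eventually.of_forall fun ξ => ?_) hG.norm (Eventually.of_forall fun ξ => ?_))
  · rw [norm_mul]
    exact mul_le_of_le_one_right (norm_nonneg _) (Real.abs_cos_le_one _)
  · fun_prop

/-- Multiplying a cosine transform by `exp(-c‖u‖²)` corresponds to averaging its source against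
`gaussDensity c`; this duality regularizes the Fourier inversion below. -/
theorem gaussDensity_eq_integral_cos (hc : 0 < c) (ζ : Vec k) :
    1 / (2 * Real.pi) ^ (k : ℝ) * ∫ u : Vec k, Real.cos (inner ℝ ζ u) * Real.exp (-c * ‖u‖ ^ 2)
      = gaussDensity c ζ := by
  rw [integral_cos_mul_exp_neg_mul_sq_norm hc, gaussDensity, ← mul_assoc]
  congr 1
  · have : (2 * Real.pi) ^ (k : ℝ) = (4 * Real.pi ^ 2) ^ ((k : ℝ) / 2) := by
      rw [show 4 * Real.pi ^ 2 = (2 * Real.pi) ^ (2 : ℝ) by rw [Real.rpow_two]; ring,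
        ← Real.rpow_mul (by positivity)]
      congr 1; ring
    rw [this, ← Real.one_rpow ((k : ℝ) / 2), ← Real.div_rpow (by positivity) (by positivity),
      ← Real.mul_rpow (by positivity) (by positivity), Real.one_rpow]
    congr 1
    field_simp
  · congr 1; ring

/-- Integrating the cosine transform against a Gaussian wave packet. -/
theorem integral_cosTransform_mul (hG : Integrable G) (heven : ∀ ξ, G (-ξ) = G ξ) (hc : 0 < c)
    (η : Vec k) :
    ∫ u, cosTransform G u * (Real.cos (inner ℝ η u) * Real.exp (-c * ‖u‖ ^ 2))
      = ∫ ξ, G ξ * gaussDensity c (ξ - η) := by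
  have hF : Integrable (fun p : Vec k × Vec k => G p.2 * Real.cos (inner ℝ p.2 p.1)
      * (Real.cos (inner ℝ η p.1) * Real.exp (-c * ‖p.1‖ ^ 2))) (volume.prod volume) := by
    have h := (integrable_exp_neg_mul_sq_norm (n := k) hc).mul_prod hG
    have h2 := h.mul_bdd (c := 1) (g := fun p : Vec k × Vec k =>
      Real.cos (inner ℝ p.2 p.1) * Real.cos (inner ℝ η p.1)) (by fun_prop)
      (Eventually.of_forall fun p => by
        rw [norm_mul]
        exact mul_le_one₀ (Real.abs_cos_le_one _) (norm_nonneg _) (Real.abs_cos_le_one _))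
    refine h2.congr (Eventually.of_forall fun p => ?_)
    simp only; ring
  have e1 : ∀ u : Vec k, cosTransform G u * (Real.cos (inner ℝ η u) * Real.exp (-c * ‖u‖ ^ 2))
      = 1 / (2 * Real.pi) ^ (k : ℝ) * ∫ ξ, G ξ * Real.cos (inner ℝ ξ u)
      * (Real.cos (inner ℝ η u) * Real.exp (-c * ‖u‖ ^ 2)) := fun u => by
    rw [integral_mul_const, cosTransform, mul_assoc]
  simp only [e1]
  rw [integral_const_mul, integral_integral_swap hF, ← integral_const_mul]
  -- The product of the two cosines splits into cosines of `ξ - η` and `ξ + η`, each producing half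
  -- a Gaussian density. Evenness of `G` later merges the two halves.
  have e2 : ∀ ξ : Vec k, 1 / (2 * Real.pi) ^ (k : ℝ) * ∫ u, G ξ * Real.cos (inner ℝ ξ u)
      * (Real.cos (inner ℝ η u) * Real.exp (-c * ‖u‖ ^ 2))
      = 1 / 2 * (G ξ * gaussDensity c (ξ - η)) + 1 / 2 * (G ξ * gaussDensity c (ξ + η)) := by
    intro ξ
    rw [← gaussDensity_eq_integral_cos hc, ← gaussDensity_eq_integral_cos hc]
    have e3 : ∀ u : Vec k, G ξ * Real.cos (inner ℝ ξ u)
        * (Real.cos (inner ℝ η u) * Real.exp (-c * ‖u‖ ^ 2))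
        = G ξ / 2 * (Real.cos (inner ℝ (ξ - η) u) * Real.exp (-c * ‖u‖ ^ 2)
          + Real.cos (inner ℝ (ξ + η) u) * Real.exp (-c * ‖u‖ ^ 2)) := fun u => by
      rw [inner_sub_left, inner_add_left, Real.cos_sub, Real.cos_add]; ring
    simp only [e3]
    rw [integral_const_mul, integral_add (integrable_cos_mul_exp_neg_mul_sq_norm hc _)
      (integrable_cos_mul_exp_neg_mul_sq_norm hc _)]
    ring
  simp only [e2]
  have hint : ∀ η : Vec k, Integrable fun ξ => G ξ * gaussDensity c (ξ - η) := fun η =>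
    hG.mul_bdd (c := (1 / (4 * Real.pi * c)) ^ ((k : ℝ) / 2))
      ((continuous_gaussDensity c).comp (continuous_id.sub continuous_const)).aestronglyMeasurable
      (Eventually.of_forall fun ξ => by
        rw [Real.norm_of_nonneg (gaussDensity_nonneg hc _), gaussDensity]
        refine mul_le_of_le_one_right (by positivity) (Real.exp_le_one_iff.2 ?_)
        have : 0 ≤ 1 / (4 * c) * ‖ξ - η‖ ^ 2 := by positivity
        linarith)
  have hint' : Integrable fun ξ => G ξ * gaussDensity c (ξ + η) := by
    simpa using hint (-η)
  rw [integral_add ((hint η).const_mul _) (hint'.const_mul _), integral_const_mul,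
    integral_const_mul]
  have : ∫ ξ, G ξ * gaussDensity c (ξ + η) = ∫ ξ, G ξ * gaussDensity c (ξ - η) := by
    rw [← integral_neg_eq_self]
    refine integral_congr_ae (Eventually.of_forall fun ξ => ?_)
    simp only [heven]
    rw [← gaussDensity_neg, neg_add, neg_neg, sub_eq_add_neg]
  rw [this]; ring

/-- Gaussian densities are an approximate identity. -/
theorem tendsto_integral_mul_gaussDensity {C L : ℝ} (hm : Measurable G) (hC : ∀ ξ, |G ξ| ≤ C)
    {η : Vec k} (hL : Tendsto (fun ζ => G (η + ζ)) (𝓝[≠] 0) (𝓝 L)) (hk : 1 ≤ k)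
    {R : ℕ → ℝ} (hR : ∀ n, 0 < R n) (hR0 : Tendsto R atTop (𝓝 0)) :
    Tendsto (fun n => ∫ ξ, G ξ * gaussDensity (R n ^ 2 / 4) (ξ - η)) atTop (𝓝 L) := by
  have : Nontrivial (Vec k) := by
    have : Nonempty (Fin k) := ⟨⟨0, hk⟩⟩
    infer_instance
  -- Substitution `ξ = η + R ζ`. With parameter `R² / 4` the density is exactly the `R`-dilate of
  -- `gaussDensity (1 / 4)`, so the dominating function does not depend on `n`.
  have key : ∀ n, ∫ ξ, G ξ * gaussDensity (R n ^ 2 / 4) (ξ - η)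
      = ∫ ζ, G (η + R n • ζ) * gaussDensity (1 / 4) ζ := by
    intro n
    have h1 := integral_add_right_eq_self (μ := volume)
      (fun ξ => G ξ * gaussDensity (R n ^ 2 / 4) (ξ - η)) η
    rw [← h1]
    have h2 := Measure.integral_comp_smul volume
      (fun ξ => G (ξ + η) * gaussDensity (R n ^ 2 / 4) (ξ + η - η)) (R n)
    have hRk : 0 < R n ^ k := pow_pos (hR n) k
    rw [finrank_euclideanSpace_fin, abs_of_pos (inv_pos.2 hRk), smul_eq_mul,
      eq_inv_mul_iff_mul_eq₀ hRk.ne'] at h2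
    rw [← h2, ← integral_const_mul]
    refine integral_congr_ae (Eventually.of_forall fun ζ => ?_)
    have hRn := hR n
    have e4 : R n ^ k * (1 / (4 * Real.pi * (R n ^ 2 / 4))) ^ ((k : ℝ) / 2)
        = (1 / (4 * Real.pi * (1 / 4))) ^ ((k : ℝ) / 2) := by
      have : R n ^ k = (R n ^ 2) ^ ((k : ℝ) / 2) := by
        rw [← Real.rpow_natCast (R n) 2, ← Real.rpow_mul hRn.le, ← Real.rpow_natCast]
        congr 1; push_cast; ring
      rw [this, ← Real.mul_rpow (by positivity) (by positivity)]
      congr 1; field_simp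
    simp only [gaussDensity, add_sub_cancel_right, norm_smul, Real.norm_of_nonneg hRn.le]
    rw [← e4, add_comm η]
    have : -(1 / (4 * (R n ^ 2 / 4))) * (R n * ‖ζ‖) ^ 2 = -(1 / (4 * (1 / 4))) * ‖ζ‖ ^ 2 := by
      field_simp
    rw [this]; ring
  simp only [key]
  have hgoal : L = ∫ ζ : Vec k, L * gaussDensity (1 / 4) ζ := by
    rw [integral_const_mul, integral_gaussDensity (by norm_num), mul_one]
  rw [hgoal]
  -- Only the limit of `G` along `ζ ≠ 0` is available, which suffices since the origin is a null set
  -- for `k ≥ 1`. The later symbol is formed with `0 / 0 = 0` at zero frequency, so its value there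
  -- is not its limit.
  have h0 : ∀ᵐ ζ : Vec k, ζ ≠ 0 := by
    simp [ae_iff]
  refine tendsto_integral_of_dominated_convergence (fun ζ => C * gaussDensity (1 / 4) ζ)
    (fun n => ?_) ((integrable_gaussDensity (by norm_num)).const_mul C)
    (fun n => Eventually.of_forall fun ζ => ?_) ?_
  · exact ((hm.comp (by fun_prop)).mul (continuous_gaussDensity _).measurable).aestronglyMeasurable
  · rw [norm_mul, Real.norm_of_nonneg (gaussDensity_nonneg (by norm_num) ζ)]
    exact mul_le_mul_of_nonneg_right (hC _) (gaussDensity_nonneg (by norm_num) ζ)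
  · filter_upwards [h0] with ζ hζ
    refine Tendsto.mul_const _ (hL.comp (tendsto_nhdsWithin_iff.2 ⟨?_, ?_⟩))
    · simpa using hR0.smul_const ζ
    · exact Eventually.of_forall fun n => smul_ne_zero (hR n).ne' hζ

/-- Damped by Gaussians of increasing width, the transform has integrals equal to averages of `G`
around `0`, and these converge to `L`. Since the transform is nonnegative, Fatou's lemma applies. -/
theorem integrable_cosTransform {C L : ℝ} (hG : Integrable G) (heven : ∀ ξ, G (-ξ) = G ξ)
    (hm : Measurable G) (hC : ∀ ξ, |G ξ| ≤ C) (hk : 1 ≤ k)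
    (hL : Tendsto G (𝓝[≠] 0) (𝓝 L)) (hpos : ∀ y, 0 ≤ cosTransform G y) :
    Integrable (cosTransform G) := by
  have hR : ∀ n : ℕ, 0 < 1 / ((n : ℝ) + 1) := fun n => Nat.one_div_pos_of_nat
  have hR0 := tendsto_one_div_add_atTop_nhds_zero_nat (𝕜 := ℝ)
  have h1 := tendsto_integral_mul_gaussDensity hm hC (η := 0) (by simpa using hL) hk hR hR0
  have h2 : ∀ n : ℕ, ∫ u, cosTransform G u * Real.exp (-((1 / ((n : ℝ) + 1)) ^ 2 / 4) * ‖u‖ ^ 2)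
      = ∫ ξ, G ξ * gaussDensity ((1 / ((n : ℝ) + 1)) ^ 2 / 4) (ξ - 0) := fun n => by
    rw [← integral_cosTransform_mul hG heven (by have := hR n; positivity) 0]
    simp
  simp only [← h2] at h1
  have hbd : ∃ B, ∀ u, |cosTransform G u| ≤ B := by
    refine ⟨1 / (2 * Real.pi) ^ (k : ℝ) * ∫ ξ, ‖G ξ‖, fun u => ?_⟩
    rw [cosTransform, abs_mul, abs_of_nonneg (a := 1 / (2 * Real.pi) ^ (k : ℝ)) (by positivity)]
    gcongr
    refine norm_integral_le_of_norm_le (f := fun ξ => G ξ * Real.cos (inner ℝ ξ u)) hG.norm (Eventually.of_forall fun ξ => ?_)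
    rw [norm_mul]
    exact mul_le_of_le_one_right (norm_nonneg _) (Real.abs_cos_le_one _)
  obtain ⟨B, hB⟩ := hbd
  have hcont := continuous_cosTransform hG
  have hint : ∀ n : ℕ, Integrable fun u =>
      cosTransform G u * Real.exp (-((1 / ((n : ℝ) + 1)) ^ 2 / 4) * ‖u‖ ^ 2) := fun n =>
    (integrable_exp_neg_mul_sq_norm (by have := hR n; positivity)).bdd_mul (c := B)
      hcont.aestronglyMeasurable (Eventually.of_forall hB)
  refine integrable_of_tendsto_of_nonneg hint (fun n u => mul_nonneg (hpos u) (Real.exp_nonneg _))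
    hcont.aestronglyMeasurable (fun u => ?_) h1
  have : Tendsto (fun n : ℕ => -((1 / ((n : ℝ) + 1)) ^ 2 / 4) * ‖u‖ ^ 2) atTop (𝓝 0) := by
    have := (((hR0.pow 2).div_const 4).neg).mul_const (‖u‖ ^ 2)
    simpa using this
  simpa using (this.rexp).const_mul (cosTransform G u)

/-- Fourier inversion for nonnegative cosine transforms. -/
theorem integral_cosTransform_mul_cos {C L : ℝ} (hG : Integrable G) (heven : ∀ ξ, G (-ξ) = G ξ)
    (hm : Measurable G) (hC : ∀ ξ, |G ξ| ≤ C) (hk : 1 ≤ k)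
    (hint : Integrable (cosTransform G)) {η : Vec k}
    (hL : Tendsto (fun ζ => G (η + ζ)) (𝓝[≠] 0) (𝓝 L)) :
    ∫ u, cosTransform G u * Real.cos (inner ℝ η u) = L := by
  have hR : ∀ n : ℕ, 0 < 1 / ((n : ℝ) + 1) := fun n => Nat.one_div_pos_of_nat
  have hR0 := tendsto_one_div_add_atTop_nhds_zero_nat (𝕜 := ℝ)
  have h1 := tendsto_integral_mul_gaussDensity hm hC hL hk hR hR0
  refine tendsto_nhds_unique ?_ h1
  have h2 := fun n : ℕ => integral_cosTransform_mul (c := (1 / ((n : ℝ) + 1)) ^ 2 / 4) hG heven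
    (by have := hR n; positivity) η
  simp only [← h2]
  refine tendsto_integral_of_dominated_convergence (fun u => ‖cosTransform G u‖) (fun n => ?_)
    hint.norm (fun n => Eventually.of_forall fun u => ?_) (Eventually.of_forall fun u => ?_)
  · exact ((continuous_cosTransform hG).mul (by fun_prop)).aestronglyMeasurable
  · rw [norm_mul, norm_mul]
    refine mul_le_of_le_one_right (norm_nonneg _) (mul_le_one₀ (Real.abs_cos_le_one _)
      (norm_nonneg _) ?_)
    rw [Real.norm_eq_abs, Real.abs_exp, Real.exp_le_one_iff]
    have := hR n
    have : 0 ≤ (1 / ((n : ℝ) + 1)) ^ 2 / 4 * ‖u‖ ^ 2 := by positivity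
    linarith
  · have : Tendsto (fun n : ℕ => -((1 / ((n : ℝ) + 1)) ^ 2 / 4) * ‖u‖ ^ 2) atTop (𝓝 0) := by
      have := (((hR0.pow 2).div_const 4).neg).mul_const (‖u‖ ^ 2)
      simpa using this
    simpa using (this.rexp.const_mul (Real.cos (inner ℝ η u))).const_mul (cosTransform G u)

end cosTransform

/-! ### Positivity of the heat kernel

The cosine transform of the Mehler kernel is nonnegative: in the Trotter approximation
every kernel is a superposition of Gaussians in the frequency variable. -/

theorem measurable_mehler {n : ℕ} :
    Measurable fun p : (ℝ × ℝ) × Vec n × Vec n => mehler p.1.1 p.1.2 p.2.1 p.2.2 := by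
  unfold mehler gaussKernel
  have h1 : Measurable fun p : (ℝ × ℝ) × Vec n × Vec n => p.1.1 / Real.sinh p.1.2 := by fun_prop
  have h2 : Measurable fun p : (ℝ × ℝ) × Vec n × Vec n =>
    p.1.1 * (Real.cosh p.1.2 / Real.sinh p.1.2) := by fun_prop
  have h3 : Measurable fun p : (ℝ × ℝ) × Vec n × Vec n => (inner ℝ p.2.1 p.2.2 : ℝ) := by fun_prop
  have h4 : Measurable fun p : (ℝ × ℝ) × Vec n × Vec n => ‖p.2.1‖ ^ 2 + ‖p.2.2‖ ^ 2 := by fun_prop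
  exact ((h1.div_const _).pow_const _).mul
    ((((h2.div_const _).neg.mul h4).add (h1.mul h3)).exp)

/-- Superadditivity from the addition formula and `cosh ≥ 1`. It gives bounds on Trotter products
that depend only on the total time. -/
theorem mul_sinh_le_sinh_mul {θ : ℝ} (hθ : 0 ≤ θ) (n : ℕ) :
    n * Real.sinh θ ≤ Real.sinh (n * θ) := by
  induction n with
  | zero => simp
  | succ n ih =>
    push_cast
    rw [add_mul, one_mul, add_mul (n : ℝ), one_mul, Real.sinh_add]
    have h1 := Real.one_le_cosh θ
    have h2 := Real.one_le_cosh (n * θ)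
    have h3 := Real.sinh_nonneg_iff.2 hθ
    have h4 := Real.sinh_nonneg_iff.2 (by positivity : 0 ≤ n * θ)
    nlinarith [mul_nonneg h4 (sub_nonneg.2 h1), mul_nonneg h3 (sub_nonneg.2 h2)]

/-- The phase of one step of length `h` of the Trotter approximation at frequency `ω`. -/
def trotterPhase (h ω : ℝ) : ℝ := 2 * Real.arsinh (ω * h / 2)

/-- The effective frequency of the Trotter approximation of step `h` at frequency `ω`. -/
def trotterFreq (h ω : ℝ) : ℝ := Real.sinh (trotterPhase h ω) / h

section trotter

variable {h ω : ℝ}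

theorem trotterPhase_pos (hh : 0 < h) (hω : 0 < ω) : 0 < trotterPhase h ω :=
  mul_pos two_pos (Real.arsinh_pos_iff.2 (by positivity))

theorem trotterFreq_pos (hh : 0 < h) (hω : 0 < ω) : 0 < trotterFreq h ω :=
  div_pos (Real.sinh_pos_iff.2 (trotterPhase_pos hh hω)) hh

/-- This explains the choice of phase: `sinh (θ/2) = ωh/2` makes `cosh θ - 1` exactly quadratic in
`ω`, so that the frequency will enter through a Gaussian factor only. -/
theorem cosh_trotterPhase (h ω : ℝ) : Real.cosh (trotterPhase h ω) = 1 + ω ^ 2 * h ^ 2 / 2 := by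
  rw [trotterPhase, Real.cosh_two_mul, Real.cosh_sq, Real.sinh_arsinh]
  ring

/-- One symmetric Trotter step, the free heat kernel of time `h` between two half-steps of the
potential `ω²|x|²/2`, is an exact Mehler kernel: its parameters are `Ω / sinh θ = 1/h` and `Ω coth θ
= 1/h + ω²h/2`. Powers of the step are therefore Mehler kernels of the same frequency with
multiplied phase. -/
theorem mehler_trotter {n : ℕ} (hh : 0 < h) (hω : 0 < ω) (x w : Vec n) :
    mehler (trotterFreq h ω) (trotterPhase h ω) x w
      = Real.exp (-(h / 4 * (‖x‖ ^ 2 + ‖w‖ ^ 2)) * ω ^ 2) * gaussKernel (1 / h) (1 / h) x w := by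
  have hs := Real.sinh_pos_iff.2 (trotterPhase_pos hh hω)
  have e1 : trotterFreq h ω / Real.sinh (trotterPhase h ω) = 1 / h := by
    rw [trotterFreq]; field_simp
  rw [mehler, ← mul_div_assoc, mul_comm, mul_div_assoc, e1, cosh_trotterPhase, gaussKernel,
    gaussKernel, mul_left_comm, ← Real.exp_add]
  congr 2
  field_simp
  ring

/-- The bound is the maximum of the free heat kernel at the total time `m * h`, uniform in the
frequency and in the number of steps of a given total time. -/
theorem mehler_trotter_le {n : ℕ} (hh : 0 < h) (hω : 0 < ω) {m : ℕ} (hm : 1 ≤ m) (x w : Vec n) :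
    mehler (trotterFreq h ω) (m * trotterPhase h ω) x w
      ≤ (1 / (m * h) / (2 * Real.pi)) ^ ((n : ℝ) / 2) := by
  have hp := trotterPhase_pos hh hω
  have hm' : (0 : ℝ) < m := by exact_mod_cast hm
  have h0 := trotterFreq_pos hh hω
  have hs := Real.sinh_pos_iff.2 hp
  have hs' := Real.sinh_pos_iff.2 (mul_pos hm' hp)
  refine (mehler_le h0 (mul_pos hm' hp) x w).trans ?_
  refine Real.rpow_le_rpow (by positivity) ?_ (by positivity)
  gcongr ?_ / _
  rw [trotterFreq, div_div, div_le_div_iff₀ (by positivity) (by positivity)]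
  have := mul_sinh_le_sinh_mul hp.le m
  nlinarith

theorem measurable_mehler_trotter {n : ℕ} (h c : ℝ) {α : Type*} [MeasurableSpace α]
    {f : α → ℝ} {x w : α → Vec n} (hf : Measurable f) (hx : Measurable x) (hw : Measurable w) :
    Measurable fun p => mehler (trotterFreq h (f p)) (c * trotterPhase h (f p)) (x p) (w p) := by
  have h1 : Measurable fun p => trotterPhase h (f p) := by
    unfold trotterPhase
    exact (Real.continuous_arsinh.measurable.comp (by fun_prop)).const_mul 2
  have h2 : Measurable fun p => trotterFreq h (f p) := by
    unfold trotterFreq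
    exact (Real.measurable_sinh.comp h1).div_const h
  exact measurable_mehler.comp ((h2.prodMk (h1.const_mul c)).prodMk (hx.prodMk hw))

theorem ae_norm_pos {k : ℕ} (hk : 1 ≤ k) : ∀ᵐ ξ : Vec k, 0 < ‖ξ‖ := by
  have : Nontrivial (Vec k) := by
    have : Nonempty (Fin k) := ⟨⟨0, hk⟩⟩
    infer_instance
  simp [ae_iff]

/-- Positivity for the Trotter approximation with `m + 1` steps. -/
theorem integral_mehler_trotter_nonneg {N k : ℕ} (hk : 1 ≤ k) (hh : 0 < h) (m : ℕ) (x₀ : Vec N)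
    (y : Vec k) : ∀ (x : Vec N) (ε : ℝ), 0 < ε →
      0 ≤ ∫ ξ : Vec k, mehler (trotterFreq h ‖ξ‖) ((m + 1 : ℕ) * trotterPhase h ‖ξ‖) x x₀
        * (Real.cos (inner ℝ y ξ) * Real.exp (-ε * ‖ξ‖ ^ 2)) := by
  -- The point `x` and the damping `ε` stay universally quantified: peeling off one step replaces
  -- `x` by the intermediate point `w` and adds the Gaussian factor in `ξ` of that step to the
  -- damping.
  induction m with
  | zero =>
    intro x ε hε
    have hb : 0 < ε + h / 4 * (‖x‖ ^ 2 + ‖x₀‖ ^ 2) := by positivity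
    have : ∫ ξ : Vec k, mehler (trotterFreq h ‖ξ‖) ((0 + 1 : ℕ) * trotterPhase h ‖ξ‖) x x₀
        * (Real.cos (inner ℝ y ξ) * Real.exp (-ε * ‖ξ‖ ^ 2))
        = ∫ ξ : Vec k, gaussKernel (1 / h) (1 / h) x x₀ * (Real.cos (inner ℝ y ξ)
          * Real.exp (-(ε + h / 4 * (‖x‖ ^ 2 + ‖x₀‖ ^ 2)) * ‖ξ‖ ^ 2)) := by
      refine integral_congr_ae ?_
      filter_upwards [ae_norm_pos hk] with ξ hξ
      have e : -(ε + h / 4 * (‖x‖ ^ 2 + ‖x₀‖ ^ 2)) * ‖ξ‖ ^ 2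
          = -(h / 4 * (‖x‖ ^ 2 + ‖x₀‖ ^ 2)) * ‖ξ‖ ^ 2 + -ε * ‖ξ‖ ^ 2 := by ring
      rw [e, Real.exp_add]
      simp only [zero_add, Nat.cast_one, one_mul]
      rw [mehler_trotter hh hξ]
      ring
    rw [this, integral_const_mul, integral_cos_mul_exp_neg_mul_sq_norm hb]
    exact mul_nonneg (gaussKernel_nonneg (by positivity) _ _) (by positivity)
  | succ m ih =>
    intro x ε hε
    set M : ℝ := (1 / ((m + 1 : ℕ) * h) / (2 * Real.pi)) ^ ((N : ℝ) / 2) with hM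
    have hM0 : 0 ≤ M := by positivity
    set F : Vec k → Vec N → ℝ := fun ξ w =>
      mehler (trotterFreq h ‖ξ‖) (1 * trotterPhase h ‖ξ‖) x w
        * mehler (trotterFreq h ‖ξ‖) ((m + 1 : ℕ) * trotterPhase h ‖ξ‖) w x₀
        * (Real.cos (inner ℝ y ξ) * Real.exp (-ε * ‖ξ‖ ^ 2)) with hF
    have hpos : ∀ᵐ p : Vec k × Vec N ∂(volume.prod volume), 0 < ‖p.1‖ :=
      (Measure.quasiMeasurePreserving_fst (μ := (volume : Measure (Vec k)))
        (ν := (volume : Measure (Vec N)))).ae (ae_norm_pos hk)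
    have hint : Integrable (Function.uncurry F) (volume.prod volume) := by
      have hg := ((integrable_exp_neg_mul_sq_norm (n := k) hε).mul_prod
        (integrable_gaussKernel (b := 1 / h) (by positivity : 0 < 1 / h) x)).const_mul M
      refine hg.mono' ?_ ?_
      · refine Measurable.aestronglyMeasurable ?_
        exact ((measurable_mehler_trotter h 1 (by fun_prop) (by fun_prop) (by fun_prop)).mul
          (measurable_mehler_trotter h _ (by fun_prop) (by fun_prop) (by fun_prop))).mul
          (by fun_prop)
      · filter_upwards [hpos] with p hp
        simp only [hF, Function.uncurry, one_mul]
        rw [mehler_trotter hh hp, norm_mul, norm_mul, norm_mul, norm_mul,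
          Real.norm_of_nonneg (Real.exp_nonneg _), Real.norm_of_nonneg (Real.exp_nonneg _),
          Real.norm_of_nonneg (gaussKernel_nonneg (by positivity) _ _),
          Real.norm_of_nonneg (mehler_nonneg (trotterFreq_pos hh hp)
            (mul_pos (by positivity) (trotterPhase_pos hh hp)) _ _)]
        have h1 := mehler_trotter_le hh hp (Nat.le_add_left 1 m) p.2 x₀
        have h2 : Real.exp (-(h / 4 * (‖x‖ ^ 2 + ‖p.2‖ ^ 2)) * ‖p.1‖ ^ 2) ≤ 1 := by
          rw [Real.exp_le_one_iff]
          have : 0 ≤ h / 4 * (‖x‖ ^ 2 + ‖p.2‖ ^ 2) * ‖p.1‖ ^ 2 := by positivity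
          linarith
        have h3 : ‖Real.cos (inner ℝ y p.1)‖ ≤ 1 := Real.abs_cos_le_one _
        have h4 : 0 ≤ gaussKernel (1 / h) (1 / h) x p.2 := gaussKernel_nonneg (by positivity) _ _
        have h5 : 0 ≤ mehler (trotterFreq h ‖p.1‖) ((m + 1 : ℕ) * trotterPhase h ‖p.1‖) p.2 x₀ :=
          mehler_nonneg (trotterFreq_pos hh hp) (mul_pos (by positivity) (trotterPhase_pos hh hp)) _ _
        calc _ ≤ 1 * gaussKernel (1 / h) (1 / h) x p.2 * M * (1 * Real.exp (-ε * ‖p.1‖ ^ 2)) := by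
              gcongr
          _ = _ := by ring
    -- One step is split off by the semigroup property of Mehler kernels at the fixed frequency
    -- `trotterFreq h ‖ξ‖`.
    have e1 : ∫ ξ : Vec k, mehler (trotterFreq h ‖ξ‖) ((m + 1 + 1 : ℕ) * trotterPhase h ‖ξ‖) x x₀
        * (Real.cos (inner ℝ y ξ) * Real.exp (-ε * ‖ξ‖ ^ 2)) = ∫ ξ, ∫ w, F ξ w := by
      refine integral_congr_ae ?_
      filter_upwards [ae_norm_pos hk] with ξ hξ
      have hp := trotterPhase_pos hh hξ
      simp only [hF]
      rw [integral_mul_const, integral_mehler_mul_mehler (trotterFreq_pos hh hξ) (by positivity)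
        (by positivity)]
      congr 2
      push_cast
      ring
    rw [e1, integral_integral_swap hint]
    refine integral_nonneg fun w => ?_
    -- The split-off step is a `ξ`-independent positive kernel times a Gaussian in `ξ`, which is
    -- absorbed into `ε`.
    have e2 : ∫ ξ, F ξ w = ∫ ξ : Vec k, gaussKernel (1 / h) (1 / h) x w *
        (mehler (trotterFreq h ‖ξ‖) ((m + 1 : ℕ) * trotterPhase h ‖ξ‖) w x₀
        * (Real.cos (inner ℝ y ξ) * Real.exp (-(ε + h / 4 * (‖x‖ ^ 2 + ‖w‖ ^ 2)) * ‖ξ‖ ^ 2))) := by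
      refine integral_congr_ae ?_
      filter_upwards [ae_norm_pos hk] with ξ hξ
      have e : -(ε + h / 4 * (‖x‖ ^ 2 + ‖w‖ ^ 2)) * ‖ξ‖ ^ 2
          = -(h / 4 * (‖x‖ ^ 2 + ‖w‖ ^ 2)) * ‖ξ‖ ^ 2 + -ε * ‖ξ‖ ^ 2 := by ring
      simp only [hF, one_mul]
      rw [e, Real.exp_add, mehler_trotter hh hξ]
      ring
    simp only [Pi.zero_apply]
    rw [e2, integral_const_mul]
    exact mul_nonneg (gaussKernel_nonneg (by positivity) _ _) (ih w _ (by positivity))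

end trotter

/-! ### Convergence of the Trotter approximation to the Mehler kernel -/

theorem tendsto_gaussKernel {α : Type*} {l : Filter α} {n : ℕ} {a b : α → ℝ} {a₀ b₀ : ℝ}
    (ha : Tendsto a l (𝓝 a₀)) (hb : Tendsto b l (𝓝 b₀)) (x w : Vec n) :
    Tendsto (fun i => gaussKernel (a i) (b i) x w) l (𝓝 (gaussKernel a₀ b₀ x w)) := by
  unfold gaussKernel
  refine ((hb.div_const _).rpow_const (Or.inr (by positivity))).mul ?_
  exact (((ha.div_const 2).neg.mul_const _).add (hb.mul_const _)).rexp

theorem tendsto_mehler {α : Type*} {l : Filter α} {n : ℕ} {Ω s : α → ℝ} {Ω₀ s₀ : ℝ}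
    (hΩ : Tendsto Ω l (𝓝 Ω₀)) (hs : Tendsto s l (𝓝 s₀)) (h0 : 0 < s₀) (x w : Vec n) :
    Tendsto (fun i => mehler (Ω i) (s i) x w) l (𝓝 (mehler Ω₀ s₀ x w)) := by
  have hsh : Real.sinh s₀ ≠ 0 := (Real.sinh_pos_iff.2 h0).ne'
  have h1 := (Real.continuous_sinh.tendsto s₀).comp hs
  have h2 := (Real.continuous_cosh.tendsto s₀).comp hs
  exact tendsto_gaussKernel (hΩ.mul (h2.div h1 hsh)) (hΩ.div h1 hsh) x w

/-- To first order the phase of a step of length `h` is `ω * h`. So `n` steps of length `t / n`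
accumulate the phase `ω * t` in the limit, and the effective frequency `sinh θ / h` tends to `ω`. -/
theorem hasDerivAt_trotterPhase (t ω : ℝ) :
    HasDerivAt (fun s => trotterPhase (t * s) ω) (ω * t) 0 := by
  unfold trotterPhase
  have h1 : HasDerivAt (fun s : ℝ => ω * (t * s) / 2) (ω * t / 2) 0 := by
    have := ((hasDerivAt_id (0 : ℝ)).const_mul (ω * t / 2))
    simp only [mul_one, id] at this
    refine this.congr_of_eventuallyEq (Eventually.of_forall fun s => ?_)
    simp only; ring
  have h2 := (h1.arsinh).const_mul 2
  exact h2.congr_deriv (by simp; ring)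

theorem tendsto_trotterPhase (t ω : ℝ) :
    Tendsto (fun m : ℕ => ((m + 1 : ℕ) : ℝ) * trotterPhase (t * (1 / ((m : ℝ) + 1))) ω) atTop
      (𝓝 (ω * t)) := by
  have h := hasDerivAt_iff_tendsto_slope_zero.1 (hasDerivAt_trotterPhase t ω)
  have h0 : Tendsto (fun m : ℕ => 1 / ((m : ℝ) + 1)) atTop (𝓝[≠] 0) :=
    tendsto_nhdsWithin_iff.2 ⟨tendsto_one_div_add_atTop_nhds_zero_nat,
      Eventually.of_forall fun m => (Nat.one_div_pos_of_nat (n := m)).ne'⟩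
  refine (h.comp h0).congr fun m => ?_
  simp [trotterPhase]

theorem tendsto_trotterFreq {t : ℝ} (ht : 0 < t) (ω : ℝ) :
    Tendsto (fun m : ℕ => trotterFreq (t * (1 / ((m : ℝ) + 1))) ω) atTop (𝓝 ω) := by
  have h1 : HasDerivAt (fun s => Real.sinh (trotterPhase (t * s) ω)) (ω * t) 0 := by
    have := (hasDerivAt_trotterPhase t ω).sinh
    simpa [trotterPhase] using this
  have h := hasDerivAt_iff_tendsto_slope_zero.1 h1
  have h0 : Tendsto (fun m : ℕ => 1 / ((m : ℝ) + 1)) atTop (𝓝[≠] 0) :=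
    tendsto_nhdsWithin_iff.2 ⟨tendsto_one_div_add_atTop_nhds_zero_nat,
      Eventually.of_forall fun m => (Nat.one_div_pos_of_nat (n := m)).ne'⟩
  have h2 := (h.comp h0).div_const t
  rw [mul_div_cancel_right₀ _ ht.ne'] at h2
  refine h2.congr fun m => ?_
  simp [trotterPhase, trotterFreq]
  field_simp

/-! ### The symbol of the heat kernel: decay, limits and positivity -/

/-- The partial Fourier transform in `y` of the heat kernel. -/
def heatSymbol {N k : ℕ} (t : ℝ) (x w : Vec N) (ξ : Vec k) : ℝ := mehler ‖ξ‖ (‖ξ‖ * t) x w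

section heatSymbol

variable {N k : ℕ} {t : ℝ}

/-- From `sinh 2a = 2 sinh a cosh a` with `sinh a ≥ a` and `cosh a ≥ exp a / 2`. The exponential
factor is what makes the symbol integrable in `ξ`. -/
theorem div_sinh_le (ht : 0 < t) {ω : ℝ} (hω : 0 ≤ ω) :
    ω / Real.sinh (ω * t) ≤ 2 / t * Real.exp (-(ω * t / 2)) := by
  rcases hω.eq_or_lt with rfl | hω
  · simp; positivity
  have hs := Real.sinh_pos_iff.2 (mul_pos hω ht)
  rw [div_le_iff₀ hs]
  have e : Real.sinh (ω * t) = 2 * Real.sinh (ω * t / 2) * Real.cosh (ω * t / 2) := by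
    rw [← Real.sinh_two_mul]; congr 1; ring
  have h1 : ω * t / 2 ≤ Real.sinh (ω * t / 2) := Real.self_le_sinh_iff.2 (by positivity)
  have h2 : Real.exp (ω * t / 2) / 2 ≤ Real.cosh (ω * t / 2) := by
    rw [Real.cosh_eq]
    have := Real.exp_pos (-(ω * t / 2))
    gcongr
    linarith
  have h3 : ω * t / 2 * Real.exp (ω * t / 2) ≤ Real.sinh (ω * t) := by
    rw [e]
    calc _ = 2 * (ω * t / 2) * (Real.exp (ω * t / 2) / 2) := by ring
      _ ≤ _ := by gcongr
  calc ω = 2 / t * Real.exp (-(ω * t / 2)) * (ω * t / 2 * Real.exp (ω * t / 2)) := by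
        rw [Real.exp_neg]; field_simp
    _ ≤ _ := by gcongr

theorem heatSymbol_params (ht : 0 < t) (ξ : Vec k) : 0 ≤ ‖ξ‖ / Real.sinh (‖ξ‖ * t) ∧
    ‖ξ‖ / Real.sinh (‖ξ‖ * t) ≤ ‖ξ‖ * (Real.cosh (‖ξ‖ * t) / Real.sinh (‖ξ‖ * t)) := by
  rcases (norm_nonneg ξ).eq_or_lt with h | h
  · simp [← h]
  · exact ⟨(mehler_params h (mul_pos h ht)).1.le, (mehler_params h (mul_pos h ht)).2⟩

theorem heatSymbol_nonneg (ht : 0 < t) (x w : Vec N) (ξ : Vec k) : 0 ≤ heatSymbol t x w ξ :=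
  gaussKernel_nonneg (heatSymbol_params ht ξ).1 _ _

theorem heatSymbol_comm (t : ℝ) (x w : Vec N) (ξ : Vec k) :
    heatSymbol t x w ξ = heatSymbol t w x ξ := mehler_comm _ _ _ _

theorem heatSymbol_neg (t : ℝ) (x w : Vec N) (ξ : Vec k) :
    heatSymbol t x w (-ξ) = heatSymbol t x w ξ := by simp [heatSymbol]

theorem heatSymbol_le (hN : 1 ≤ N) (ht : 0 < t) (x w : Vec N) (ξ : Vec k) :
    heatSymbol t x w ξ
      ≤ (2 / t / (2 * Real.pi)) ^ ((N : ℝ) / 2) * Real.exp (-(t / 4) * ‖ξ‖) := by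
  obtain ⟨h1, h2⟩ := heatSymbol_params ht ξ
  refine (gaussKernel_le h1 h2 x w).trans ?_
  calc _ ≤ (2 / t / (2 * Real.pi) * Real.exp (-(‖ξ‖ * t / 2))) ^ ((N : ℝ) / 2) := by
        refine Real.rpow_le_rpow (by positivity) ?_ (by positivity)
        rw [div_mul_eq_mul_div]
        gcongr
        exact div_sinh_le ht (norm_nonneg ξ)
    _ ≤ _ := by
        rw [Real.mul_rpow (by positivity) (by positivity), ← Real.exp_mul]
        refine mul_le_mul_of_nonneg_left (Real.exp_le_exp.2 ?_) (by positivity)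
        -- The exponent `(‖ξ‖t/2)(N/2)` is at least `‖ξ‖t/4` because `N ≥ 1`.
        have hN' : (1 : ℝ) ≤ N := by exact_mod_cast hN
        have : 0 ≤ ‖ξ‖ * t := by positivity
        nlinarith [mul_le_mul_of_nonneg_left hN' this]

theorem measurable_heatSymbol {α : Type*} [MeasurableSpace α] (t : ℝ) {x w : α → Vec N}
    {ξ : α → Vec k} (hx : Measurable x) (hw : Measurable w) (hξ : Measurable ξ) :
    Measurable fun p => heatSymbol t (x p) (w p) (ξ p) :=
  measurable_mehler.comp ((hξ.norm.prodMk (hξ.norm.mul_const t)).prodMk (hx.prodMk hw))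

/-- One term of the exponential series compares the exponential with `(1 + ‖ξ‖)^(-(k+1))`, which is
integrable on `ℝᵏ`. -/
theorem integrable_exp_neg_mul_norm {c : ℝ} (hc : 0 < c) :
    Integrable fun ξ : Vec k => Real.exp (-c * ‖ξ‖) := by
  have h := (integrable_one_add_norm (E := Vec k) (μ := volume) (r := (k + 1 : ℕ))
    (by simp)).const_mul (((k + 1).factorial : ℝ) / c ^ (k + 1) * Real.exp c)
  refine h.mono' (by fun_prop) (Eventually.of_forall fun ξ => ?_)
  rw [Real.norm_eq_abs, Real.abs_exp]
  have h0 : 0 < 1 + ‖ξ‖ := by positivity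
  have h1 := Real.pow_div_factorial_le_exp _ (by positivity : 0 ≤ c * (1 + ‖ξ‖)) (k + 1)
  have hf : (0 : ℝ) < (k + 1).factorial := by exact_mod_cast Nat.factorial_pos _
  rw [Real.rpow_neg h0.le, Real.rpow_natCast]
  rw [div_le_iff₀ hf, mul_pow] at h1
  have e : Real.exp (c * (1 + ‖ξ‖)) = Real.exp c * Real.exp (c * ‖ξ‖) := by
    rw [← Real.exp_add]; ring_nf
  rw [e] at h1
  rw [neg_mul, Real.exp_neg, ← div_eq_mul_inv, le_div_iff₀ (by positivity), ← div_eq_inv_mul,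
    div_le_iff₀ (by positivity), div_mul_eq_mul_div, div_mul_eq_mul_div, le_div_iff₀ (by positivity)]
  linarith

theorem integrable_heatSymbol (hN : 1 ≤ N) (ht : 0 < t) (x w : Vec N) :
    Integrable fun ξ : Vec k => heatSymbol t x w ξ := by
  refine ((integrable_exp_neg_mul_norm (by positivity : 0 < t / 4)).const_mul
    ((2 / t / (2 * Real.pi)) ^ ((N : ℝ) / 2))).mono'
    (measurable_heatSymbol t measurable_const measurable_const measurable_id).aestronglyMeasurable
    (Eventually.of_forall fun ξ => ?_)
  rw [Real.norm_of_nonneg (heatSymbol_nonneg ht x w ξ)]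
  exact heatSymbol_le hN ht x w ξ

/-- At vanishing frequency the oscillator degenerates to the free heat flow in `x`, since `ω / sinh
(ωt) → 1/t`. The neighbourhood is punctured because the formula reads `0 / 0` at `ξ = 0`. -/
theorem tendsto_heatSymbol_nhds_zero (ht : 0 < t) (x w : Vec N) :
    Tendsto (fun ξ : Vec k => heatSymbol t x w ξ) (𝓝[≠] 0)
      (𝓝 (gaussKernel (1 / t) (1 / t) x w)) := by
  have h1 : HasDerivAt (fun ω : ℝ => Real.sinh (ω * t)) t 0 := by
    have := ((hasDerivAt_id (0 : ℝ)).mul_const t).sinh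
    simpa using this
  have h2 := hasDerivAt_iff_tendsto_slope_zero.1 h1
  have h3 : Tendsto (fun ξ : Vec k => ‖ξ‖) (𝓝[≠] 0) (𝓝[≠] 0) :=
    tendsto_nhdsWithin_iff.2 ⟨by
      have := (continuous_norm.tendsto (0 : Vec k)).mono_left (nhdsWithin_le_nhds (s := {0}ᶜ))
      rwa [norm_zero] at this,
      (by filter_upwards [self_mem_nhdsWithin] with ξ hξ; simpa using hξ)⟩
  have h4 := ((h2.comp h3).inv₀ ht.ne')
  have hb : Tendsto (fun ξ : Vec k => ‖ξ‖ / Real.sinh (‖ξ‖ * t)) (𝓝[≠] 0) (𝓝 (1 / t)) := by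
    rw [one_div]
    refine h4.congr fun ξ => ?_
    simp [div_eq_mul_inv, mul_comm]
  have h5 : Tendsto (fun ξ : Vec k => Real.cosh (‖ξ‖ * t)) (𝓝[≠] 0) (𝓝 1) := by
    have : Continuous fun ξ : Vec k => Real.cosh (‖ξ‖ * t) := by fun_prop
    simpa using (this.tendsto 0).mono_left nhdsWithin_le_nhds
  refine tendsto_gaussKernel ?_ hb x w
  have := h5.mul hb
  rw [one_mul] at this
  refine this.congr fun ξ => ?_
  ring

theorem tendsto_heatSymbol (ht : 0 < t) (x w : Vec N) {η : Vec k} (hη : η ≠ 0) :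
    Tendsto (fun ζ => heatSymbol t x w (η + ζ)) (𝓝[≠] 0) (𝓝 (heatSymbol t x w η)) := by
  have h : Tendsto (fun ζ : Vec k => ‖η + ζ‖) (𝓝[≠] 0) (𝓝 ‖η‖) := by
    have : Continuous fun ζ : Vec k => ‖η + ζ‖ := by fun_prop
    simpa using (this.tendsto 0).mono_left nhdsWithin_le_nhds
  exact tendsto_mehler h (h.mul_const t) (mul_pos (norm_pos_iff.2 hη) ht) x w

/-- Limit of the Trotter products with `m + 1` steps of length `t / (m + 1)`. The dominating bound
of `mehler_trotter_le` only sees the total time `t`. -/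
theorem integral_heatSymbol_mul_nonneg (hk : 1 ≤ k) (ht : 0 < t) (x w : Vec N) (y : Vec k)
    {ε : ℝ} (hε : 0 < ε) :
    0 ≤ ∫ ξ : Vec k, heatSymbol t x w ξ * (Real.cos (inner ℝ y ξ) * Real.exp (-ε * ‖ξ‖ ^ 2)) := by
  have hh : ∀ m : ℕ, 0 < t * (1 / ((m : ℝ) + 1)) := fun m => by positivity
  refine ge_of_tendsto' (x := atTop) (f := fun m : ℕ => ∫ ξ : Vec k,
    mehler (trotterFreq (t * (1 / ((m : ℝ) + 1))) ‖ξ‖)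
      ((m + 1 : ℕ) * trotterPhase (t * (1 / ((m : ℝ) + 1))) ‖ξ‖) x w
        * (Real.cos (inner ℝ y ξ) * Real.exp (-ε * ‖ξ‖ ^ 2))) ?_
    fun m => integral_mehler_trotter_nonneg hk (hh m) m w y x ε hε
  refine tendsto_integral_of_dominated_convergence
    (fun ξ => (1 / t / (2 * Real.pi)) ^ ((N : ℝ) / 2) * Real.exp (-ε * ‖ξ‖ ^ 2))
    (fun m => ?_) ((integrable_exp_neg_mul_sq_norm hε).const_mul _) (fun m => ?_) ?_
  · exact ((measurable_mehler_trotter _ _ (by fun_prop) measurable_const measurable_const).mul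
      (by fun_prop)).aestronglyMeasurable
  · filter_upwards [ae_norm_pos hk] with ξ hξ
    have h1 := mehler_trotter_le (hh m) hξ (Nat.le_add_left 1 m) x w
    have e : ((m + 1 : ℕ) : ℝ) * (t * (1 / ((m : ℝ) + 1))) = t := by push_cast; field_simp
    rw [e] at h1
    rw [norm_mul, norm_mul, Real.norm_of_nonneg (Real.exp_nonneg _),
      Real.norm_of_nonneg (mehler_nonneg (trotterFreq_pos (hh m) hξ)
        (mul_pos (by positivity) (trotterPhase_pos (hh m) hξ)) _ _)]
    refine mul_le_mul h1 (mul_le_of_le_one_left (Real.exp_nonneg _) (Real.abs_cos_le_one _))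
      (by positivity) (by positivity)
  · filter_upwards [ae_norm_pos hk] with ξ hξ
    exact (tendsto_mehler (tendsto_trotterFreq ht _) (tendsto_trotterPhase t _)
      (mul_pos hξ ht) x w).mul_const _

/-- The symbol is itself integrable, so the Gaussian damping is removed by dominated convergence. -/
theorem cosTransform_heatSymbol_nonneg (hN : 1 ≤ N) (hk : 1 ≤ k) (ht : 0 < t) (x w : Vec N)
    (y : Vec k) : 0 ≤ cosTransform (heatSymbol t x w) y := by
  refine mul_nonneg (by positivity) ?_
  have hR : ∀ n : ℕ, 0 < 1 / ((n : ℝ) + 1) := fun n => Nat.one_div_pos_of_nat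
  refine ge_of_tendsto' (x := atTop) (f := fun n : ℕ => ∫ ξ : Vec k, heatSymbol t x w ξ
    * (Real.cos (inner ℝ y ξ) * Real.exp (-(1 / ((n : ℝ) + 1)) * ‖ξ‖ ^ 2))) ?_
    fun n => integral_heatSymbol_mul_nonneg hk ht x w y (hR n)
  refine tendsto_integral_of_dominated_convergence (fun ξ => heatSymbol t x w ξ) (fun n => ?_)
    (integrable_heatSymbol hN ht x w) (fun n => Eventually.of_forall fun ξ => ?_)
    (Eventually.of_forall fun ξ => ?_)
  · exact ((measurable_heatSymbol t measurable_const measurable_const measurable_id).mul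
      (by fun_prop)).aestronglyMeasurable
  · rw [norm_mul, norm_mul, Real.norm_of_nonneg (heatSymbol_nonneg ht x w ξ)]
    refine mul_le_of_le_one_right (heatSymbol_nonneg ht x w ξ) (mul_le_one₀ (Real.abs_cos_le_one _)
      (norm_nonneg _) ?_)
    rw [Real.norm_eq_abs, Real.abs_exp, Real.exp_le_one_iff]
    have := hR n
    have : 0 ≤ 1 / ((n : ℝ) + 1) * ‖ξ‖ ^ 2 := by positivity
    linarith
  · have : Tendsto (fun n : ℕ => -(1 / ((n : ℝ) + 1)) * ‖ξ‖ ^ 2) atTop (𝓝 0) := by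
      simpa using (tendsto_one_div_add_atTop_nhds_zero_nat (𝕜 := ℝ)).neg.mul_const (‖ξ‖ ^ 2)
    simpa [real_inner_comm] using
      (this.rexp.const_mul (Real.cos (inner ℝ y ξ))).const_mul (heatSymbol t x w ξ)

end heatSymbol

/-! ### Products of symbols and convolution of kernels -/

section convolution

variable {k : ℕ}

/-- The cosine transform turns products into convolutions. -/
theorem integral_cosTransform_mul_cosTransform {G₁ G₂ : Vec k → ℝ}
    (h₁ : Integrable (cosTransform G₁)) (h₂ : Integrable G₂)
    (hinv : ∀ᵐ ξ : Vec k, ∫ u, cosTransform G₁ u * Real.cos (inner ℝ ξ u) = G₁ ξ) (y : Vec k) :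
    ∫ u, cosTransform G₁ (y - u) * cosTransform G₂ u = cosTransform (fun ξ => G₁ ξ * G₂ ξ) y := by
  have hF : Integrable (fun p : Vec k × Vec k => cosTransform G₁ (y - p.1)
      * (G₂ p.2 * Real.cos (inner ℝ p.2 p.1))) (volume.prod volume) := by
    refine (((h₁.comp_sub_left y).mul_prod h₂).mul_bdd (c := 1)
      (g := fun p : Vec k × Vec k => Real.cos (inner ℝ p.2 p.1)) (by fun_prop)
      (Eventually.of_forall fun p => Real.abs_cos_le_one _)).congr
      (Eventually.of_forall fun p => ?_)
    simp only; ring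
  have e1 : ∀ u, cosTransform G₁ (y - u) * cosTransform G₂ u = 1 / (2 * Real.pi) ^ (k : ℝ)
      * ∫ ξ, cosTransform G₁ (y - u) * (G₂ ξ * Real.cos (inner ℝ ξ u)) := fun u => by
    rw [integral_const_mul, cosTransform.eq_1 G₂]; ring
  simp only [e1]
  rw [integral_const_mul, integral_integral_swap hF, cosTransform]
  congr 1
  refine integral_congr_ae ?_
  filter_upwards [hinv] with ξ hξ
  -- A cosine transform is even, so the sine part of `cos (ξ·(y - u))` integrates to zero and only
  -- the inversion formula for the cosine part remains.
  have hs : ∫ u, cosTransform G₁ u * Real.sin (inner ℝ ξ u) = 0 := by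
    have h := integral_neg_eq_self (μ := volume)
      (fun u => cosTransform G₁ u * Real.sin (inner ℝ ξ u))
    simp only [cosTransform_neg, inner_neg_right, Real.sin_neg, mul_neg] at h
    rw [integral_neg] at h
    linarith
  have e2 : ∫ u, cosTransform G₁ (y - u) * (G₂ ξ * Real.cos (inner ℝ ξ u))
      = ∫ u, cosTransform G₁ u * (G₂ ξ * Real.cos (inner ℝ ξ (y - u))) := by
    rw [← integral_sub_left_eq_self _ volume y]
    simp only [sub_sub_cancel]
  have e3 : ∀ u, cosTransform G₁ u * (G₂ ξ * Real.cos (inner ℝ ξ (y - u)))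
      = G₂ ξ * Real.cos (inner ℝ ξ y) * (cosTransform G₁ u * Real.cos (inner ℝ ξ u))
        + G₂ ξ * Real.sin (inner ℝ ξ y) * (cosTransform G₁ u * Real.sin (inner ℝ ξ u)) := by
    intro u
    rw [inner_sub_right, Real.cos_sub]; ring
  rw [e2]
  simp only [e3]
  rw [integral_add, integral_const_mul, integral_const_mul, hs, hξ]
  · ring
  · exact (h₁.mul_bdd (c := 1) (by fun_prop)
      (Eventually.of_forall fun u => Real.abs_cos_le_one _)).const_mul _
  · exact (h₁.mul_bdd (c := 1) (by fun_prop)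
      (Eventually.of_forall fun u => Real.abs_sin_le_one _)).const_mul _

end convolution

/-! ### Fourier inversion, composition and mass bounds for the symbol -/

section symbol

variable {N k : ℕ} {t s : ℝ}

theorem continuous_heatSymbol (t : ℝ) (ξ : Vec k) :
    Continuous fun p : Vec N × Vec N => heatSymbol t p.1 p.2 ξ := by
  unfold heatSymbol mehler
  exact continuous_gaussKernel _ _

theorem abs_heatSymbol_le (hN : 1 ≤ N) (ht : 0 < t) (x w : Vec N) (ξ : Vec k) :
    |heatSymbol t x w ξ| ≤ (2 / t / (2 * Real.pi)) ^ ((N : ℝ) / 2) := by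
  rw [abs_of_nonneg (heatSymbol_nonneg ht x w ξ)]
  refine (heatSymbol_le hN ht x w ξ).trans
    (mul_le_of_le_one_right (by positivity) (Real.exp_le_one_iff.2 ?_))
  have : 0 ≤ t / 4 * ‖ξ‖ := by positivity
  linarith

theorem integrable_cosTransform_heatSymbol (hN : 1 ≤ N) (hk : 1 ≤ k) (ht : 0 < t) (x w : Vec N) :
    Integrable (cosTransform (heatSymbol t x w : Vec k → ℝ)) :=
  integrable_cosTransform (integrable_heatSymbol hN ht x w) (heatSymbol_neg t x w)
    (measurable_heatSymbol t measurable_const measurable_const measurable_id)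
    (abs_heatSymbol_le hN ht x w) hk (tendsto_heatSymbol_nhds_zero ht x w)
    (cosTransform_heatSymbol_nonneg hN hk ht x w)

/-- Inversion at zero frequency: integrating the kernel over `y` leaves the limit of the symbol at
`0`, the free heat kernel in `x`. This is the source of the unit mass of the Grushin kernel. -/
theorem integral_cosTransform_heatSymbol (hN : 1 ≤ N) (hk : 1 ≤ k) (ht : 0 < t) (x w : Vec N) :
    ∫ u, cosTransform (heatSymbol t x w : Vec k → ℝ) u = gaussKernel (1 / t) (1 / t) x w := by
  have h := integral_cosTransform_mul_cos (η := 0) (integrable_heatSymbol hN ht x w)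
    (heatSymbol_neg t x w)
    (measurable_heatSymbol t measurable_const measurable_const measurable_id)
    (abs_heatSymbol_le hN ht x w) hk (integrable_cosTransform_heatSymbol (k := k) hN hk ht x w)
    (by simpa using tendsto_heatSymbol_nhds_zero ht x w)
  simpa using h

theorem integral_cosTransform_heatSymbol_mul_cos (hN : 1 ≤ N) (hk : 1 ≤ k) (ht : 0 < t)
    (x w : Vec N) {η : Vec k} (hη : η ≠ 0) :
    ∫ u, cosTransform (heatSymbol t x w) u * Real.cos (inner ℝ η u) = heatSymbol t x w η :=
  integral_cosTransform_mul_cos (integrable_heatSymbol hN ht x w)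
    (heatSymbol_neg t x w)
    (measurable_heatSymbol t measurable_const measurable_const measurable_id)
    (abs_heatSymbol_le hN ht x w) hk (integrable_cosTransform_heatSymbol hN hk ht x w)
    (tendsto_heatSymbol ht x w hη)

theorem integral_heatSymbol_mul_heatSymbol (ht : 0 < t) (hs : 0 < s) (x w : Vec N) {ξ : Vec k}
    (hξ : 0 < ‖ξ‖) : ∫ v, heatSymbol t x v ξ * heatSymbol s v w ξ = heatSymbol (t + s) x w ξ := by
  unfold heatSymbol
  rw [integral_mehler_mul_mehler hξ (mul_pos hξ ht) (mul_pos hξ hs), mul_add]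

/-- Tonelli with the spatial variable first: the inner integral is the symbol at time `t + s`,
integrable in `ξ`. -/
theorem integrable_heatSymbol_mul_heatSymbol (hN : 1 ≤ N) (hk : 1 ≤ k) (ht : 0 < t) (hs : 0 < s)
    (x w : Vec N) : Integrable (fun p : Vec N × Vec k =>
      heatSymbol t x p.1 p.2 * heatSymbol s p.1 w p.2) (volume.prod volume) := by
  rw [integrable_prod_iff']
  · constructor
    · filter_upwards [ae_norm_pos hk] with ξ hξ
      exact integrable_mehler_mul_mehler hξ hξ (mul_pos hξ ht) (mul_pos hξ hs) x w
    · refine (integrable_heatSymbol hN (add_pos ht hs) x w).congr ?_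
      filter_upwards [ae_norm_pos hk] with ξ hξ
      rw [← integral_heatSymbol_mul_heatSymbol ht hs x w hξ]
      refine integral_congr_ae (Eventually.of_forall fun v => ?_)
      exact (Real.norm_of_nonneg (mul_nonneg (heatSymbol_nonneg ht _ _ _)
        (heatSymbol_nonneg hs _ _ _))).symm
  · exact ((measurable_heatSymbol t measurable_const measurable_fst measurable_snd).mul
      (measurable_heatSymbol s measurable_fst measurable_const measurable_snd)).aestronglyMeasurable

theorem sinh_le_mul_cosh {s : ℝ} (hs : 0 ≤ s) : Real.sinh s ≤ s * Real.cosh s := by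
  have h := Convex.norm_image_sub_le_of_norm_deriv_le (f := Real.sinh) (C := Real.cosh s)
    (s := Icc 0 s) (fun x _ => Real.differentiable_sinh x) (fun x hx => ?_) (convex_Icc 0 s)
    (left_mem_Icc.2 hs) (right_mem_Icc.2 hs)
  · rw [Real.sinh_zero, sub_zero, sub_zero, Real.norm_of_nonneg (Real.sinh_nonneg_iff.2 hs),
      Real.norm_of_nonneg hs, mul_comm] at h
    exact h
  · rw [Real.deriv_sinh, Real.norm_of_nonneg (Real.cosh_pos x).le]
    exact Real.cosh_le_cosh.2 (by rw [abs_of_nonneg hx.1, abs_of_nonneg hs]; exact hx.2)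

theorem integral_heatSymbol_le_one (ht : 0 < t) (x : Vec N) {ξ : Vec k} (hξ : 0 < ‖ξ‖) :
    ∫ w, heatSymbol t x w ξ ≤ 1 := by
  have hs := mul_pos hξ ht
  have hsh := Real.sinh_pos_iff.2 hs
  have hch := Real.cosh_pos (‖ξ‖ * t)
  unfold heatSymbol
  rw [integral_mehler hξ hs]
  refine mul_le_one₀ (Real.rpow_le_one (by positivity) ?_ (by positivity)) (Real.exp_nonneg _) ?_
  · rw [div_le_one hch]
    exact Real.one_le_cosh _
  · rw [Real.exp_le_one_iff, neg_mul, neg_nonpos]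
    positivity

/-- From `cosh s ≤ exp(s²/2)`, `tanh s ≤ s` and `1 + a ≤ exp a`. The mass lost at frequency `ξ` is
`O(|ξ|²)`, which expresses a spread in `y` of variance of order `t² + t|x|²`. -/
theorem integral_heatSymbol_ge (ht : 0 < t) (x : Vec N) {ξ : Vec k} (hξ : 0 < ‖ξ‖) :
    1 - ‖ξ‖ ^ 2 * (N * t ^ 2 / 4 + t * ‖x‖ ^ 2 / 2) ≤ ∫ w, heatSymbol t x w ξ := by
  unfold heatSymbol
  rw [integral_mehler hξ (mul_pos hξ ht)]
  set s := ‖ξ‖ * t with hs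
  have hs0 : 0 < s := mul_pos hξ ht
  have h1 : Real.exp (-(s ^ 2 / 2 * (N / 2))) ≤ (1 / Real.cosh s) ^ ((N : ℝ) / 2) := by
    rw [← neg_mul, Real.exp_mul]
    refine Real.rpow_le_rpow (Real.exp_nonneg _) ?_ (by positivity)
    rw [Real.exp_neg, ← one_div]
    exact one_div_le_one_div_of_le (Real.cosh_pos s) (Real.cosh_le_exp_half_sq s)
  have h2 : Real.sinh s / Real.cosh s ≤ s := by
    rw [div_le_iff₀ (Real.cosh_pos s)]
    exact sinh_le_mul_cosh hs0.le
  have h3 : Real.exp (-(‖ξ‖ * s / 2) * ‖x‖ ^ 2)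
      ≤ Real.exp (-(‖ξ‖ * (Real.sinh s / Real.cosh s) / 2) * ‖x‖ ^ 2) := by
    gcongr
  calc _ ≤ Real.exp (-(s ^ 2 / 2 * (N / 2)) + -(‖ξ‖ * s / 2) * ‖x‖ ^ 2) := by
        refine le_trans (le_of_eq ?_) (Real.add_one_le_exp _)
        rw [hs]; ring
    _ ≤ _ := by
        rw [Real.exp_add]
        gcongr

end symbol

/-! ### The heat kernel -/

/-- The real part of `exp(iξ·y)` is the cosine, and the factor `(2π)^(-N/2)` inside `gaussKernel`
turns the constant `(2π)^(-(N+2k)/2)` into `(2π)^(-k)`. -/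
theorem heatKernel_eq_cosTransform {N k : ℕ} (hN : 1 ≤ N) {t : ℝ} (ht : 0 < t) (x w : Vec N)
    (y : Vec k) : heatKernel N k x w y t = cosTransform (heatSymbol t x w) y := by
  have e : ∀ ξ : Vec k, (((‖ξ‖ / Real.sinh (‖ξ‖ * t)) ^ ((N : ℝ) / 2) : ℝ) : ℂ) *
        Complex.exp (Complex.I * ((inner ℝ ξ y : ℝ) : ℂ) -
          ((‖ξ‖ / 2 * ((‖x‖ ^ 2 + ‖w‖ ^ 2) * (Real.cosh (‖ξ‖ * t) / Real.sinh (‖ξ‖ * t)) -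
            2 * (inner ℝ x w : ℝ) * (1 / Real.sinh (‖ξ‖ * t))) : ℝ) : ℂ))
      = (((2 * Real.pi) ^ ((N : ℝ) / 2) * heatSymbol t x w ξ : ℝ) : ℂ)
        * Complex.exp (((inner ℝ ξ y : ℝ) : ℂ) * Complex.I) := by
    intro ξ
    rw [sub_eq_add_neg, Complex.exp_add, mul_comm Complex.I, mul_comm (Complex.exp _), ← mul_assoc]
    congr 1
    rw [← Complex.ofReal_neg, ← Complex.ofReal_exp, ← Complex.ofReal_mul, heatSymbol, mehler,
      gaussKernel, ← mul_assoc, ← Real.mul_rpow (by positivity)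
        (div_nonneg (heatSymbol_params ht ξ).1 (by positivity))]
    congr 3
    · field_simp
    · ring
  unfold heatKernel
  simp only [e]
  have hint : Integrable fun ξ : Vec k => (((2 * Real.pi) ^ ((N : ℝ) / 2) * heatSymbol t x w ξ : ℝ) : ℂ)
        * Complex.exp (((inner ℝ ξ y : ℝ) : ℂ) * Complex.I) := by
    refine (((integrable_heatSymbol hN ht x w).const_mul _).ofReal).mul_bdd (c := 1)
      (by fun_prop) (Eventually.of_forall fun ξ => ?_)
    rw [Complex.norm_exp_ofReal_mul_I]
  have h3 := integral_re hint
  simp only [RCLike.re_eq_complex_re] at h3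
  rw [← h3]
  have e2 : ∀ ξ : Vec k, ((((2 * Real.pi) ^ ((N : ℝ) / 2) * heatSymbol t x w ξ : ℝ) : ℂ)
        * Complex.exp (((inner ℝ ξ y : ℝ) : ℂ) * Complex.I)).re
      = (2 * Real.pi) ^ ((N : ℝ) / 2) * (heatSymbol t x w ξ * Real.cos (inner ℝ ξ y)) := by
    intro ξ
    rw [Complex.re_ofReal_mul, Complex.exp_ofReal_mul_I_re, mul_assoc]
  simp only [e2]
  rw [integral_const_mul, cosTransform, ← mul_assoc]
  congr 1
  rw [show ((N : ℝ) + 2 * k) / 2 = N / 2 + k by ring, Real.rpow_add (by positivity)]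
  field_simp

/-- The heat kernel as a kernel on `ℝ^{N+k}`. -/
def kernel {N k : ℕ} (t : ℝ) (z w : Space N k) : ℝ := heatKernel N k z.1 w.1 (z.2 - w.2) t

section kernel

variable {N k : ℕ} {t s : ℝ}

theorem kernel_eq (hN : 1 ≤ N) (ht : 0 < t) (z w : Space N k) :
    kernel t z w = cosTransform (heatSymbol t z.1 w.1) (z.2 - w.2) :=
  heatKernel_eq_cosTransform hN ht _ _ _

theorem kernel_nonneg (hN : 1 ≤ N) (hk : 1 ≤ k) (ht : 0 < t) (z w : Space N k) :
    0 ≤ kernel t z w := by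
  rw [kernel_eq hN ht]
  exact cosTransform_heatSymbol_nonneg hN hk ht _ _ _

theorem kernel_comm (hN : 1 ≤ N) (ht : 0 < t) (z w : Space N k) : kernel t z w = kernel t w z := by
  have : (heatSymbol t z.1 w.1 : Vec k → ℝ) = heatSymbol t w.1 z.1 :=
    funext fun ξ => heatSymbol_comm _ _ _ _
  rw [kernel_eq hN ht, kernel_eq hN ht, ← neg_sub, cosTransform_neg, this]

theorem continuous_kernel (hN : 1 ≤ N) (ht : 0 < t) :
    Continuous fun p : Space N k × Space N k => kernel t p.1 p.2 := by
  simp only [kernel_eq hN ht, cosTransform]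
  refine continuous_const.mul (continuous_of_dominated (bound := fun ξ =>
    (2 / t / (2 * Real.pi)) ^ ((N : ℝ) / 2) * Real.exp (-(t / 4) * ‖ξ‖))
    (fun p => ?_) (fun p => Eventually.of_forall fun ξ => ?_)
    ((integrable_exp_neg_mul_norm (by positivity)).const_mul _)
    (Eventually.of_forall fun ξ => ?_))
  · exact (integrable_mul_cos (integrable_heatSymbol hN ht _ _) _).aestronglyMeasurable
  · rw [norm_mul, Real.norm_of_nonneg (heatSymbol_nonneg ht _ _ _)]
    exact (mul_le_of_le_one_right (heatSymbol_nonneg ht _ _ _) (Real.abs_cos_le_one _)).trans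
      (heatSymbol_le hN ht _ _ _)
  · have h1 : Continuous fun p : Space N k × Space N k => heatSymbol t p.1.1 p.2.1 ξ :=
      (continuous_heatSymbol t ξ).comp (f := fun p : Space N k × Space N k => (p.1.1, p.2.1))
        (by fun_prop)
    exact h1.mul (by fun_prop)

theorem exists_kernel_le (hN : 1 ≤ N) (ht : 0 < t) :
    ∃ C, ∀ z w : Space N k, |kernel t z w| ≤ C := by
  refine ⟨1 / (2 * Real.pi) ^ (k : ℝ) * ∫ ξ : Vec k,
    (2 / t / (2 * Real.pi)) ^ ((N : ℝ) / 2) * Real.exp (-(t / 4) * ‖ξ‖), fun z w => ?_⟩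
  rw [kernel_eq hN ht, cosTransform, abs_mul,
    abs_of_nonneg (a := 1 / (2 * Real.pi) ^ (k : ℝ)) (by positivity)]
  gcongr
  refine norm_integral_le_of_norm_le (f := fun ξ => heatSymbol t z.1 w.1 ξ * Real.cos
    (inner ℝ ξ (z.2 - w.2))) ((integrable_exp_neg_mul_norm (by positivity)).const_mul _)
    (Eventually.of_forall fun ξ => ?_)
  rw [norm_mul, Real.norm_of_nonneg (heatSymbol_nonneg ht _ _ _)]
  exact (mul_le_of_le_one_right (heatSymbol_nonneg ht _ _ _) (Real.abs_cos_le_one _)).trans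
      (heatSymbol_le hN ht _ _ _)

theorem integrable_gaussKernel_self (ht : 0 < t) (x : Vec N) :
    Integrable fun w => gaussKernel (1 / t) (1 / t) x w := integrable_gaussKernel (by positivity) x

theorem integral_gaussKernel_self (ht : 0 < t) (x : Vec N) :
    ∫ w, gaussKernel (1 / t) (1 / t) x w = 1 := by
  rw [integral_gaussKernel (by positivity) (by positivity)]
  rw [div_self (by positivity), sub_self]
  simp

/-- Tonelli with `y` first: by positivity and inversion at zero frequency the inner integral is the
free Gaussian in `x`. -/
theorem integrable_kernel (hN : 1 ≤ N) (hk : 1 ≤ k) (ht : 0 < t) (z : Space N k) :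
    Integrable fun w => kernel t z w := by
  rw [Measure.volume_eq_prod, integrable_prod_iff]
  · constructor
    · refine Eventually.of_forall fun x => ?_
      simp only [kernel_eq hN ht]
      exact (integrable_cosTransform_heatSymbol hN hk ht z.1 x).comp_sub_left z.2
    · refine (integrable_gaussKernel_self ht z.1).congr (Eventually.of_forall fun x => ?_)
      simp only [Real.norm_of_nonneg (kernel_nonneg hN hk ht _ _)]
      simp only [kernel_eq hN ht]
      rw [integral_sub_left_eq_self (cosTransform (heatSymbol t z.1 x)) volume z.2,
        integral_cosTransform_heatSymbol hN hk ht]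
  · exact ((continuous_kernel hN ht).comp (continuous_const.prodMk continuous_id)).aestronglyMeasurable

theorem integrable_kernel_mul (hN : 1 ≤ N) (hk : 1 ≤ k) (ht : 0 < t) (z : Space N k)
    {f : Space N k → ℝ} (hf : AEStronglyMeasurable f volume) {C : ℝ} (hC : ∀ w, |f w| ≤ C) :
    Integrable fun w => kernel t z w * f w :=
  (integrable_kernel hN hk ht z).mul_bdd hf (Eventually.of_forall hC)

theorem integral_kernel (hN : 1 ≤ N) (hk : 1 ≤ k) (ht : 0 < t) (z : Space N k) :
    ∫ w, kernel t z w = 1 := by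
  have h := integrable_kernel hN hk ht z
  rw [Measure.volume_eq_prod] at h ⊢
  rw [integral_prod _ h, ← integral_gaussKernel_self ht z.1]
  refine integral_congr_ae (Eventually.of_forall fun x => ?_)
  simp only [kernel_eq hN ht]
  rw [integral_sub_left_eq_self (cosTransform (heatSymbol t z.1 x)) volume z.2,
    integral_cosTransform_heatSymbol hN hk ht]

theorem one_sub_exp_neg_mem {a : ℝ} (ha : 0 ≤ a) : |1 - Real.exp (-a)| ≤ 1 := by
  have h1 := Real.exp_pos (-a)
  have h2 : Real.exp (-a) ≤ 1 := Real.exp_le_one_iff.2 (by linarith)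
  rw [abs_le]; constructor <;> linarith

theorem integrable_kernel_mul_exp (hN : 1 ≤ N) (hk : 1 ≤ k) (ht : 0 < t) (z : Space N k)
    {g : Space N k → ℝ} (hg : Continuous g) (h0 : ∀ w, 0 ≤ g w) :
    Integrable fun w => kernel t z w * Real.exp (-g w) :=
  integrable_kernel_mul hN hk ht z (by fun_prop) (C := 1) fun w => by
    rw [Real.abs_exp, Real.exp_le_one_iff]
    linarith [h0 w]

/-- Off-diagonal decay of the heat kernel in the variable `x`. -/
theorem integral_kernel_mul_fst_le (hN : 1 ≤ N) (hk : 1 ≤ k) (ht : 0 < t) {c : ℝ} (hc : 0 < c)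
    (z : Space N k) :
    ∫ w, kernel t z w * (1 - Real.exp (-(c * ‖z.1 - w.1‖ ^ 2))) ≤ N * c * t := by
  have hi := integrable_kernel_mul_exp hN hk ht z (g := fun w => c * ‖z.1 - w.1‖ ^ 2)
    (by fun_prop) (fun w => by positivity)
  have e : ∀ w, kernel t z w * (1 - Real.exp (-(c * ‖z.1 - w.1‖ ^ 2)))
    = kernel t z w - kernel t z w * Real.exp (-(c * ‖z.1 - w.1‖ ^ 2)) := fun w => by ring
  simp only [e]
  rw [integral_sub (integrable_kernel hN hk ht z) hi, integral_kernel hN hk ht]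
  -- The `x`-marginal of the kernel is the free heat kernel, so the mass that survives the Gaussian
  -- damping is explicit.
  have h1 : ∫ w, kernel t z w * Real.exp (-(c * ‖z.1 - w.1‖ ^ 2))
      = (1 / (1 + 2 * c * t)) ^ ((N : ℝ) / 2) := by
    rw [Measure.volume_eq_prod] at hi ⊢
    rw [integral_prod _ hi]
    have e2 : ∀ x : Vec N, ∫ y, kernel t z (x, y) * Real.exp (-(c * ‖z.1 - x‖ ^ 2))
        = (1 / (2 * Real.pi * t)) ^ ((N : ℝ) / 2) * Real.exp (-(1 / (2 * t) + c) * ‖z.1 - x‖ ^ 2) := by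
      intro x
      rw [integral_mul_const]
      simp only [kernel_eq hN ht]
      rw [integral_sub_left_eq_self (cosTransform (heatSymbol t z.1 x)) volume z.2,
        integral_cosTransform_heatSymbol hN hk ht, gaussKernel, mul_assoc, ← Real.exp_add,
        norm_sub_sq_real]
      congr 2
      · field_simp
      · field_simp
        ring
    simp only [e2]
    rw [integral_const_mul, integral_sub_left_eq_self
      (fun v : Vec N => Real.exp (-(1 / (2 * t) + c) * ‖v‖ ^ 2)) volume z.1,
      integral_exp_neg_mul_sq_norm (by positivity), ← Real.mul_rpow (by positivity) (by positivity)]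
    congr 1
    field_simp
  rw [h1]
  -- The chain is `1 - Nct ≤ exp(-Nct) ≤ (1 + 2ct)^(-N/2)`.
  have h2 : 1 - N * c * t ≤ Real.exp (-(2 * c * t) * (N / 2)) := by
    refine le_trans (le_of_eq ?_) (Real.add_one_le_exp _)
    ring
  have h3 : Real.exp (-(2 * c * t) * (N / 2)) ≤ (1 / (1 + 2 * c * t)) ^ ((N : ℝ) / 2) := by
    rw [Real.exp_mul]
    refine Real.rpow_le_rpow (Real.exp_nonneg _) ?_ (by positivity)
    rw [Real.exp_neg, ← one_div]
    refine one_div_le_one_div_of_le (by positivity) ?_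
    linarith [Real.add_one_le_exp (2 * c * t)]
  linarith

/-- The factor `‖ξ‖²` is absorbed by doubling the covariance: `a ≤ exp a` with `a = ‖ξ‖² / (8c)`.
The constant `2^(k/2)` is the ratio of the two normalizations. -/
theorem integral_sq_norm_mul_gaussDensity_le {c : ℝ} (hc : 0 < c) :
    Integrable (fun ξ : Vec k => ‖ξ‖ ^ 2 * gaussDensity c ξ) ∧
    ∫ ξ : Vec k, ‖ξ‖ ^ 2 * gaussDensity c ξ ≤ 8 * c * 2 ^ ((k : ℝ) / 2) := by
  have hle : ∀ ξ : Vec k, ‖ξ‖ ^ 2 * gaussDensity c ξ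
      ≤ 8 * c * 2 ^ ((k : ℝ) / 2) * gaussDensity (2 * c) ξ := by
    intro ξ
    have h1 : ‖ξ‖ ^ 2 / (8 * c) ≤ Real.exp (‖ξ‖ ^ 2 / (8 * c)) := by
      linarith [Real.add_one_le_exp (‖ξ‖ ^ 2 / (8 * c))]
    rw [div_le_iff₀ (by positivity)] at h1
    have e : (1 / (4 * Real.pi * c)) ^ ((k : ℝ) / 2)
        = 2 ^ ((k : ℝ) / 2) * (1 / (4 * Real.pi * (2 * c))) ^ ((k : ℝ) / 2) := by
      rw [← Real.mul_rpow (by positivity) (by positivity)]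
      congr 1; field_simp
    have e2 : Real.exp (-(1 / (4 * (2 * c))) * ‖ξ‖ ^ 2)
        = Real.exp (‖ξ‖ ^ 2 / (8 * c)) * Real.exp (-(1 / (4 * c)) * ‖ξ‖ ^ 2) := by
      rw [← Real.exp_add]; congr 1; field_simp; ring
    unfold gaussDensity
    rw [e, e2]
    calc _ ≤ (Real.exp (‖ξ‖ ^ 2 / (8 * c)) * (8 * c)) * (2 ^ ((k : ℝ) / 2)
          * (1 / (4 * Real.pi * (2 * c))) ^ ((k : ℝ) / 2) * Real.exp (-(1 / (4 * c)) * ‖ξ‖ ^ 2)) := by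
          gcongr
      _ = _ := by ring
  have hi := (integrable_gaussDensity (k := k) (by positivity : 0 < 2 * c)).const_mul
    (8 * c * 2 ^ ((k : ℝ) / 2))
  have hi2 : Integrable (fun ξ : Vec k => ‖ξ‖ ^ 2 * gaussDensity c ξ) := by
    refine hi.mono' ?_ (Eventually.of_forall fun ξ => ?_)
    · have := continuous_gaussDensity (k := k) c
      fun_prop
    · rw [Real.norm_of_nonneg (mul_nonneg (sq_nonneg _) (gaussDensity_nonneg hc ξ))]
      exact hle ξ
  refine ⟨hi2, (integral_mono hi2 hi hle).trans (le_of_eq ?_)⟩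
  rw [integral_const_mul, integral_gaussDensity (by positivity), mul_one]

/-- Off-diagonal decay of the heat kernel in the variable `y`. -/
theorem integral_kernel_mul_snd_le (hN : 1 ≤ N) (hk : 1 ≤ k) (ht : 0 < t) {c : ℝ} (hc : 0 < c)
    (z : Space N k) :
    ∫ w, kernel t z w * (1 - Real.exp (-(c * ‖z.2 - w.2‖ ^ 2)))
      ≤ (N * t ^ 2 / 4 + t * ‖z.1‖ ^ 2 / 2) * (8 * c * 2 ^ ((k : ℝ) / 2)) := by
  have hi := integrable_kernel_mul_exp hN hk ht z (g := fun w => c * ‖z.2 - w.2‖ ^ 2)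
    (by fun_prop) (fun w => by positivity)
  have e : ∀ w, kernel t z w * (1 - Real.exp (-(c * ‖z.2 - w.2‖ ^ 2)))
    = kernel t z w - kernel t z w * Real.exp (-(c * ‖z.2 - w.2‖ ^ 2)) := fun w => by ring
  simp only [e]
  rw [integral_sub (integrable_kernel hN hk ht z) hi, integral_kernel hN hk ht]
  have hF : Integrable (fun p : Vec N × Vec k => heatSymbol t z.1 p.1 p.2 * gaussDensity c p.2)
      (volume.prod volume) := by
    have hm : Measurable fun p : Vec N × Vec k => heatSymbol t z.1 p.1 p.2 :=
      measurable_heatSymbol t measurable_const measurable_fst measurable_snd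
    have hmg : Measurable fun p : Vec N × Vec k => gaussDensity c p.2 :=
      (continuous_gaussDensity c).measurable.comp measurable_snd
    have hmm : AEStronglyMeasurable (fun p : Vec N × Vec k =>
        heatSymbol t z.1 p.1 p.2 * gaussDensity c p.2) (volume.prod volume) :=
      (hm.mul hmg).aestronglyMeasurable
    rw [integrable_prod_iff' hmm]
    constructor
    · filter_upwards [ae_norm_pos hk] with ξ hξ
      exact (integrable_mehler hξ (mul_pos hξ ht) z.1).mul_const _
    · refine (integrable_gaussDensity (k := k) hc).mono'
        hmm.norm.prod_swap.integral_prod_right' ?_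
      filter_upwards [ae_norm_pos hk] with ξ hξ
      have hg := gaussDensity_nonneg hc ξ
      simp only [norm_mul, Real.norm_of_nonneg hg, Real.norm_of_nonneg (heatSymbol_nonneg ht _ _ _)]
      rw [integral_mul_const, Real.norm_of_nonneg (mul_nonneg
        (integral_nonneg fun w => heatSymbol_nonneg ht _ _ _) hg)]
      exact mul_le_of_le_one_left hg (integral_heatSymbol_le_one ht z.1 hξ)
  -- Gaussian damping in `y` becomes an average over frequencies, with density `gaussDensity c`, of
  -- the spatial mass of the symbol.
  have h1 : ∫ w, kernel t z w * Real.exp (-(c * ‖z.2 - w.2‖ ^ 2))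
      = ∫ ξ : Vec k, (∫ x, heatSymbol t z.1 x ξ) * gaussDensity c ξ := by
    rw [Measure.volume_eq_prod] at hi ⊢
    rw [integral_prod _ hi]
    have e2 : ∀ x : Vec N, ∫ y, kernel t z (x, y) * Real.exp (-(c * ‖z.2 - y‖ ^ 2))
        = ∫ ξ : Vec k, heatSymbol t z.1 x ξ * gaussDensity c ξ := by
      intro x
      simp only [kernel_eq hN ht]
      rw [integral_sub_left_eq_self (fun u => cosTransform (heatSymbol t z.1 x) u
        * Real.exp (-(c * ‖u‖ ^ 2))) volume z.2]
      have := integral_cosTransform_mul (k := k) (integrable_heatSymbol hN ht z.1 x)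
        (heatSymbol_neg t z.1 x) hc 0
      simpa using this
    simp only [e2]
    rw [integral_integral_swap hF]
    simp only [integral_mul_const]
  rw [h1]
  set B := (N * t ^ 2 / 4 + t * ‖z.1‖ ^ 2 / 2) with hB
  have hB0 : 0 ≤ B := by positivity
  obtain ⟨h2, h3⟩ := integral_sq_norm_mul_gaussDensity_le (k := k) hc
  -- The lower bound `1 - B‖ξ‖²` for the mass is averaged; the second moment of the density then
  -- bounds the loss.
  have h4 : ∫ ξ : Vec k, (gaussDensity c ξ - B * (‖ξ‖ ^ 2 * gaussDensity c ξ))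
      ≤ ∫ ξ : Vec k, (∫ x, heatSymbol t z.1 x ξ) * gaussDensity c ξ := by
    refine integral_mono_ae ((integrable_gaussDensity hc).sub (h2.const_mul B)) ?_ ?_
    · refine hF.integral_prod_right.congr (Eventually.of_forall fun ξ => ?_)
      simp only [integral_mul_const]
    · filter_upwards [ae_norm_pos hk] with ξ hξ
      have := mul_le_mul_of_nonneg_right (integral_heatSymbol_ge ht z.1 hξ)
        (gaussDensity_nonneg hc ξ)
      refine le_trans (le_of_eq ?_) this
      rw [hB]; ring
  rw [integral_sub (integrable_gaussDensity hc) (h2.const_mul B), integral_gaussDensity hc,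
    integral_const_mul] at h4
  have := mul_le_mul_of_nonneg_left h3 hB0
  linarith

/-- The Chapman–Kolmogorov equation. -/
theorem integral_kernel_mul_kernel (hN : 1 ≤ N) (hk : 1 ≤ k) (ht : 0 < t) (hs : 0 < s)
    (z v : Space N k) : ∫ w, kernel t z w * kernel s w v = kernel (t + s) z v := by
  have hi : Integrable fun w => kernel t z w * kernel s w v := by
    obtain ⟨C, hC⟩ := exists_kernel_le (k := k) hN hs
    exact integrable_kernel_mul hN hk ht z ((continuous_kernel hN hs).comp
      (continuous_id.prodMk continuous_const)).aestronglyMeasurable (fun w => hC w v)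
  rw [Measure.volume_eq_prod] at hi ⊢
  rw [integral_prod _ hi]
  -- The integral over the `y`-component is a convolution, hence the transform of the product of the
  -- symbols. The remaining integral over `x` is the Mehler semigroup property at each frequency.
  have e : ∀ x : Vec N, ∫ y, kernel t z (x, y) * kernel s (x, y) v
      = 1 / (2 * Real.pi) ^ (k : ℝ) * ∫ ξ : Vec k, heatSymbol t z.1 x ξ * heatSymbol s x v.1 ξ
        * Real.cos (inner ℝ ξ (z.2 - v.2)) := by
    intro x
    rw [← cosTransform.eq_1 (fun ξ => heatSymbol t z.1 x ξ * heatSymbol s x v.1 ξ),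
      ← integral_cosTransform_mul_cosTransform (integrable_cosTransform_heatSymbol hN hk ht _ _)
      (integrable_heatSymbol hN hs _ _) ?_]
    · simp only [kernel_eq hN ht, kernel_eq hN hs]
      rw [← integral_add_right_eq_self _ v.2]
      simp only [add_sub_cancel_right, sub_add_eq_sub_sub_swap]
    · filter_upwards [ae_norm_pos hk] with ξ hξ
      exact integral_cosTransform_heatSymbol_mul_cos hN hk ht _ _ (norm_pos_iff.1 hξ)
  simp only [e]
  rw [integral_const_mul, kernel_eq hN (add_pos ht hs), cosTransform]
  congr 1
  have hF : Integrable (fun p : Vec N × Vec k => heatSymbol t z.1 p.1 p.2 * heatSymbol s p.1 v.1 p.2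
      * Real.cos (inner ℝ p.2 (z.2 - v.2))) (volume.prod volume) :=
    (integrable_heatSymbol_mul_heatSymbol hN hk ht hs _ _).mul_bdd (c := 1) (by fun_prop)
      (Eventually.of_forall fun p => Real.abs_cos_le_one _)
  rw [integral_integral_swap hF]
  refine integral_congr_ae ?_
  filter_upwards [ae_norm_pos hk] with ξ hξ
  rw [integral_mul_const, integral_heatSymbol_mul_heatSymbol ht hs _ _ hξ]

end kernel

/-! ### Continuous functions vanishing at infinity -/

section zeroAtInfty

variable {E : Type*} [TopologicalSpace E]

theorem abs_apply_le_norm (f : C₀(E, ℝ)) (z : E) : |f z| ≤ ‖f‖ := by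
  rw [← ZeroAtInftyContinuousMap.norm_toBCF_eq_norm]
  exact f.toBCF.norm_coe_le_norm z

theorem zeroAtInfty_norm_le {f : C₀(E, ℝ)} {C : ℝ} (hC : 0 ≤ C) (h : ∀ z, |f z| ≤ C) :
    ‖f‖ ≤ C := by
  rw [← ZeroAtInftyContinuousMap.norm_toBCF_eq_norm]
  exact (BoundedContinuousFunction.norm_le hC).2 h

/-- Composition of a function vanishing at infinity with a continuous function fixing `0`. -/
def postcomp (g : ℝ → ℝ) (hg : Continuous g) (h0 : g 0 = 0) (f : C₀(E, ℝ)) : C₀(E, ℝ) where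
  toFun z := g (f z)
  continuous_toFun := hg.comp (map_continuous f)
  zero_at_infty' := by
    have := (hg.tendsto 0).comp (zero_at_infty f)
    rwa [h0] at this

@[simp]
theorem postcomp_apply (g : ℝ → ℝ) (hg : Continuous g) (h0 : g 0 = 0) (f : C₀(E, ℝ)) (z : E) :
    postcomp g hg h0 f z = g (f z) := rfl

/-- Soft thresholding at level `ε`. -/
def softThreshold (ε a : ℝ) : ℝ := a - max (-ε) (min ε a)

theorem continuous_softThreshold (ε : ℝ) : Continuous (softThreshold ε) := by
  unfold softThreshold; fun_prop

theorem softThreshold_of_abs_le {ε a : ℝ} (h : |a| ≤ ε) : softThreshold ε a = 0 := by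
  rw [abs_le] at h
  rw [softThreshold, min_eq_right h.2, max_eq_right h.1, sub_self]

theorem abs_sub_softThreshold_le {ε : ℝ} (hε : 0 ≤ ε) (a : ℝ) : |a - softThreshold ε a| ≤ ε := by
  rw [softThreshold, sub_sub_cancel, abs_le]
  exact ⟨le_max_left _ _, max_le (by linarith) (min_le_left _ _)⟩

/-- Truncation of a function vanishing at infinity to a compactly supported one. -/
def truncation {ε : ℝ} (hε : 0 ≤ ε) (f : C₀(E, ℝ)) : C₀(E, ℝ) :=
  postcomp (softThreshold ε) (continuous_softThreshold ε)
    (softThreshold_of_abs_le (by simpa using hε)) f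

end zeroAtInfty

/-- Soft thresholding changes `f` by at most `ε` and kills it wherever `|f| ≤ ε`, in particular far
away. Together with the contraction property it reduces assertions on `C₀` to functions of bounded
support. -/
theorem exists_truncation_eq_zero {E : Type*} [NormedAddCommGroup E] {ε : ℝ} (hε : 0 < ε)
    (f : C₀(E, ℝ)) : ∃ R, 0 ≤ R ∧ ∀ w : E, R < ‖w‖ → truncation hε.le f w = 0 := by
  have h : ∀ᶠ w in cocompact E, |f w| < ε := by
    have := (zero_at_infty f).abs
    rw [abs_zero] at this
    exact this.eventually (gt_mem_nhds hε)
  obtain ⟨R, hR⟩ := Metric.closedBall_compl_subset_of_mem_cocompact h 0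
  refine ⟨max R 0, le_max_right _ _, fun w hw => softThreshold_of_abs_le ?_⟩
  have hw' : w ∈ (Metric.closedBall (0 : E) R)ᶜ := by
    simp only [mem_compl_iff, Metric.mem_closedBall, dist_zero_right, not_le]
    exact (le_max_left _ _).trans_lt hw
  exact (show |f w| < ε from hR hw').le

/-! ### The heat semigroup on `C₀` -/

/-- The action of the heat kernel on functions. -/
def heatOp {N k : ℕ} (t : ℝ) (f : Space N k → ℝ) (z : Space N k) : ℝ := ∫ w, kernel t z w * f w

section heatOp

variable {N k : ℕ} {t s : ℝ}

/-- Thanks to this, `2 (1 - exp(-r²/δ²))` dominates the indicator of `r ≥ δ`, so the smooth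
off-diagonal bounds serve as tail estimates. -/
theorem half_le_one_sub_exp {a : ℝ} (ha : 1 ≤ a) : 1 / 2 ≤ 1 - Real.exp (-a) := by
  have h1 : Real.exp (-a) ≤ Real.exp (-1) := Real.exp_le_exp.2 (by linarith)
  have h2 : (2 : ℝ) ≤ Real.exp 1 := by linarith [Real.add_one_le_exp (1 : ℝ)]
  have h3 : Real.exp (-1) ≤ 1 / 2 := by
    rw [Real.exp_neg, ← one_div]
    exact one_div_le_one_div_of_le two_pos h2
  linarith

theorem one_sub_exp_neg_nonneg {a : ℝ} (ha : 0 ≤ a) : 0 ≤ 1 - Real.exp (-a) := by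
  have : Real.exp (-a) ≤ 1 := Real.exp_le_one_iff.2 (by linarith)
  linarith

theorem integrable_kernel_mul_one_sub (hN : 1 ≤ N) (hk : 1 ≤ k) (ht : 0 < t) (z : Space N k)
    {g : Space N k → ℝ} (hg : Continuous g) (h0 : ∀ w, 0 ≤ g w) :
    Integrable fun w => kernel t z w * (1 - Real.exp (-g w)) :=
  integrable_kernel_mul hN hk ht z (by fun_prop) (C := 1) fun w => one_sub_exp_neg_mem (h0 w)

theorem abs_integral_kernel_mul_le (hN : 1 ≤ N) (hk : 1 ≤ k) (ht : 0 < t) (z : Space N k)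
    {f g : Space N k → ℝ} (hfg : ∀ w, |f w| ≤ g w) (hg : Integrable fun w => kernel t z w * g w) :
    |∫ w, kernel t z w * f w| ≤ ∫ w, kernel t z w * g w := by
  refine norm_integral_le_of_norm_le (f := fun w => kernel t z w * f w) hg
    (Eventually.of_forall fun w => ?_)
  rw [norm_mul, Real.norm_of_nonneg (kernel_nonneg hN hk ht z w)]
  exact mul_le_mul_of_nonneg_left (hfg w) (kernel_nonneg hN hk ht z w)

theorem abs_heatOp_le (hN : 1 ≤ N) (hk : 1 ≤ k) (ht : 0 < t) {f : Space N k → ℝ} {C : ℝ}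
    (hf : ∀ w, |f w| ≤ C) (z : Space N k) : |heatOp t f z| ≤ C := by
  have h := abs_integral_kernel_mul_le hN hk ht z hf ((integrable_kernel hN hk ht z).mul_const C)
  rwa [integral_mul_const, integral_kernel hN hk ht, one_mul] at h

theorem heatOp_sub (hN : 1 ≤ N) (hk : 1 ≤ k) (ht : 0 < t) (f g : C₀(Space N k, ℝ))
    (z : Space N k) : heatOp t (fun w => f w - g w) z = heatOp t f z - heatOp t g z := by
  unfold heatOp
  simp only [mul_sub]
  exact integral_sub
    (integrable_kernel_mul hN hk ht z (map_continuous f).aestronglyMeasurable (abs_apply_le_norm f))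
    (integrable_kernel_mul hN hk ht z (map_continuous g).aestronglyMeasurable (abs_apply_le_norm g))

theorem continuous_heatOp_of_bounded_support (hN : 1 ≤ N) (ht : 0 < t)
    (f : C₀(Space N k, ℝ)) {R : ℝ} (hR : ∀ w : Space N k, R < ‖w‖ → f w = 0) :
    Continuous (heatOp t f) := by
  obtain ⟨C, hC⟩ := exists_kernel_le (k := k) hN ht
  have hint : Integrable f := by
    refine (map_continuous f).integrable_of_hasCompactSupport
      (HasCompactSupport.intro (isCompact_closedBall (0 : Space N k) R) fun w hw => hR w ?_)
    simpa using hw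
  refine continuous_of_dominated (bound := fun w => C * |f w|) (fun z => ?_)
    (fun z => Eventually.of_forall fun w => ?_) (hint.abs.const_mul C)
    (Eventually.of_forall fun w => ?_)
  · exact (((continuous_kernel hN ht).comp (continuous_const.prodMk continuous_id)).mul
      (map_continuous f)).aestronglyMeasurable
  · rw [norm_mul]
    exact mul_le_mul_of_nonneg_right (hC z w) (abs_nonneg _)
  · exact ((continuous_kernel hN ht).comp (continuous_id.prodMk continuous_const)).mul
      continuous_const

/-- If `‖z.1‖` is large, the decay in `x` suffices. Otherwise `‖z.2‖` is large, and the decay in `y`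
applies: its constant grows with `‖z.1‖`, which is now bounded. -/
theorem tendsto_heatOp_of_bounded_support (hN : 1 ≤ N) (hk : 1 ≤ k) (ht : 0 < t)
    (f : C₀(Space N k, ℝ)) {R : ℝ} (hR : ∀ w : Space N k, R < ‖w‖ → f w = 0) :
    Tendsto (heatOp t f) (cocompact (Space N k)) (𝓝 0) := by
  rw [Metric.tendsto_nhds]
  intro ε hε
  have hmass : ∀ A : ℝ, ∃ δ, 0 < δ ∧ 2 * ‖f‖ * (A * (1 / δ ^ 2)) < ε := by
    intro A
    have h : Tendsto (fun δ : ℝ => 2 * ‖f‖ * (A * (1 / δ ^ 2))) atTop (𝓝 0) := by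
      have h1 : Tendsto (fun δ : ℝ => 1 / δ ^ 2) atTop (𝓝 0) := by
        simpa using (tendsto_pow_neg_atTop (𝕜 := ℝ) (n := 2) two_ne_zero)
      simpa using (h1.const_mul A).const_mul (2 * ‖f‖)
    obtain ⟨δ, h1, h2⟩ := ((h.eventually (gt_mem_nhds hε)).and (eventually_gt_atTop 0)).exists
    exact ⟨δ, h2, h1⟩
  obtain ⟨δ, hδ, hδε⟩ := hmass (N * t)
  -- The distance `δ'` in `y` is chosen after `δ`, because the `y`-tail bound is used where `‖z.1‖ ≤
  -- R + δ`.
  obtain ⟨δ', hδ', hδε'⟩ := hmass ((N * t ^ 2 / 4 + t * (R + δ) ^ 2 / 2)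
    * (8 * 2 ^ ((k : ℝ) / 2)))
  have hbound : ∀ (r d : ℝ) (v w : Space N k), 0 < d → (f w ≠ 0 → d ≤ r) →
      |f w| ≤ 2 * ‖f‖ * (1 - Real.exp (-(1 / d ^ 2 * r ^ 2))) := by
    intro r d v w hd h
    by_cases hw : f w = 0
    · rw [hw, abs_zero]
      exact mul_nonneg (by positivity) (one_sub_exp_neg_nonneg (by positivity))
    · have h1 : 1 ≤ 1 / d ^ 2 * r ^ 2 := by
        rw [div_mul_eq_mul_div, one_mul, one_le_div (by positivity)]
        exact pow_le_pow_left₀ hd.le (h hw) 2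
      have := half_le_one_sub_exp h1
      have := abs_apply_le_norm f w
      nlinarith [norm_nonneg f]
  have hsupp : ∀ w : Space N k, f w ≠ 0 → ‖w.1‖ ≤ R ∧ ‖w.2‖ ≤ R := by
    intro w hw
    have : ‖w‖ ≤ R := by
      by_contra! h
      exact hw (hR w h)
    exact ⟨(norm_fst_le w).trans this, (norm_snd_le w).trans this⟩
  have hout : ∀ᶠ z in cocompact (Space N k), max (R + δ) (R + δ') < ‖z‖ := by
    have := tendsto_norm_cocompact_atTop (E := Space N k)
    exact this.eventually_gt_atTop _
  filter_upwards [hout] with z hz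
  rw [dist_zero_right, Real.norm_eq_abs]
  by_cases h1 : R + δ < ‖z.1‖
  · have h := abs_integral_kernel_mul_le hN hk ht z (f := f)
      (g := fun w => 2 * ‖f‖ * (1 - Real.exp (-(1 / δ ^ 2 * ‖z.1 - w.1‖ ^ 2))))
      (fun w => hbound _ δ z w hδ fun hw => by
        linarith [(hsupp w hw).1, norm_sub_norm_le z.1 w.1])
    simp only [mul_left_comm (kernel t z _)] at h
    have h2 := h ((integrable_kernel_mul_one_sub hN hk ht z (by fun_prop)
      (fun w => by positivity)).const_mul _)
    rw [integral_const_mul] at h2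
    refine h2.trans_lt (lt_of_le_of_lt ?_ hδε)
    refine mul_le_mul_of_nonneg_left ((integral_kernel_mul_fst_le hN hk ht
      (by positivity) z).trans (le_of_eq ?_)) (by positivity)
    ring
  · have h2 : R + δ' < ‖z.2‖ := by
      have : ‖z‖ = max ‖z.1‖ ‖z.2‖ := Prod.norm_def z
      rw [this] at hz
      rcases lt_max_iff.1 ((le_max_left _ _).trans_lt hz) with h | h
      · exact absurd h h1
      · rcases lt_max_iff.1 ((le_max_right _ _).trans_lt hz) with h' | h'
        · by_contra! h3
          have := (max_lt_iff.1 hz).1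
          rcases lt_max_iff.1 this with h4 | h4
          · exact h1 h4
          · have h5 := (max_lt_iff.1 hz).2
            rw [max_eq_right (by linarith)] at h5
            linarith
        · exact h'
    have h := abs_integral_kernel_mul_le hN hk ht z (f := f)
      (g := fun w => 2 * ‖f‖ * (1 - Real.exp (-(1 / δ' ^ 2 * ‖z.2 - w.2‖ ^ 2))))
      (fun w => hbound _ δ' z w hδ' fun hw => by
        linarith [(hsupp w hw).2, norm_sub_norm_le z.2 w.2])
    simp only [mul_left_comm (kernel t z _)] at h
    have h3 := h ((integrable_kernel_mul_one_sub hN hk ht z (by fun_prop)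
      (fun w => by positivity)).const_mul _)
    rw [integral_const_mul] at h3
    refine h3.trans_lt (lt_of_le_of_lt ?_ hδε')
    refine mul_le_mul_of_nonneg_left ((integral_kernel_mul_snd_le hN hk ht
      (by positivity) z).trans ?_) (by positivity)
    have h4 : ‖z.1‖ ^ 2 ≤ (R + δ) ^ 2 := pow_le_pow_left₀ (norm_nonneg _) (not_lt.1 h1) 2
    calc _ ≤ (N * t ^ 2 / 4 + t * (R + δ) ^ 2 / 2) * (8 * (1 / δ' ^ 2) * 2 ^ ((k : ℝ) / 2)) := by
          gcongr
      _ = _ := by ring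

theorem abs_heatOp_sub_truncation_le (hN : 1 ≤ N) (hk : 1 ≤ k) (ht : 0 < t)
    (f : C₀(Space N k, ℝ)) {ε : ℝ} (hε : 0 ≤ ε) (z : Space N k) :
    |heatOp t f z - heatOp t (truncation hε f) z| ≤ ε := by
  rw [← heatOp_sub hN hk ht]
  exact abs_heatOp_le hN hk ht (fun w => abs_sub_softThreshold_le hε (f w)) z

theorem continuous_heatOp (hN : 1 ≤ N) (hk : 1 ≤ k) (ht : 0 < t) (f : C₀(Space N k, ℝ)) :
    Continuous (heatOp t f) := by
  refine continuous_of_uniform_approx_of_continuous fun u hu => ?_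
  obtain ⟨ε, hε, hu⟩ := Metric.mem_uniformity_dist.1 hu
  obtain ⟨R, -, hR⟩ := exists_truncation_eq_zero (half_pos hε) f
  refine ⟨_, continuous_heatOp_of_bounded_support hN ht _ hR, fun z => hu ?_⟩
  exact (abs_heatOp_sub_truncation_le hN hk ht f _ z).trans_lt (half_lt_self hε)

theorem tendsto_heatOp (hN : 1 ≤ N) (hk : 1 ≤ k) (ht : 0 < t) (f : C₀(Space N k, ℝ)) :
    Tendsto (heatOp t f) (cocompact (Space N k)) (𝓝 0) := by
  rw [Metric.tendsto_nhds]
  intro ε hε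
  obtain ⟨R, -, hR⟩ := exists_truncation_eq_zero (half_pos hε) f
  filter_upwards [Metric.tendsto_nhds.1 (tendsto_heatOp_of_bounded_support hN hk ht _ hR) _
    (half_pos hε)] with z hz
  have := abs_heatOp_sub_truncation_le hN hk ht f (half_pos hε).le z
  rw [dist_zero_right, Real.norm_eq_abs] at hz ⊢
  rw [abs_le] at this
  rw [abs_lt] at hz ⊢
  constructor <;> linarith

/-- The heat operator at a positive time as a bounded operator on `C₀`. -/
def heatCLM (hN : 1 ≤ N) (hk : 1 ≤ k) (ht : 0 < t) : C₀(Space N k, ℝ) →L[ℝ] C₀(Space N k, ℝ) :=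
  LinearMap.mkContinuous
    { toFun := fun f => ⟨⟨heatOp t f, continuous_heatOp hN hk ht f⟩, tendsto_heatOp hN hk ht f⟩
      map_add' := fun f g => by
        ext z
        change ∫ w, kernel t z w * (f w + g w) = (∫ w, kernel t z w * f w) + ∫ w, kernel t z w * g w
        simp only [mul_add]
        exact integral_add (integrable_kernel_mul hN hk ht z
          (map_continuous f).aestronglyMeasurable (abs_apply_le_norm f))
          (integrable_kernel_mul hN hk ht z
          (map_continuous g).aestronglyMeasurable (abs_apply_le_norm g))
      map_smul' := fun c f => by
        ext z
        change ∫ w, kernel t z w * (c * f w) = c * ∫ w, kernel t z w * f w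
        rw [← integral_const_mul]
        simp only [mul_left_comm] }
    1 fun f => by
      rw [one_mul]
      exact zeroAtInfty_norm_le (norm_nonneg f) (abs_heatOp_le hN hk ht (abs_apply_le_norm f))

/-- The heat semigroup on `C₀`, extended by the identity to negative times. -/
def heatSemigroup (hN : 1 ≤ N) (hk : 1 ≤ k) (t : ℝ) : C₀(Space N k, ℝ) →L[ℝ] C₀(Space N k, ℝ) :=
  if ht : 0 < t then heatCLM hN hk ht else ContinuousLinearMap.id ℝ _

theorem heatSemigroup_of_pos (hN : 1 ≤ N) (hk : 1 ≤ k) (ht : 0 < t) (f : C₀(Space N k, ℝ))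
    (z : Space N k) : heatSemigroup hN hk t f z = heatOp t f z := by
  rw [heatSemigroup, dif_pos ht]; rfl

theorem heatSemigroup_of_nonpos (hN : 1 ≤ N) (hk : 1 ≤ k) (ht : t ≤ 0) (f : C₀(Space N k, ℝ)) :
    heatSemigroup hN hk t f = f := by
  rw [heatSemigroup, dif_neg (not_lt.2 ht)]; rfl

theorem heatSemigroup_apply (hN : 1 ≤ N) (hk : 1 ≤ k) (t : ℝ) (f : C₀(Space N k, ℝ))
    (z : Space N k) : heatSemigroup hN hk t f z = semigroup N k t f z := by
  by_cases ht : 0 < t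
  · rw [heatSemigroup_of_pos hN hk ht, semigroup, if_pos ht]; rfl
  · rw [heatSemigroup_of_nonpos hN hk (not_lt.1 ht), semigroup, if_neg ht]

theorem norm_heatSemigroup_le (hN : 1 ≤ N) (hk : 1 ≤ k) (t : ℝ) (f : C₀(Space N k, ℝ)) :
    ‖heatSemigroup hN hk t f‖ ≤ ‖f‖ := by
  by_cases ht : 0 < t
  · refine zeroAtInfty_norm_le (norm_nonneg f) fun z => ?_
    rw [heatSemigroup_of_pos hN hk ht]
    exact abs_heatOp_le hN hk ht (abs_apply_le_norm f) z
  · rw [heatSemigroup_of_nonpos hN hk (not_lt.1 ht)]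

theorem heatOp_heatOp (hN : 1 ≤ N) (hk : 1 ≤ k) (ht : 0 < t) (hs : 0 < s)
    (f : C₀(Space N k, ℝ)) (z : Space N k) : heatOp t (heatOp s f) z = heatOp (t + s) f z := by
  have hF : Integrable (fun p : Space N k × Space N k => kernel t z p.1 * (kernel s p.1 p.2 * f p.2))
      (volume.prod volume) := by
    have hm : AEStronglyMeasurable (fun p : Space N k × Space N k =>
        kernel t z p.1 * (kernel s p.1 p.2 * f p.2)) (volume.prod volume) :=
      (((continuous_kernel hN ht).comp (continuous_const.prodMk continuous_fst)).mul
        ((continuous_kernel hN hs).mul ((map_continuous f).comp continuous_snd)))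
        |>.aestronglyMeasurable
    rw [integrable_prod_iff hm]
    constructor
    · exact Eventually.of_forall fun v => (integrable_kernel_mul hN hk hs v
        (map_continuous f).aestronglyMeasurable (abs_apply_le_norm f)).const_mul (kernel t z v)
    · refine ((integrable_kernel hN hk ht z).mul_const ‖f‖).mono'
        hm.norm.integral_prod_right' (Eventually.of_forall fun v => ?_)
      have h0 := kernel_nonneg hN hk ht z v
      simp only [norm_mul, Real.norm_of_nonneg h0]
      rw [integral_const_mul, norm_mul, Real.norm_of_nonneg h0]
      refine mul_le_mul_of_nonneg_left ?_ h0
      have h := abs_integral_kernel_mul_le hN hk hs v (f := fun w => |f w|) (g := fun _ => ‖f‖)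
        (fun w => by rw [abs_abs]; exact abs_apply_le_norm f w)
        ((integrable_kernel hN hk hs v).mul_const _)
      rw [integral_mul_const, integral_kernel hN hk hs, one_mul] at h
      simpa only [Real.norm_of_nonneg (kernel_nonneg hN hk hs v _), Real.norm_eq_abs] using h
  unfold heatOp
  simp only [← integral_const_mul]
  rw [integral_integral_swap hF]
  refine integral_congr_ae (Eventually.of_forall fun v => ?_)
  simp only
  rw [← integral_kernel_mul_kernel hN hk ht hs, ← integral_mul_const]
  simp only [mul_assoc]

theorem heatSemigroup_add (hN : 1 ≤ N) (hk : 1 ≤ k) (ht : 0 ≤ t) (hs : 0 ≤ s)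
    (f : C₀(Space N k, ℝ)) :
    heatSemigroup hN hk (t + s) f = heatSemigroup hN hk t (heatSemigroup hN hk s f) := by
  rcases ht.eq_or_lt with rfl | ht
  · rw [heatSemigroup_of_nonpos hN hk le_rfl, zero_add]
  rcases hs.eq_or_lt with rfl | hs
  · rw [heatSemigroup_of_nonpos hN hk le_rfl, add_zero]
  ext z
  have : ⇑(heatSemigroup hN hk s f) = heatOp s f := funext fun z => heatSemigroup_of_pos hN hk hs f z
  rw [heatSemigroup_of_pos hN hk (add_pos ht hs), heatSemigroup_of_pos hN hk ht, this,
    heatOp_heatOp hN hk ht hs]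

theorem heatSemigroup_nonneg (hN : 1 ≤ N) (hk : 1 ≤ k) (t : ℝ) {f : C₀(Space N k, ℝ)}
    (hf : ∀ z, 0 ≤ f z) (z : Space N k) : 0 ≤ heatSemigroup hN hk t f z := by
  by_cases ht : 0 < t
  · rw [heatSemigroup_of_pos hN hk ht]
    exact integral_nonneg fun w => mul_nonneg (kernel_nonneg hN hk ht z w) (hf w)
  · rw [heatSemigroup_of_nonpos hN hk (not_lt.1 ht)]
    exact hf z

end heatOp

/-! ### Strong continuity -/

/-- A contraction semigroup which is strongly continuous at `0` is strongly continuous. -/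
theorem continuous_of_semigroup {X : Type*} [NormedAddCommGroup X] [NormedSpace ℝ X]
    {S : ℝ → X →L[ℝ] X} (h1 : ∀ t x, ‖S t x‖ ≤ ‖x‖) (h0 : ∀ t ≤ 0, ∀ x, S t x = x)
    (hadd : ∀ t s, 0 ≤ t → 0 ≤ s → ∀ x, S (t + s) x = S t (S s x)) (x : X)
    (hx : Tendsto (fun t => S t x) (𝓝[>] 0) (𝓝 x)) : Continuous fun t => S t x := by
  have hmax : ∀ t, S t x = S (max t 0) x := by
    intro t
    rcases le_total t 0 with h | h
    · rw [max_eq_right h, h0 t h, h0 0 le_rfl]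
    · rw [max_eq_left h]
  have hle : ∀ a b, 0 ≤ a → a ≤ b → ‖S b x - S a x‖ ≤ ‖S (b - a) x - x‖ := by
    intro a b ha hab
    have : S b x = S a (S (b - a) x) := by
      rw [← hadd a (b - a) ha (by linarith), add_sub_cancel]
    rw [this, ← map_sub]
    exact h1 _ _
  -- All moduli of continuity reduce to the one at time `0`; `max · 0` accounts for the extension by
  -- the identity to negative times.
  have hdiff : ∀ t s, ‖S t x - S s x‖ ≤ ‖S |max t 0 - max s 0| x - x‖ := by
    intro t s
    rw [hmax t, hmax s]
    rcases le_total (max s 0) (max t 0) with h | h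
    · rw [abs_of_nonneg (by linarith)]
      exact hle _ _ (le_max_right _ _) h
    · rw [abs_of_nonpos (by linarith), neg_sub, norm_sub_rev]
      exact hle _ _ (le_max_right _ _) h
  have hcont0 : Tendsto (fun t => S t x) (𝓝 0) (𝓝 x) := by
    rw [← nhdsLE_sup_nhdsGT, tendsto_sup]
    refine ⟨tendsto_const_nhds.congr' ?_, hx⟩
    filter_upwards [self_mem_nhdsWithin] with t ht
    rw [h0 t ht]
  rw [continuous_iff_continuousAt]
  intro s
  refine tendsto_iff_norm_sub_tendsto_zero.2 ?_
  have h2 : Tendsto (fun t : ℝ => |max t 0 - max s 0|) (𝓝 s) (𝓝 0) := by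
    have : Continuous fun t : ℝ => |max t 0 - max s 0| := by fun_prop
    simpa using this.tendsto s
  have h3 := tendsto_iff_norm_sub_tendsto_zero.1 (hcont0.comp h2)
  exact squeeze_zero (fun t => norm_nonneg _) (fun t => hdiff t s) h3

section heatSemigroup

variable {N k : ℕ} {t s : ℝ}

/-- Nearby points are handled by uniform continuity; points at distance `δ` in `x` or in `y` have a
weight at least `1/2`, against `|f w - f z| ≤ 2‖f‖`. If `‖z.1‖ > R + δ` and the points are close in
`x`, both values vanish. So the `y`-weight, whose kernel integral grows with `‖z.1‖`, is needed for
bounded `z.1` only. -/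
theorem abs_sub_le_of_uniform {f : C₀(Space N k, ℝ)} {R δ ε : ℝ} (hδ : 0 < δ) (hε : 0 ≤ ε)
    (hR : ∀ w : Space N k, R < ‖w‖ → f w = 0)
    (hδε : ∀ z w : Space N k, dist z w < δ → |f w - f z| ≤ ε) (z w : Space N k) :
    |f w - f z| ≤ ε + 4 * ‖f‖ * (1 - Real.exp (-(1 / δ ^ 2 * ‖z.1 - w.1‖ ^ 2)))
      + if ‖z.1‖ ≤ R + δ then
        4 * ‖f‖ * (1 - Real.exp (-(1 / δ ^ 2 * ‖z.2 - w.2‖ ^ 2))) else 0 := by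
  have hcase : ∀ r : ℝ, δ ≤ r → |f w - f z| ≤ 4 * ‖f‖ * (1 - Real.exp (-(1 / δ ^ 2 * r ^ 2))) := by
    intro r hr
    have h1 : 1 ≤ 1 / δ ^ 2 * r ^ 2 := by
      rw [div_mul_eq_mul_div, one_mul, one_le_div (by positivity)]
      exact pow_le_pow_left₀ hδ.le hr 2
    have h2 := half_le_one_sub_exp h1
    have h3 := abs_apply_le_norm f w
    have h4 := abs_apply_le_norm f z
    have h5 := abs_sub (f w) (f z)
    nlinarith [norm_nonneg f]
  have hpos : ∀ r : ℝ, 0 ≤ 4 * ‖f‖ * (1 - Real.exp (-(1 / δ ^ 2 * r ^ 2))) := fun r =>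
    mul_nonneg (by positivity) (one_sub_exp_neg_nonneg (by positivity))
  have hif : 0 ≤ if ‖z.1‖ ≤ R + δ then
        4 * ‖f‖ * (1 - Real.exp (-(1 / δ ^ 2 * ‖z.2 - w.2‖ ^ 2))) else 0 := by
    split_ifs
    · exact hpos _
    · exact le_rfl
  by_cases h1 : δ ≤ ‖z.1 - w.1‖
  · linarith [hcase _ h1]
  by_cases hz : ‖z.1‖ ≤ R + δ
  · rw [if_pos hz]
    by_cases h2 : δ ≤ ‖z.2 - w.2‖
    · linarith [hcase _ h2, hpos ‖z.1 - w.1‖]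
    · have : dist z w < δ := by
        rw [Prod.dist_eq, dist_eq_norm, dist_eq_norm]
        exact max_lt (not_le.1 h1) (not_le.1 h2)
      linarith [hδε z w this, hpos ‖z.1 - w.1‖, hpos ‖z.2 - w.2‖]
  · have h2 : f z = 0 := hR z (by linarith [norm_fst_le z, not_le.1 hz])
    have h3 : f w = 0 := by
      refine hR w ?_
      linarith [norm_fst_le w, not_le.1 hz, not_le.1 h1, norm_sub_norm_le z.1 w.1]
    rw [h2, h3, sub_zero, abs_zero]
    linarith [hpos ‖z.1 - w.1‖]

theorem exists_abs_heatOp_sub_le (hN : 1 ≤ N) (hk : 1 ≤ k) (f : C₀(Space N k, ℝ)) {R : ℝ}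
    (hR : ∀ w : Space N k, R < ‖w‖ → f w = 0) {ε : ℝ} (hε : 0 < ε) :
    ∃ A B : ℝ, ∀ t : ℝ, 0 < t → ∀ z, |heatOp t f z - f z| ≤ ε + A * t + B * t ^ 2 := by
  obtain ⟨δ, hδ, hu⟩ := Metric.uniformContinuous_iff.1 (ZeroAtInftyContinuousMap.uniformContinuous f)
    ε hε
  have hδε : ∀ z w : Space N k, dist z w < δ → |f w - f z| ≤ ε := fun z w h => by
    have := hu h
    rw [dist_comm, Real.dist_eq] at this
    exact this.le
  -- The coefficients of `t` and `t²` in the two off-diagonal bounds with `c = 1/δ²`, where `‖z.1‖`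
  -- is replaced by `R + δ`. They do not depend on `z`, so the convergence is uniform.
  refine ⟨4 * ‖f‖ * (N * (1 / δ ^ 2) + (R + δ) ^ 2 / 2 * (8 * (1 / δ ^ 2) * 2 ^ ((k : ℝ) / 2))),
    4 * ‖f‖ * (N / 4 * (8 * (1 / δ ^ 2) * 2 ^ ((k : ℝ) / 2))), fun t ht z => ?_⟩
  set c := 1 / δ ^ 2 with hc
  have hc0 : 0 < c := by positivity
  have hi1 := integrable_kernel_mul_one_sub hN hk ht z (g := fun w => c * ‖z.1 - w.1‖ ^ 2)
    (by fun_prop) (fun w => by positivity)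
  have hi2 := integrable_kernel_mul_one_sub hN hk ht z (g := fun w => c * ‖z.2 - w.2‖ ^ 2)
    (by fun_prop) (fun w => by positivity)
  have e1 : heatOp t f z - f z = ∫ w, kernel t z w * (f w - f z) := by
    simp only [mul_sub]
    rw [integral_sub (integrable_kernel_mul hN hk ht z (map_continuous f).aestronglyMeasurable
      (abs_apply_le_norm f)) ((integrable_kernel hN hk ht z).mul_const _), integral_mul_const,
      integral_kernel hN hk ht, one_mul, heatOp]
  have h1 := integral_kernel_mul_fst_le hN hk ht hc0 z
  have h2 := integral_kernel_mul_snd_le hN hk ht hc0 z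
  have hf0 : 0 ≤ 4 * ‖f‖ := by positivity
  rw [e1]
  by_cases hz : ‖z.1‖ ≤ R + δ
  · have hb := fun w => abs_sub_le_of_uniform hδ hε.le hR hδε z w
    simp only [if_pos hz, ← hc] at hb
    have e2 : ∀ w, kernel t z w * (ε + 4 * ‖f‖ * (1 - Real.exp (-(c * ‖z.1 - w.1‖ ^ 2)))
        + 4 * ‖f‖ * (1 - Real.exp (-(c * ‖z.2 - w.2‖ ^ 2))))
        = kernel t z w * ε + 4 * ‖f‖ * (kernel t z w * (1 - Real.exp (-(c * ‖z.1 - w.1‖ ^ 2))))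
        + 4 * ‖f‖ * (kernel t z w * (1 - Real.exp (-(c * ‖z.2 - w.2‖ ^ 2)))) := fun w => by ring
    have hi3 := (integrable_kernel hN hk ht z).mul_const ε
    have hi4 : Integrable fun w => kernel t z w * ε
        + 4 * ‖f‖ * (kernel t z w * (1 - Real.exp (-(c * ‖z.1 - w.1‖ ^ 2)))) :=
      hi3.add (hi1.const_mul _)
    have h := abs_integral_kernel_mul_le hN hk ht z hb (by
      simp only [e2]
      exact hi4.add (hi2.const_mul _))
    simp only [e2] at h
    rw [integral_add hi4 (hi2.const_mul _),
      integral_add hi3 (hi1.const_mul _), integral_mul_const, integral_const_mul,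
      integral_const_mul, integral_kernel hN hk ht] at h
    have h4 : ‖z.1‖ ^ 2 ≤ (R + δ) ^ 2 := pow_le_pow_left₀ (norm_nonneg _) hz 2
    have h5 : (N * t ^ 2 / 4 + t * ‖z.1‖ ^ 2 / 2) * (8 * c * 2 ^ ((k : ℝ) / 2))
        ≤ (N * t ^ 2 / 4 + t * (R + δ) ^ 2 / 2) * (8 * c * 2 ^ ((k : ℝ) / 2)) := by gcongr
    have h6 := mul_le_mul_of_nonneg_left h1 hf0
    have h7 := mul_le_mul_of_nonneg_left (h2.trans h5) hf0
    linarith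
  · have hb := fun w => abs_sub_le_of_uniform hδ hε.le hR hδε z w
    simp only [if_neg hz, ← hc, add_zero] at hb
    have e2 : ∀ w, kernel t z w * (ε + 4 * ‖f‖ * (1 - Real.exp (-(c * ‖z.1 - w.1‖ ^ 2))))
        = kernel t z w * ε + 4 * ‖f‖ * (kernel t z w * (1 - Real.exp (-(c * ‖z.1 - w.1‖ ^ 2)))) :=
      fun w => by ring
    have hi3 := (integrable_kernel hN hk ht z).mul_const ε
    have h := abs_integral_kernel_mul_le hN hk ht z hb (by
      simp only [e2]
      exact hi3.add (hi1.const_mul _))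
    simp only [e2] at h
    rw [integral_add hi3 (hi1.const_mul _), integral_mul_const, integral_const_mul,
      integral_kernel hN hk ht] at h
    have h6 := mul_le_mul_of_nonneg_left h1 hf0
    have h7 : 0 ≤ 4 * ‖f‖ * ((R + δ) ^ 2 / 2 * (8 * c * 2 ^ ((k : ℝ) / 2))) * t := by positivity
    have h8 : 0 ≤ 4 * ‖f‖ * (N / 4 * (8 * c * 2 ^ ((k : ℝ) / 2))) * t ^ 2 := by positivity
    linarith

theorem tendsto_heatSemigroup_zero (hN : 1 ≤ N) (hk : 1 ≤ k) (f : C₀(Space N k, ℝ)) :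
    Tendsto (fun t => heatSemigroup hN hk t f) (𝓝[>] 0) (𝓝 f) := by
  rw [Metric.tendsto_nhds]
  intro ε hε
  have hε4 : 0 < ε / 4 := by positivity
  obtain ⟨R, -, hR⟩ := exists_truncation_eq_zero hε4 f
  obtain ⟨A, B, hAB⟩ := exists_abs_heatOp_sub_le hN hk _ hR hε4
  have hlim : Tendsto (fun t : ℝ => ε / 4 + A * t + B * t ^ 2) (𝓝[>] 0) (𝓝 (ε / 4)) := by
    have : Continuous fun t : ℝ => ε / 4 + A * t + B * t ^ 2 := by fun_prop
    simpa using (this.tendsto 0).mono_left nhdsWithin_le_nhds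
  filter_upwards [hlim.eventually (gt_mem_nhds (show ε / 4 < ε / 3 by linarith)),
    self_mem_nhdsWithin] with t h1 ht
  rw [dist_eq_norm]
  refine lt_of_le_of_lt (zeroAtInfty_norm_le (C := ε / 4 + ε / 3 + ε / 4) (by positivity)
    fun z => ?_) (by linarith)
  rw [ZeroAtInftyContinuousMap.sub_apply, heatSemigroup_of_pos hN hk ht]
  have h2 := abs_heatOp_sub_truncation_le hN hk ht f hε4.le z
  have h3 := hAB t ht z
  have h4 : |f z - truncation hε4.le f z| ≤ ε / 4 := abs_sub_softThreshold_le hε4.le (f z)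
  rw [abs_le] at *
  constructor <;> linarith

theorem continuous_heatSemigroup (hN : 1 ≤ N) (hk : 1 ≤ k) (f : C₀(Space N k, ℝ)) :
    Continuous fun t => heatSemigroup hN hk t f :=
  continuous_of_semigroup (norm_heatSemigroup_le hN hk)
    (fun _ ht f => heatSemigroup_of_nonpos hN hk ht f)
    (fun _ _ ht hs f => heatSemigroup_add hN hk ht hs f) f (tendsto_heatSemigroup_zero hN hk f)

end heatSemigroup

/-! ### Volterra equations with memory in Banach spaces -/

section memory

variable {X : Type*} [NormedAddCommGroup X] [NormedSpace ℝ X]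

/-- The memory integral `∫₀ˢ (s-τ)^{-γ} F(τ) dτ`. -/
def memory (γ : ℝ) (F : ℝ → X) (s : ℝ) : X := ∫ τ in (0 : ℝ)..s, (s - τ) ^ (-γ) • F τ

theorem memory_congr {γ : ℝ} {F G : ℝ → X} {s : ℝ} (hs : 0 ≤ s) (h : EqOn F G (Icc 0 s)) :
    memory γ F s = memory γ G s := by
  refine intervalIntegral.integral_congr fun τ hτ => ?_
  rw [uIcc_of_le hs] at hτ
  simp only [h hτ]

theorem intervalIntegrable_sub_rpow {γ : ℝ} (hγ : γ < 1) (s : ℝ) :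
    IntervalIntegrable (fun τ : ℝ => (s - τ) ^ (-γ)) volume 0 s := by
  have h := (intervalIntegral.intervalIntegrable_rpow' (a := s) (b := 0) (r := -γ)
    (by linarith)).comp_sub_left s
  simpa using h

theorem intervalIntegrable_memory {γ : ℝ} (hγ : γ < 1) {F : ℝ → X} {s : ℝ} (hs : 0 ≤ s)
    (hF : ContinuousOn F (Icc 0 s)) :
    IntervalIntegrable (fun τ => (s - τ) ^ (-γ) • F τ) volume 0 s :=
  (intervalIntegrable_sub_rpow hγ s).smul_continuousOn (by rwa [uIcc_of_le hs])

theorem integral_sub_rpow {γ : ℝ} (hγ : γ < 1) (s : ℝ) :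
    ∫ τ in (0 : ℝ)..s, (s - τ) ^ (-γ) = s ^ (1 - γ) / (1 - γ) := by
  rw [intervalIntegral.integral_comp_sub_left (fun x => x ^ (-γ)) s, sub_self, sub_zero,
    integral_rpow (Or.inl (by linarith)), neg_add_eq_sub, Real.zero_rpow (by linarith), sub_zero]

/-- The rescaling `τ = sσ` frees the singular weight of `s`. Continuity in `s` then follows by
dominated convergence with a fixed integrable weight. -/
theorem memory_eq_smul {γ : ℝ} (hγ : γ < 1) (F : ℝ → X) {s : ℝ} (hs : 0 ≤ s) :
    memory γ F s = s ^ (1 - γ) • ∫ σ in (0 : ℝ)..1, (1 - σ) ^ (-γ) • F (s * σ) := by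
  rcases hs.eq_or_lt with rfl | hs
  · simp [memory, Real.zero_rpow (show 1 - γ ≠ 0 by linarith)]
  have h := intervalIntegral.smul_integral_comp_mul_left (a := 0) (b := 1)
    (fun τ => (s - τ) ^ (-γ) • F τ) s
  rw [mul_zero, mul_one] at h
  have h' : ∫ σ in (0 : ℝ)..1, (s - s * σ) ^ (-γ) • F (s * σ)
      = s ^ (-γ) • ∫ σ in (0 : ℝ)..1, (1 - σ) ^ (-γ) • F (s * σ) := by
    rw [← intervalIntegral.integral_smul]
    refine intervalIntegral.integral_congr fun σ hσ => ?_
    rw [uIcc_of_le zero_le_one] at hσ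
    have e : s - s * σ = s * (1 - σ) := by ring
    simp only [e]
    rw [Real.mul_rpow hs.le (by linarith [hσ.2]), mul_smul]
  rw [memory, ← h, h', show 1 - γ = 1 + -γ by ring, Real.rpow_add hs, Real.rpow_one, mul_smul]

theorem continuous_integral_memory {γ : ℝ} (hγ : γ < 1) {F : ℝ → X} (hF : Continuous F) :
    Continuous fun s : ℝ => ∫ σ in (0 : ℝ)..1, (1 - σ) ^ (-γ) • F (s * σ) := by
  rw [continuous_iff_continuousAt]
  intro s₀
  obtain ⟨C, hC⟩ := (isCompact_Icc (a := -(|s₀| + 1)) (b := |s₀| + 1)).exists_bound_of_continuousOn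
    hF.continuousOn
  have hint := intervalIntegrable_sub_rpow hγ 1
  refine intervalIntegral.continuousAt_of_dominated_interval
    (bound := fun σ => (1 - σ) ^ (-γ) * C) (Eventually.of_forall fun s => ?_) ?_
    (hint.mul_const C) (Eventually.of_forall fun σ _ => ?_)
  · exact (hint.smul_continuousOn (g := fun σ => F (s * σ))
      (by fun_prop)).def'.aestronglyMeasurable
  · have hnear : ∀ᶠ s in 𝓝 s₀, |s - s₀| < 1 := by
      have : Continuous fun s : ℝ => |s - s₀| := by fun_prop
      exact this.tendsto s₀ |>.eventually (gt_mem_nhds (by simp))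
    filter_upwards [hnear] with s hs
    refine Eventually.of_forall fun σ hσ => ?_
    rw [uIoc_of_le zero_le_one] at hσ
    rw [norm_smul, Real.norm_of_nonneg (Real.rpow_nonneg (by linarith [hσ.2]) _)]
    refine mul_le_mul_of_nonneg_left (hC _ ?_) (Real.rpow_nonneg (by linarith [hσ.2]) _)
    rw [mem_Icc, ← abs_le, abs_mul, abs_of_pos hσ.1]
    have h1 : |s| ≤ |s₀| + 1 := by
      have := abs_sub_abs_le_abs_sub s s₀
      linarith
    exact (mul_le_of_le_one_right (abs_nonneg s) hσ.2).trans h1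
  · exact (continuous_const.smul (by fun_prop : Continuous fun s => F (s * σ))).continuousAt

theorem continuousOn_memory {γ : ℝ} (hγ : γ < 1) {F : ℝ → X} (hF : Continuous F) :
    ContinuousOn (memory γ F) (Ici 0) := by
  have h : ContinuousOn (fun s : ℝ => s ^ (1 - γ) • ∫ σ in (0 : ℝ)..1, (1 - σ) ^ (-γ) • F (s * σ))
      (Ici 0) :=
    ((Real.continuous_rpow_const (by linarith)).smul (continuous_integral_memory hγ hF)).continuousOn
  exact h.congr fun s hs => memory_eq_smul hγ F hs

/-- The constant extension to negative times gives a globally continuous integrand for the outer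
convolution. -/
theorem continuous_memory_max {γ : ℝ} (hγ : γ < 1) {F : ℝ → X} (hF : Continuous F) :
    Continuous fun s => memory γ F (max s 0) := by
  have h := (continuousOn_memory hγ hF).comp (f := fun s : ℝ => max s 0) (s := univ)
    (by fun_prop) fun s _ => le_max_right s 0
  exact continuousOn_univ.1 h

theorem norm_memory_sub_le {γ : ℝ} (hγ : γ < 1) {F G : ℝ → X} (hF : Continuous F)
    (hG : Continuous G) {s B : ℝ} (hs : 0 ≤ s) (h : ∀ τ ∈ Icc 0 s, ‖F τ - G τ‖ ≤ B) :
    ‖memory γ F s - memory γ G s‖ ≤ s ^ (1 - γ) / (1 - γ) * B := by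
  rw [memory, memory, ← intervalIntegral.integral_sub
    (intervalIntegrable_memory hγ hs hF.continuousOn)
    (intervalIntegrable_memory hγ hs hG.continuousOn), ← integral_sub_rpow hγ,
    ← intervalIntegral.integral_mul_const]
  refine intervalIntegral.norm_integral_le_of_norm_le hs (Eventually.of_forall fun τ hτ => ?_)
    ((intervalIntegrable_sub_rpow hγ s).mul_const B)
  have h0 := Real.rpow_nonneg (sub_nonneg.2 hτ.2) (-γ)
  rw [← smul_sub, norm_smul, Real.norm_of_nonneg h0]
  exact mul_le_mul_of_nonneg_left (h τ ⟨hτ.1.le, hτ.2⟩) h0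

end memory

/-- The data of a semilinear evolution equation with memory in a Banach space: a strongly
continuous family of contractions and two globally Lipschitz nonlinearities. -/
structure MemoryProblem (X : Type*) [NormedAddCommGroup X] [NormedSpace ℝ X] where
  /-- the linear propagator -/
  S : ℝ → X →L[ℝ] X
  norm_le : ∀ t x, ‖S t x‖ ≤ ‖x‖
  cont : ∀ x, Continuous fun t => S t x
  /-- the coefficient of the memory term -/
  k₁ : ℝ
  /-- the coefficient of the instantaneous term -/
  k₂ : ℝ
  /-- the exponent of the memory kernel -/
  γ : ℝ
  γ_lt : γ < 1
  /-- the nonlinearity of the memory term -/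
  F₁ : X → X
  /-- the nonlinearity of the instantaneous term -/
  F₂ : X → X
  /-- a common Lipschitz constant -/
  L : NNReal
  lip₁ : LipschitzWith L F₁
  lip₂ : LipschitzWith L F₂

namespace MemoryProblem

variable {X : Type*} [NormedAddCommGroup X] [NormedSpace ℝ X] (P : MemoryProblem X)

/-- The right-hand side of the integral equation. -/
def rhs (x₀ : X) (u : ℝ → X) (t : ℝ) : X :=
  P.S t x₀ + P.k₁ • (∫ s in (0 : ℝ)..t, P.S (t - s) (memory P.γ (fun τ => P.F₁ (u τ)) s))
    + P.k₂ • ∫ s in (0 : ℝ)..t, P.S (t - s) (P.F₂ (u s))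

/-- Causality. It allows a function on `[0, t]` to be replaced by a globally continuous extension.
-/
theorem rhs_congr (x₀ : X) {u v : ℝ → X} {t : ℝ} (ht : 0 ≤ t) (h : EqOn u v (Icc 0 t)) :
    P.rhs x₀ u t = P.rhs x₀ v t := by
  have h1 : ∫ s in (0 : ℝ)..t, P.S (t - s) (memory P.γ (fun τ => P.F₁ (u τ)) s)
      = ∫ s in (0 : ℝ)..t, P.S (t - s) (memory P.γ (fun τ => P.F₁ (v τ)) s) := by
    refine intervalIntegral.integral_congr fun s hs => ?_
    rw [uIcc_of_le ht] at hs
    have e : memory P.γ (fun τ => P.F₁ (u τ)) s = memory P.γ (fun τ => P.F₁ (v τ)) s :=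
      memory_congr hs.1 fun τ hτ => by simp only [h ⟨hτ.1, hτ.2.trans hs.2⟩]
    simp only [e]
  have h2 : ∫ s in (0 : ℝ)..t, P.S (t - s) (P.F₂ (u s))
      = ∫ s in (0 : ℝ)..t, P.S (t - s) (P.F₂ (v s)) := by
    refine intervalIntegral.integral_congr fun s hs => ?_
    rw [uIcc_of_le ht] at hs
    simp only [h hs]
  rw [rhs, rhs, h1, h2]

/-- Strong continuity and the uniform bound on the operators give joint continuity. -/
theorem continuous_S : Continuous fun p : ℝ × X => P.S p.1 p.2 := by
  rw [continuous_iff_continuousAt]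
  rintro ⟨t₀, x₀⟩
  refine tendsto_iff_norm_sub_tendsto_zero.2 ?_
  have h1 : Tendsto (fun p : ℝ × X => ‖p.2 - x₀‖ + ‖P.S p.1 x₀ - P.S t₀ x₀‖) (𝓝 (t₀, x₀))
      (𝓝 0) := by
    have hc := P.cont x₀
    have : Continuous fun p : ℝ × X => ‖p.2 - x₀‖ + ‖P.S p.1 x₀ - P.S t₀ x₀‖ := by
      have h2 : Continuous fun p : ℝ × X => P.S p.1 x₀ := hc.comp continuous_fst
      fun_prop
    simpa using this.tendsto (t₀, x₀)
  refine squeeze_zero (fun p => norm_nonneg _) (fun p => ?_) h1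
  have e : P.S p.1 p.2 - P.S t₀ x₀ = P.S p.1 (p.2 - x₀) + (P.S p.1 x₀ - P.S t₀ x₀) := by
    rw [map_sub]; abel
  rw [e]
  exact (norm_add_le _ _).trans (add_le_add_left (P.norm_le _ _) _)

theorem continuous_S_comp {α : Type*} [TopologicalSpace α] {f : α → ℝ} {g : α → X}
    (hf : Continuous f) (hg : Continuous g) : Continuous fun a => P.S (f a) (g a) :=
  P.continuous_S.comp (hf.prodMk hg)

theorem continuous_convolution [CompleteSpace X] {g : ℝ → X} (hg : Continuous g) :
    Continuous fun t => ∫ s in (0 : ℝ)..t, P.S (t - s) (g s) := by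
  refine intervalIntegral.continuous_parametric_intervalIntegral_of_continuous
    (f := fun t s => P.S (t - s) (g s)) ?_ continuous_id
  exact P.continuous_S_comp (by fun_prop) (by fun_prop)

theorem integral_memory_eq (F : ℝ → X) {t : ℝ} (ht : 0 ≤ t) :
    ∫ s in (0 : ℝ)..t, P.S (t - s) (memory P.γ F s)
      = ∫ s in (0 : ℝ)..t, P.S (t - s) (memory P.γ F (max s 0)) := by
  refine intervalIntegral.integral_congr fun s hs => ?_
  rw [uIcc_of_le ht] at hs
  simp only [max_eq_left hs.1]

theorem continuousOn_rhs [CompleteSpace X] (x₀ : X) {u : ℝ → X} (hu : Continuous u) :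
    ContinuousOn (P.rhs x₀ u) (Ici 0) := by
  have h1 := P.continuous_convolution (continuous_memory_max P.γ_lt (P.lip₁.continuous.comp hu))
  have h2 := P.continuous_convolution (P.lip₂.continuous.comp hu)
  have h3 := (((P.cont x₀).add (h1.const_smul P.k₁)).add (h2.const_smul P.k₂)).continuousOn
    (s := Ici 0)
  refine h3.congr fun t ht => ?_
  rw [rhs, integral_memory_eq P _ ht]
  rfl

/-- The constant in the exponentially weighted contraction estimate on `[0, T]`. -/
def bound (T : ℝ) : ℝ := P.L * (|P.k₁| * (T ^ (1 - P.γ) / (1 - P.γ)) + |P.k₂|)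

theorem bound_nonneg {T : ℝ} (hT : 0 ≤ T) : 0 ≤ P.bound T := by
  have := P.γ_lt
  have : 0 ≤ T ^ (1 - P.γ) / (1 - P.γ) := div_nonneg (Real.rpow_nonneg hT _) (by linarith)
  unfold bound
  positivity

theorem integral_exp_le {lam : ℝ} (hl : 0 < lam) (t : ℝ) :
    ∫ s in (0 : ℝ)..t, Real.exp (lam * s) ≤ Real.exp (lam * t) / lam := by
  rw [intervalIntegral.integral_comp_mul_left (fun x => Real.exp x) hl.ne', integral_exp,
    smul_eq_mul, mul_zero, Real.exp_zero, div_eq_inv_mul]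
  gcongr
  linarith

/-- Integrating the weight `exp(λs)` gains a factor `1/λ`; this produces a contraction on
arbitrarily long intervals. -/
theorem norm_convolution_sub_le {f g : ℝ → X} (hf : Continuous f) (hg : Continuous g)
    {t lam B : ℝ} (ht : 0 ≤ t) (hl : 0 < lam) (hB : 0 ≤ B)
    (h : ∀ s ∈ Icc 0 t, ‖f s - g s‖ ≤ B * Real.exp (lam * s)) :
    ‖(∫ s in (0 : ℝ)..t, P.S (t - s) (f s)) - ∫ s in (0 : ℝ)..t, P.S (t - s) (g s)‖
      ≤ B * (Real.exp (lam * t) / lam) := by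
  have hi : ∀ {f : ℝ → X}, Continuous f →
      IntervalIntegrable (fun s => P.S (t - s) (f s)) volume 0 t := fun hf =>
    (P.continuous_S_comp (by fun_prop) hf).intervalIntegrable _ _
  rw [← intervalIntegral.integral_sub (hi hf) (hi hg)]
  refine (intervalIntegral.norm_integral_le_of_norm_le (g := fun s => B * Real.exp (lam * s)) ht
    (Eventually.of_forall fun s hs => ?_)
    (Continuous.intervalIntegrable (by fun_prop) _ _)).trans ?_
  · rw [← map_sub]
    exact (P.norm_le _ _).trans (h s ⟨hs.1.le, hs.2⟩)
  · rw [intervalIntegral.integral_const_mul]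
    exact mul_le_mul_of_nonneg_left (integral_exp_le hl t) hB

/-- In the memory term the weight increases, so `exp(λτ) ≤ exp(λs)` and the inner integral costs
only the mass `T^(1-γ)/(1-γ)` of its kernel. The outer convolution supplies `1/λ`. -/
theorem norm_rhs_sub_le (x₀ : X) {u v : ℝ → X} (hu : Continuous u) (hv : Continuous v)
    {T lam D : ℝ} (hl : 0 < lam) (hD : 0 ≤ D)
    (h : ∀ t ∈ Icc 0 T, ‖u t - v t‖ ≤ D * Real.exp (lam * t)) {t : ℝ} (ht : t ∈ Icc 0 T) :
    ‖P.rhs x₀ u t - P.rhs x₀ v t‖ ≤ P.bound T / lam * D * Real.exp (lam * t) := by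
  have hγ := P.γ_lt
  have hT : 0 ≤ T := ht.1.trans ht.2
  set C := T ^ (1 - P.γ) / (1 - P.γ) with hC
  have hC0 : 0 ≤ C := div_nonneg (Real.rpow_nonneg hT _) (by linarith)
  have hF : ∀ {F : X → X}, LipschitzWith P.L F → ∀ s ∈ Icc 0 T,
      ‖F (u s) - F (v s)‖ ≤ P.L * D * Real.exp (lam * s) := fun hF s hs => by
    have := hF.dist_le_mul (u s) (v s)
    rw [dist_eq_norm, dist_eq_norm] at this
    refine this.trans ?_
    rw [mul_assoc]
    exact mul_le_mul_of_nonneg_left (h s hs) P.L.2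
  have h1 := P.norm_convolution_sub_le
    (continuous_memory_max P.γ_lt (P.lip₁.continuous.comp hu))
    (continuous_memory_max P.γ_lt (P.lip₁.continuous.comp hv)) ht.1 hl
    (B := C * (P.L * D)) (by positivity) fun s hs => by
      rw [max_eq_left hs.1]
      refine (norm_memory_sub_le P.γ_lt (P.lip₁.continuous.comp hu) (P.lip₁.continuous.comp hv)
        hs.1 (B := P.L * D * Real.exp (lam * s)) fun τ hτ => ?_).trans ?_
      · refine (hF P.lip₁ τ ⟨hτ.1, hτ.2.trans (hs.2.trans ht.2)⟩).trans ?_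
        have := hτ.2
        gcongr
      · rw [mul_assoc]
        have h1 : s ^ (1 - P.γ) / (1 - P.γ) ≤ C :=
          div_le_div_of_nonneg_right (Real.rpow_le_rpow hs.1 (hs.2.trans ht.2) (by linarith))
            (by linarith)
        refine (mul_le_mul_of_nonneg_right h1 (by positivity)).trans (le_of_eq (by ring))
  have h2 := P.norm_convolution_sub_le (P.lip₂.continuous.comp hu) (P.lip₂.continuous.comp hv)
    ht.1 hl (B := P.L * D) (by positivity) fun s hs => hF P.lip₂ s ⟨hs.1, hs.2.trans ht.2⟩
  rw [rhs, rhs, integral_memory_eq P _ ht.1, integral_memory_eq P (fun τ => P.F₁ (v τ)) ht.1]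
  have e : ∀ a b c d e : X, a + P.k₁ • b + P.k₂ • c - (a + P.k₁ • d + P.k₂ • e)
      = P.k₁ • (b - d) + P.k₂ • (c - e) := fun a b c d e => by
    rw [smul_sub, smul_sub]; abel
  rw [e]
  refine (norm_add_le _ _).trans ?_
  rw [norm_smul, norm_smul, Real.norm_eq_abs, Real.norm_eq_abs]
  refine (add_le_add (mul_le_mul_of_nonneg_left h1 (abs_nonneg _))
    (mul_le_mul_of_nonneg_left h2 (abs_nonneg _))).trans (le_of_eq ?_)
  rw [bound, ← hC]
  field_simp

/-- A weight for which the integral equation is a contraction with constant `1/2`. -/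
def weight (T : ℝ) : ℝ := 2 * P.bound T + 1

theorem weight_pos {T : ℝ} (hT : 0 ≤ T) : 0 < P.weight T := by
  have := P.bound_nonneg hT
  unfold weight; linarith

theorem norm_rhs_sub_le_half (x₀ : X) {u v : ℝ → X} (hu : Continuous u) (hv : Continuous v)
    {T D : ℝ} (hD : 0 ≤ D)
    (h : ∀ t ∈ Icc 0 T, ‖u t - v t‖ ≤ D * Real.exp (P.weight T * t)) {t : ℝ} (ht : t ∈ Icc 0 T) :
    ‖P.rhs x₀ u t - P.rhs x₀ v t‖ ≤ D / 2 * Real.exp (P.weight T * t) := by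
  have hT : 0 ≤ T := ht.1.trans ht.2
  have hw := P.weight_pos hT
  refine (P.norm_rhs_sub_le x₀ hu hv hw hD h ht).trans ?_
  have : P.bound T / P.weight T ≤ 1 / 2 := by
    rw [div_le_div_iff₀ hw two_pos, weight]
    linarith
  have h2 := mul_le_mul_of_nonneg_right this hD
  gcongr
  linarith

/-- Solutions of the integral equation on `[0, T]` are unique. -/
theorem eqOn_of_eq_rhs (x₀ : X) {u v : ℝ → X} {T : ℝ} (hu : ContinuousOn u (Icc 0 T))
    (hv : ContinuousOn v (Icc 0 T)) (hu' : ∀ t ∈ Icc 0 T, u t = P.rhs x₀ u t)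
    (hv' : ∀ t ∈ Icc 0 T, v t = P.rhs x₀ v t) : EqOn u v (Icc 0 T) := by
  rcases lt_or_ge T 0 with hT | hT
  · intro t ht
    linarith [ht.1, ht.2]
  set U : ℝ → X := IccExtend hT ((Icc 0 T).domRestrict u) with hU
  set V : ℝ → X := IccExtend hT ((Icc 0 T).domRestrict v) with hV
  have hUc : Continuous U := (continuousOn_iff_continuous_domRestrict.1 hu).Icc_extend'
  have hVc : Continuous V := (continuousOn_iff_continuous_domRestrict.1 hv).Icc_extend'
  have hUu : EqOn U u (Icc 0 T) := fun t ht => by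
    rw [hU, IccExtend_of_mem _ _ ht]; rfl
  have hVv : EqOn V v (Icc 0 T) := fun t ht => by
    rw [hV, IccExtend_of_mem _ _ ht]; rfl
  have hsub : ∀ {t}, t ∈ Icc 0 T → Icc 0 t ⊆ Icc 0 T := fun ht => Icc_subset_Icc_right ht.2
  have hU' : ∀ t ∈ Icc 0 T, U t = P.rhs x₀ U t := fun t ht => by
    rw [hUu ht, P.rhs_congr x₀ ht.1 (hUu.mono (hsub ht))]
    exact hu' t ht
  have hV' : ∀ t ∈ Icc 0 T, V t = P.rhs x₀ V t := fun t ht => by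
    rw [hVv ht, P.rhs_congr x₀ ht.1 (hVv.mono (hsub ht))]
    exact hv' t ht
  -- Let `D` be the maximum of the weighted difference. The contraction estimate at the maximizing
  -- time gives `D ≤ D / 2`.
  obtain ⟨t₀, ht₀, hmax⟩ := (isCompact_Icc (a := (0 : ℝ)) (b := T)).exists_isMaxOn
    ⟨0, left_mem_Icc.2 hT⟩
    (f := fun t => ‖U t - V t‖ * Real.exp (-(P.weight T * t))) (by fun_prop)
  set D := ‖U t₀ - V t₀‖ * Real.exp (-(P.weight T * t₀)) with hDdef
  have hD : 0 ≤ D := by positivity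
  have hle : ∀ t ∈ Icc 0 T, ‖U t - V t‖ ≤ D * Real.exp (P.weight T * t) := fun t ht => by
    have := hmax ht
    simp only [mem_ofPred_eq] at this
    rw [Real.exp_neg, ← div_eq_mul_inv, div_le_iff₀ (Real.exp_pos _)] at this
    exact this
  have h2 := P.norm_rhs_sub_le_half x₀ hUc hVc hD hle ht₀
  rw [← hU' t₀ ht₀, ← hV' t₀ ht₀] at h2
  have h3 : D ≤ D / 2 := by
    have := mul_le_mul_of_nonneg_right h2 (Real.exp_nonneg (-(P.weight T * t₀)))
    rwa [mul_assoc, ← Real.exp_add, add_neg_cancel, Real.exp_zero, mul_one] at this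
  have hD0 : D = 0 := by linarith
  intro t ht
  have := hle t ht
  rw [hD0, zero_mul, norm_le_zero_iff, sub_eq_zero, hUu ht, hVv ht] at this
  exact this

/-- The integral equation can be solved on every bounded interval. -/
theorem exists_eq_rhs_on_Icc [CompleteSpace X] (x₀ : X) {T : ℝ} (hT : 0 ≤ T) :
    ∃ u : ℝ → X, Continuous u ∧ ∀ t ∈ Icc 0 T, u t = P.rhs x₀ u t := by
  have : Nonempty (Icc (0 : ℝ) T) := ⟨⟨0, left_mem_Icc.2 hT⟩⟩
  -- The unknown `w` is the solution divided by the exponential weight, so that the usual sup norm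
  -- of `w` is the weighted norm of the solution.
  set U : C(Icc (0 : ℝ) T, X) → ℝ → X := fun w t =>
    Real.exp (P.weight T * t) • IccExtend hT w t with hU
  have hUc : ∀ w, Continuous (U w) := fun w => by
    have : Continuous (IccExtend hT w) := w.continuous.Icc_extend'
    fun_prop
  set Φ : C(Icc (0 : ℝ) T, X) → C(Icc (0 : ℝ) T, X) := fun w =>
    ⟨fun t => Real.exp (-(P.weight T * t)) • P.rhs x₀ (U w) t, by
      have h := (P.continuousOn_rhs x₀ (hUc w)).mono (Icc_subset_Ici_self : Icc 0 T ⊆ Ici 0)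
      have h2 := continuousOn_iff_continuous_domRestrict.1 h
      exact (Continuous.smul (by fun_prop) h2)⟩ with hΦ
  have hcontr : ContractingWith (1 / 2) Φ := by
    refine ⟨by norm_num [← NNReal.coe_lt_coe], LipschitzWith.of_dist_le_mul fun w w' => ?_⟩
    rw [ContinuousMap.dist_le (by positivity)]
    intro t
    have h := P.norm_rhs_sub_le_half x₀ (hUc w) (hUc w') (dist_nonneg (x := w) (y := w'))
      (T := T) (fun s hs => ?_) t.2
    · rw [dist_eq_norm]
      simp only [hΦ, ContinuousMap.coe_mk]
      rw [← smul_sub, norm_smul, Real.norm_of_nonneg (Real.exp_nonneg _)]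
      refine (mul_le_mul_of_nonneg_left h (Real.exp_nonneg _)).trans (le_of_eq ?_)
      rw [mul_left_comm, ← Real.exp_add, neg_add_cancel, Real.exp_zero]
      push_cast
      ring
    · simp only [hU]
      rw [← smul_sub, norm_smul, Real.norm_of_nonneg (Real.exp_nonneg _), mul_comm]
      refine mul_le_mul_of_nonneg_right ?_ (Real.exp_nonneg _)
      rw [← dist_eq_norm, IccExtend_of_mem _ _ hs, IccExtend_of_mem _ _ hs]
      exact ContinuousMap.dist_apply_le_dist _
  obtain ⟨w, hw⟩ : ∃ w, Φ w = w := ⟨_, hcontr.fixedPoint_isFixedPt⟩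
  refine ⟨U w, hUc w, fun t ht => ?_⟩
  have h := congrArg (fun f : C(Icc (0 : ℝ) T, X) => f ⟨t, ht⟩) hw
  simp only [hΦ, ContinuousMap.coe_mk] at h
  have h2 : U w t = Real.exp (P.weight T * t) • w ⟨t, ht⟩ := by
    simp only [hU]
    rw [IccExtend_of_mem _ _ ht]
  rw [h2, ← h, smul_smul, ← Real.exp_add, add_neg_cancel, Real.exp_zero, one_smul]

/-- The integral equation has a global solution. -/
theorem exists_eq_rhs [CompleteSpace X] (x₀ : X) :
    ∃ u : ℝ → X, Continuous u ∧ ∀ t, 0 ≤ t → u t = P.rhs x₀ u t := by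
  choose! U hUc hU using fun T (hT : 0 ≤ T) => P.exists_eq_rhs_on_Icc x₀ hT
  have huniq : ∀ s T, 0 ≤ s → s ≤ T → U T s = U s s := fun s T hs hsT =>
    P.eqOn_of_eq_rhs x₀ (hUc T (hs.trans hsT)).continuousOn (hUc s hs).continuousOn
      (fun t ht => hU T (hs.trans hsT) t ⟨ht.1, ht.2.trans hsT⟩) (hU s hs) (right_mem_Icc.2 hs)
  -- The value at time `t` is taken from the solution on `[0, t]`; uniqueness makes it agree with
  -- the solution on any longer interval.
  refine ⟨fun t => U (max t 0) (max t 0), ?_, fun t ht => ?_⟩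
  · rw [continuous_iff_continuousAt]
    intro t
    have hT : 0 ≤ |t| + 1 := by positivity
    have h : Continuous fun s : ℝ => U (|t| + 1) (max s 0) :=
      (hUc _ hT).comp (by fun_prop)
    refine h.continuousAt.congr ?_
    filter_upwards [gt_mem_nhds (show t < |t| + 1 by linarith [le_abs_self t])] with s hs
    exact huniq _ _ (le_max_right _ _) (max_le hs.le hT)
  · simp only [max_eq_left ht]
    rw [hU t ht t (right_mem_Icc.2 ht)]
    refine P.rhs_congr x₀ ht fun s hs => ?_
    rw [max_eq_left hs.1]
    exact huniq s t hs.1 hs.2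

end MemoryProblem

/-! ### The heat semigroup in Lebesgue spaces -/

section Lebesgue

variable {N k : ℕ} {t : ℝ}

theorem lintegral_kernel (hN : 1 ≤ N) (hk : 1 ≤ k) (ht : 0 < t) (z : Space N k) :
    ∫⁻ w, ENNReal.ofReal (kernel t z w) = 1 := by
  rw [← ofReal_integral_eq_lintegral_ofReal (integrable_kernel hN hk ht z)
    (Eventually.of_forall (kernel_nonneg hN hk ht z)), integral_kernel hN hk ht, ENNReal.ofReal_one]

theorem measurable_kernel (hN : 1 ≤ N) (ht : 0 < t) :
    Measurable fun p : Space N k × Space N k => ENNReal.ofReal (kernel t p.1 p.2) :=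
  (continuous_kernel hN ht).measurable.ennreal_ofReal

theorem measurable_kernel_right (hN : 1 ≤ N) (ht : 0 < t) (z : Space N k) :
    Measurable fun w : Space N k => ENNReal.ofReal (kernel t z w) := by
  have h : Continuous fun w : Space N k => kernel t z w :=
    (continuous_kernel hN ht).comp (f := fun w : Space N k => (z, w)) (by fun_prop)
  exact h.measurable.ennreal_ofReal

theorem enorm_heatOp_le (hN : 1 ≤ N) (hk : 1 ≤ k) (ht : 0 < t) (f : Space N k → ℝ)
    (z : Space N k) : ‖heatOp t f z‖ₑ ≤ ∫⁻ w, ENNReal.ofReal (kernel t z w) * ‖f w‖ₑ := by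
  refine (enorm_integral_le_lintegral_enorm _).trans_eq (lintegral_congr fun w => ?_)
  rw [enorm_mul, Real.enorm_of_nonneg (kernel_nonneg hN hk ht z w)]

/-- Jensen's inequality for the heat kernel. -/
theorem enorm_heatOp_rpow_le (hN : 1 ≤ N) (hk : 1 ≤ k) (ht : 0 < t) {p : ℝ} (hp : 1 ≤ p)
    {f : Space N k → ℝ} (hf : Continuous f) (z : Space N k) :
    ‖heatOp t f z‖ₑ ^ p ≤ ∫⁻ w, ENNReal.ofReal (kernel t z w) * ‖f w‖ₑ ^ p := by
  have hmK := measurable_kernel_right hN ht z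
  -- Under the probability measure with density `kernel t z`, Jensen's inequality is the
  -- monotonicity of `Lᵖ` norms in `p`.
  set μ : Measure (Space N k) := volume.withDensity fun w => ENNReal.ofReal (kernel t z w) with hμ
  have : IsProbabilityMeasure μ :=
    ⟨by rw [hμ, withDensity_apply _ MeasurableSet.univ, setLIntegral_univ,
      lintegral_kernel hN hk ht]⟩
  have h := eLpNorm'_le_eLpNorm'_of_exponent_le one_pos hp μ (f := f) hf.aestronglyMeasurable
  have hp0 : 0 < p := one_pos.trans_le hp
  have hme : Measurable fun w => ‖f w‖ₑ := hf.measurable.enorm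
  rw [eLpNorm'_eq_lintegral_enorm, eLpNorm'_eq_lintegral_enorm, one_div_one, ENNReal.rpow_one,
    ← ENNReal.rpow_le_rpow_iff hp0, ← ENNReal.rpow_mul, one_div_mul_cancel hp0.ne',
    ENNReal.rpow_one] at h
  simp only [ENNReal.rpow_one] at h
  rw [hμ, lintegral_withDensity_eq_lintegral_mul _ hmK hme,
    lintegral_withDensity_eq_lintegral_mul _ hmK (hme.pow_const p)] at h
  exact (ENNReal.rpow_le_rpow (enorm_heatOp_le hN hk ht f z) hp0.le).trans h

/-- Jensen's inequality, then Tonelli. By symmetry the kernel also has mass one in its first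
variable. -/
theorem lintegral_enorm_heatOp_rpow_le (hN : 1 ≤ N) (hk : 1 ≤ k) (ht : 0 < t) {p : ℝ}
    (hp : 1 ≤ p) {f : Space N k → ℝ} (hf : Continuous f) :
    ∫⁻ z, ‖heatOp t f z‖ₑ ^ p ≤ ∫⁻ w, ‖f w‖ₑ ^ p := by
  have hme : Measurable fun w => ‖f w‖ₑ ^ p := hf.measurable.enorm.pow_const p
  refine (lintegral_mono fun z => enorm_heatOp_rpow_le hN hk ht hp hf z).trans_eq ?_
  rw [lintegral_lintegral_swap
    ((measurable_kernel hN ht).mul (hme.comp measurable_snd)).aemeasurable]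
  refine lintegral_congr fun w => ?_
  simp only [kernel_comm hN ht _ w]
  rw [lintegral_mul_const _ (measurable_kernel_right hN ht w), lintegral_kernel hN hk ht, one_mul]

theorem eLpNorm_heatSemigroup_le (hN : 1 ≤ N) (hk : 1 ≤ k) (t : ℝ) (f : C₀(Space N k, ℝ))
    {r : ℝ≥0∞} (hr : 1 ≤ r) (hr' : r ≠ ∞) :
    eLpNorm (heatSemigroup hN hk t f) r volume ≤ eLpNorm f r volume := by
  by_cases ht : 0 < t
  · have h0 : r ≠ 0 := (one_pos.trans_le hr).ne'
    have e : ⇑(heatSemigroup hN hk t f) = heatOp t f :=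
      funext fun z => heatSemigroup_of_pos hN hk ht f z
    rw [e, eLpNorm_eq_lintegral_rpow_enorm_toReal h0 hr',
      eLpNorm_eq_lintegral_rpow_enorm_toReal h0 hr']
    refine ENNReal.rpow_le_rpow (lintegral_enorm_heatOp_rpow_le hN hk ht ?_ (map_continuous f))
      (by positivity)
    rwa [← ENNReal.ofReal_le_iff_le_toReal hr', ENNReal.ofReal_one]
  · rw [heatSemigroup_of_nonpos hN hk (not_lt.1 ht)]

theorem memLp_heatSemigroup (hN : 1 ≤ N) (hk : 1 ≤ k) (t : ℝ) {f : C₀(Space N k, ℝ)}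
    {r : ℝ≥0∞} (hr : 1 ≤ r) (hr' : r ≠ ∞) (hf : MemLp f r volume) :
    MemLp (heatSemigroup hN hk t f) r volume :=
  ⟨(map_continuous _).aestronglyMeasurable,
    (eLpNorm_heatSemigroup_le hN hk t f hr hr').trans_lt hf.2⟩

theorem tendsto_heatSemigroup_apply (hN : 1 ≤ N) (hk : 1 ≤ k) (f : C₀(Space N k, ℝ))
    (z : Space N k) : Tendsto (fun t => heatSemigroup hN hk t f z) (𝓝[>] 0) (𝓝 (f z)) := by
  rw [tendsto_iff_norm_sub_tendsto_zero]
  refine squeeze_zero (fun t => norm_nonneg _) (fun t => ?_)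
    (tendsto_iff_norm_sub_tendsto_zero.1 (tendsto_heatSemigroup_zero hN hk f))
  rw [← ZeroAtInftyContinuousMap.sub_apply]
  exact abs_apply_le_norm _ z

/-- Strong continuity in `L¹` for nonnegative functions (Scheffé's argument). -/
theorem tendsto_integral_abs_heatSemigroup_sub_of_nonneg (hN : 1 ≤ N) (hk : 1 ≤ k)
    {f : C₀(Space N k, ℝ)} (hf : Integrable f) (hpos : ∀ z, 0 ≤ f z) :
    Tendsto (fun t => ∫ z, |heatSemigroup hN hk t f z - f z|) (𝓝[>] 0) (𝓝 0) := by
  have hmem : MemLp f 1 volume := memLp_one_iff_integrable.2 hf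
  have hSi : ∀ t, Integrable (heatSemigroup hN hk t f) := fun t =>
    memLp_one_iff_integrable.1 (memLp_heatSemigroup hN hk t le_rfl ENNReal.one_ne_top hmem)
  have hle : ∀ t, ∫ z, heatSemigroup hN hk t f z ≤ ∫ z, f z := by
    intro t
    have h := eLpNorm_heatSemigroup_le hN hk t f le_rfl ENNReal.one_ne_top
    rw [eLpNorm_one_eq_lintegral_enorm, eLpNorm_one_eq_lintegral_enorm] at h
    rw [integral_eq_lintegral_of_nonneg_ae
      (Eventually.of_forall (heatSemigroup_nonneg hN hk t hpos)) (hSi t).aestronglyMeasurable,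
      integral_eq_lintegral_of_nonneg_ae (Eventually.of_forall hpos) hf.aestronglyMeasurable]
    simp only [← Real.enorm_of_nonneg (hpos _),
      ← Real.enorm_of_nonneg (heatSemigroup_nonneg hN hk t hpos _)]
    refine ENNReal.toReal_mono ?_ h
    rw [← eLpNorm_one_eq_lintegral_enorm]
    exact hmem.2.ne
  have hmax : ∀ t, Integrable fun z => max (f z - heatSemigroup hN hk t f z) 0 := fun t =>
    (hf.sub (hSi t)).pos_part
  have hlim : Tendsto (fun t => 2 * ∫ z, max (f z - heatSemigroup hN hk t f z) 0) (𝓝[>] 0)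
      (𝓝 0) := by
    have h : Tendsto (fun t => ∫ z, max (f z - heatSemigroup hN hk t f z) 0) (𝓝[>] 0)
        (𝓝 (∫ _ : Space N k, (0 : ℝ))) := by
      refine tendsto_integral_filter_of_dominated_convergence f
        (Eventually.of_forall fun t => (hmax t).aestronglyMeasurable)
        (Eventually.of_forall fun t => Eventually.of_forall fun z => ?_) hf
        (Eventually.of_forall fun z => ?_)
      · rw [Real.norm_of_nonneg (le_max_right _ _)]
        exact max_le (by linarith [heatSemigroup_nonneg hN hk t hpos z]) (hpos z)
      · have := ((tendsto_heatSemigroup_apply hN hk f z).const_sub (f z)).max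
          (tendsto_const_nhds (x := (0 : ℝ)))
        simpa using this
    simpa using h.const_mul 2
  refine squeeze_zero (fun t => integral_nonneg fun z => abs_nonneg _) (fun t => ?_) hlim
  -- `|a| = a + 2a⁻`. The total integral does not increase under the semigroup, so only the negative
  -- part of the difference matters, and it is dominated by `f`.
  have e : ∀ z, |heatSemigroup hN hk t f z - f z| = (heatSemigroup hN hk t f z - f z)
      + 2 * max (f z - heatSemigroup hN hk t f z) 0 := by
    intro z
    rcases le_total (heatSemigroup hN hk t f z) (f z) with h | h
    · rw [abs_of_nonpos (by linarith), max_eq_left (by linarith)]; ring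
    · rw [abs_of_nonneg (by linarith), max_eq_right (by linarith)]; ring
  have hsub : Integrable fun z => heatSemigroup hN hk t f z - f z := (hSi t).sub hf
  simp only [e]
  rw [integral_add hsub ((hmax t).const_mul 2), integral_sub (hSi t) hf,
    integral_const_mul]
  linarith [hle t]

theorem tendsto_integral_abs_heatSemigroup_sub (hN : 1 ≤ N) (hk : 1 ≤ k)
    {f : C₀(Space N k, ℝ)} (hf : Integrable f) :
    Tendsto (fun t => ∫ z, |heatSemigroup hN hk t f z - f z|) (𝓝[>] 0) (𝓝 0) := by
  set g₁ : C₀(Space N k, ℝ) := postcomp (fun a => max a 0) (by fun_prop) (by simp) f with hg₁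
  set g₂ : C₀(Space N k, ℝ) := postcomp (fun a => max (-a) 0) (by fun_prop) (by simp) f with hg₂
  have hfg : f = g₁ - g₂ := by
    ext z
    simp only [hg₁, hg₂, ZeroAtInftyContinuousMap.sub_apply, postcomp_apply]
    rcases le_total (f z) 0 with h | h
    · rw [max_eq_right h, max_eq_left (by linarith)]; ring
    · rw [max_eq_left h, max_eq_right (by linarith)]; ring
  have hi₁ : Integrable g₁ := hf.pos_part
  have hi₂ : Integrable g₂ := hf.neg_part
  have h₁ := tendsto_integral_abs_heatSemigroup_sub_of_nonneg hN hk hi₁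
    (fun z => le_max_right _ _)
  have h₂ := tendsto_integral_abs_heatSemigroup_sub_of_nonneg hN hk hi₂
    (fun z => le_max_right _ _)
  have h := h₁.add h₂
  rw [add_zero] at h
  have hS : ∀ {g : C₀(Space N k, ℝ)}, Integrable g → ∀ t,
      Integrable fun z => |heatSemigroup hN hk t g z - g z| := fun hg t =>
    ((memLp_one_iff_integrable.1 (memLp_heatSemigroup hN hk t le_rfl ENNReal.one_ne_top
      (memLp_one_iff_integrable.2 hg))).sub hg).abs
  refine squeeze_zero (fun t => integral_nonneg fun z => abs_nonneg _) (fun t => ?_) h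
  rw [← integral_add (hS hi₁ t) (hS hi₂ t)]
  refine integral_mono (hS hf t) ((hS hi₁ t).add (hS hi₂ t)) fun z => ?_
  have e : heatSemigroup hN hk t f z - f z
      = (heatSemigroup hN hk t g₁ z - g₁ z) - (heatSemigroup hN hk t g₂ z - g₂ z) := by
    rw [hfg, map_sub, ZeroAtInftyContinuousMap.sub_apply, ZeroAtInftyContinuousMap.sub_apply]
    ring
  rw [e]
  exact abs_sub _ _

/-- The difference is bounded by `2‖f‖`, so its `r`-th power is at most `(2‖f‖)^(r-1)` times its
absolute value, and convergence in `L¹` suffices. -/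
theorem tendsto_eLpNorm_heatSemigroup_sub_of_integrable (hN : 1 ≤ N) (hk : 1 ≤ k)
    {f : C₀(Space N k, ℝ)} (hf : Integrable f) {r : ℝ≥0∞} (hr : 1 ≤ r) (hr' : r ≠ ∞) :
    Tendsto (fun t => eLpNorm (fun z => heatSemigroup hN hk t f z - f z) r volume) (𝓝[>] 0)
      (𝓝 0) := by
  have h0 : r ≠ 0 := (one_pos.trans_le hr).ne'
  have hp : 1 ≤ r.toReal := by
    rwa [← ENNReal.ofReal_le_iff_le_toReal hr', ENNReal.ofReal_one]
  have hp0 : 0 < r.toReal := one_pos.trans_le hp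
  set M : ℝ≥0∞ := ENNReal.ofReal (2 * ‖f‖) ^ (r.toReal - 1) with hM
  have hM' : M ≠ ∞ := (ENNReal.rpow_lt_top_of_nonneg (by linarith) ENNReal.ofReal_ne_top).ne
  have hi : ∀ t, Integrable fun z => heatSemigroup hN hk t f z - f z := fun t =>
    (memLp_one_iff_integrable.1 (memLp_heatSemigroup hN hk t le_rfl ENNReal.one_ne_top
      (memLp_one_iff_integrable.2 hf))).sub hf
  have h1 : Tendsto (fun t => (M * ENNReal.ofReal (∫ z, |heatSemigroup hN hk t f z - f z|))
      ^ (1 / r.toReal)) (𝓝[>] 0) (𝓝 0) := by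
    have h2 := ENNReal.tendsto_ofReal (tendsto_integral_abs_heatSemigroup_sub hN hk hf)
    rw [ENNReal.ofReal_zero] at h2
    have h3 := (ENNReal.Tendsto.const_mul h2 (Or.inr hM')).ennrpow_const (1 / r.toReal)
    rwa [mul_zero, ENNReal.zero_rpow_of_pos (by positivity)] at h3
  refine tendsto_of_tendsto_of_tendsto_of_le_of_le tendsto_const_nhds h1 (fun t => bot_le)
    fun t => ?_
  rw [eLpNorm_eq_lintegral_rpow_enorm_toReal h0 hr']
  refine ENNReal.rpow_le_rpow ?_ (by positivity)
  have h4 : ENNReal.ofReal (∫ z, |heatSemigroup hN hk t f z - f z|)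
      = ∫⁻ z, ‖heatSemigroup hN hk t f z - f z‖ₑ := by
    rw [ofReal_integral_eq_lintegral_ofReal (hi t).abs (Eventually.of_forall fun z => abs_nonneg _)]
    exact lintegral_congr fun z => (Real.enorm_eq_ofReal_abs _).symm
  rw [h4, ← lintegral_const_mul' _ _ hM']
  refine lintegral_mono fun z => ?_
  have h5 : ‖heatSemigroup hN hk t f z - f z‖ₑ ≤ ENNReal.ofReal (2 * ‖f‖) := by
    rw [Real.enorm_eq_ofReal_abs]
    refine ENNReal.ofReal_le_ofReal ?_
    have h6 := (abs_apply_le_norm (heatSemigroup hN hk t f) z).trans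
      (norm_heatSemigroup_le hN hk t f)
    have h7 := abs_apply_le_norm f z
    linarith [abs_sub (heatSemigroup hN hk t f z) (f z)]
  calc ‖heatSemigroup hN hk t f z - f z‖ₑ ^ r.toReal
      = ‖heatSemigroup hN hk t f z - f z‖ₑ ^ (r.toReal - 1)
        * ‖heatSemigroup hN hk t f z - f z‖ₑ ^ (1 : ℝ) := by
        rw [← ENNReal.rpow_add_of_nonneg _ _ (by linarith) zero_le_one, sub_add_cancel]
    _ ≤ M * ‖heatSemigroup hN hk t f z - f z‖ₑ := by
        rw [ENNReal.rpow_one]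
        exact mul_le_mul_left (ENNReal.rpow_le_rpow h5 (by linarith)) _

/-- Strong continuity of the heat semigroup at time `0` in `Lʳ`. -/
theorem tendsto_eLpNorm_heatSemigroup_sub (hN : 1 ≤ N) (hk : 1 ≤ k)
    {f : C₀(Space N k, ℝ)} {r : ℝ≥0∞} (hr : 1 ≤ r) (hr' : r ≠ ∞) (hf : MemLp f r volume) :
    Tendsto (fun t => eLpNorm (fun z => heatSemigroup hN hk t f z - f z) r volume) (𝓝[>] 0)
      (𝓝 0) := by
  rw [ENNReal.tendsto_nhds_zero]
  intro ε hε
  have hε3 : ε / 3 ≠ 0 := (ENNReal.div_pos hε.ne' (by norm_num)).ne'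
  -- A compactly supported continuous approximation is integrable, so the previous case applies to
  -- it. The `Lʳ` contraction handles the error, one third of `ε` per term.
  obtain ⟨g, hgc, hgε, hg, hgm⟩ := hf.exists_hasCompactSupport_eLpNorm_sub_le hr' hε3
  set G : C₀(Space N k, ℝ) := ⟨⟨g, hg⟩, hgc.is_zero_at_infty⟩ with hG
  have hGi : Integrable G := hg.integrable_of_hasCompactSupport hgc
  filter_upwards [ENNReal.tendsto_nhds_zero.1
    (tendsto_eLpNorm_heatSemigroup_sub_of_integrable hN hk hGi hr hr') (ε / 3)
    (pos_iff_ne_zero.2 hε3)] with t ht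
  have e : (fun z => heatSemigroup hN hk t f z - f z) = (⇑(heatSemigroup hN hk t (f - G))
      + fun z => heatSemigroup hN hk t G z - G z) - (⇑f - g) := by
    ext z
    simp only [map_sub, Pi.sub_apply, Pi.add_apply, ZeroAtInftyContinuousMap.sub_apply]
    have : G z = g z := rfl
    rw [this]; ring
  rw [e]
  have hm₁ : AEStronglyMeasurable (heatSemigroup hN hk t (f - G)) volume :=
    (map_continuous _).aestronglyMeasurable
  have hm₂ : AEStronglyMeasurable (fun z => heatSemigroup hN hk t G z - G z) volume :=
    ((map_continuous _).sub (map_continuous _)).aestronglyMeasurable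
  have hm₃ : AEStronglyMeasurable (⇑f - g) volume :=
    ((map_continuous f).sub hg).aestronglyMeasurable
  have h1 : eLpNorm (heatSemigroup hN hk t (f - G)) r volume ≤ ε / 3 :=
    (eLpNorm_heatSemigroup_le hN hk t _ hr hr').trans hgε
  calc _ ≤ eLpNorm (⇑(heatSemigroup hN hk t (f - G))
          + fun z => heatSemigroup hN hk t G z - G z) r volume + eLpNorm (⇑f - g) r volume :=
        eLpNorm_sub_le (hm₁.add hm₂) hm₃ hr
    _ ≤ (ε / 3 + ε / 3) + ε / 3 :=
        add_le_add ((eLpNorm_add_le hm₁ hm₂ hr).trans (add_le_add h1 ht)) hgε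
    _ = ε := ENNReal.add_thirds ε

end Lebesgue

/-! ### Linear images of the integral equation -/

theorem map_memory {X Y : Type*} [NormedAddCommGroup X] [NormedSpace ℝ X] [CompleteSpace X]
    [NormedAddCommGroup Y] [NormedSpace ℝ Y] [CompleteSpace Y] (T : X →L[ℝ] Y) {γ : ℝ}
    (hγ : γ < 1) {F : ℝ → X} {s : ℝ} (hs : 0 ≤ s) (hF : ContinuousOn F (Icc 0 s)) :
    T (memory γ F s) = memory γ (fun τ => T (F τ)) s := by
  rw [memory, memory, ← ContinuousLinearMap.intervalIntegral_comp_comm T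
    (intervalIntegrable_memory hγ hs hF)]
  simp only [map_smul]

namespace MemoryProblem

variable {X Y : Type*} [NormedAddCommGroup X] [NormedSpace ℝ X] [CompleteSpace X]
  [NormedAddCommGroup Y] [NormedSpace ℝ Y] [CompleteSpace Y]

/-- Bounded operators pass through the Bochner integrals. This serves both for point evaluations on
`C₀` and for the inclusion of `C₀ ∩ Lʳ` into `C₀`. -/
theorem map_rhs (P : MemoryProblem X) (T : X →L[ℝ] Y) (x₀ : X) {u : ℝ → X} (hu : Continuous u)
    {t : ℝ} (ht : 0 ≤ t) :
    T (P.rhs x₀ u t) = T (P.S t x₀)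
      + P.k₁ • (∫ s in (0 : ℝ)..t, T (P.S (t - s) (memory P.γ (fun τ => P.F₁ (u τ)) s)))
      + P.k₂ • ∫ s in (0 : ℝ)..t, T (P.S (t - s) (P.F₂ (u s))) := by
  have h1 : IntervalIntegrable
      (fun s => P.S (t - s) (memory P.γ (fun τ => P.F₁ (u τ)) (max s 0))) volume 0 t :=
    (P.continuous_S_comp (by fun_prop)
      (continuous_memory_max P.γ_lt (P.lip₁.continuous.comp hu))).intervalIntegrable _ _
  have h2 : IntervalIntegrable (fun s => P.S (t - s) (P.F₂ (u s))) volume 0 t :=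
    (P.continuous_S_comp (by fun_prop) (P.lip₂.continuous.comp hu)).intervalIntegrable _ _
  have h3 : ∫ s in (0 : ℝ)..t, T (P.S (t - s) (memory P.γ (fun τ => P.F₁ (u τ)) s))
      = ∫ s in (0 : ℝ)..t, T (P.S (t - s) (memory P.γ (fun τ => P.F₁ (u τ)) (max s 0))) := by
    refine intervalIntegral.integral_congr fun s hs => ?_
    rw [uIcc_of_le ht] at hs
    simp only [max_eq_left hs.1]
  rw [rhs, integral_memory_eq P _ ht, map_add, map_add, map_smul, map_smul, h3,
    ContinuousLinearMap.intervalIntegral_comp_comm T h1,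
    ContinuousLinearMap.intervalIntegral_comp_comm T h2]

/-- An intertwining operator maps the right-hand side of one problem to that of another. -/
theorem map_rhs_of_intertwines (P : MemoryProblem X) (Q : MemoryProblem Y) (T : X →L[ℝ] Y)
    (hk₁ : P.k₁ = Q.k₁) (hk₂ : P.k₂ = Q.k₂) (hγ : P.γ = Q.γ)
    (hS : ∀ t x, T (P.S t x) = Q.S t (T x)) (hF₁ : ∀ x, T (P.F₁ x) = Q.F₁ (T x))
    (hF₂ : ∀ x, T (P.F₂ x) = Q.F₂ (T x)) (x₀ : X) {u : ℝ → X} (hu : Continuous u)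
    {t : ℝ} (ht : 0 ≤ t) : T (P.rhs x₀ u t) = Q.rhs (T x₀) (fun s => T (u s)) t := by
  have h1 : ∫ s in (0 : ℝ)..t, T (P.S (t - s) (memory P.γ (fun τ => P.F₁ (u τ)) s))
      = ∫ s in (0 : ℝ)..t, Q.S (t - s) (memory Q.γ (fun τ => Q.F₁ (T (u τ))) s) := by
    refine intervalIntegral.integral_congr fun s hs => ?_
    rw [uIcc_of_le ht] at hs
    have h : T (memory P.γ (fun τ => P.F₁ (u τ)) s) = memory P.γ (fun τ => T (P.F₁ (u τ))) s :=
      map_memory T P.γ_lt hs.1 (P.lip₁.continuous.comp hu).continuousOn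
    change T (P.S (t - s) (memory P.γ (fun τ => P.F₁ (u τ)) s)) = _
    rw [hS, h, hγ]
    simp only [hF₁]
  have h2 : ∫ s in (0 : ℝ)..t, T (P.S (t - s) (P.F₂ (u s)))
      = ∫ s in (0 : ℝ)..t, Q.S (t - s) (Q.F₂ (T (u s))) := by
    simp only [hS, hF₂]
  rw [P.map_rhs T x₀ hu ht, rhs, hk₁, hk₂, hS, h1, h2]

end MemoryProblem

/-! ### The Banach space `C₀ ∩ Lʳ` -/

/-- The space `C₀ ∩ Lʳ`, as a closed subspace of `C₀ × Lʳ`. -/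
def zeroAtInftyLp (N k : ℕ) (r : ℝ≥0∞) [Fact (1 ≤ r)] :
    Submodule ℝ (C₀(Space N k, ℝ) × Lp ℝ r (volume : Measure (Space N k))) where
  carrier := {p | p.1 =ᵐ[volume] p.2}
  add_mem' := fun {p q} hp hq => by
    simp only [mem_ofPred_eq] at *
    filter_upwards [hp, hq, Lp.coeFn_add p.2 q.2] with z h1 h2 h3
    rw [Prod.fst_add, Prod.snd_add, h3, ZeroAtInftyContinuousMap.add_apply, h1, h2, Pi.add_apply]
  zero_mem' := by
    simp only [mem_ofPred_eq]
    filter_upwards [Lp.coeFn_zero ℝ r (volume : Measure (Space N k))] with z h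
    rw [Prod.fst_zero, Prod.snd_zero, h]
    rfl
  smul_mem' := fun c p hp => by
    simp only [mem_ofPred_eq] at *
    filter_upwards [hp, Lp.coeFn_smul c p.2] with z h1 h2
    rw [Prod.smul_fst, Prod.smul_snd, h2, ZeroAtInftyContinuousMap.smul_apply, h1, Pi.smul_apply]

section zeroAtInftyLp

variable {N k : ℕ} {r : ℝ≥0∞} [Fact (1 ≤ r)]

/-- Convergence in `Lʳ` gives an a.e. convergent subsequence, whose limit must be the uniform limit.
-/
theorem isClosed_zeroAtInftyLp : IsClosed (zeroAtInftyLp N k r : Set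
    (C₀(Space N k, ℝ) × Lp ℝ r (volume : Measure (Space N k)))) := by
  refine IsSeqClosed.isClosed fun p q hp hpq => ?_
  have h1 : Tendsto (fun n => (p n).1) atTop (𝓝 q.1) := (continuous_fst.tendsto q).comp hpq
  have h2 : Tendsto (fun n => (p n).2) atTop (𝓝 q.2) := (continuous_snd.tendsto q).comp hpq
  obtain ⟨ns, hns, hae⟩ := (tendstoInMeasure_of_tendsto_Lp h2).exists_seq_tendsto_ae
  have hall : ∀ᵐ z : Space N k, ∀ n, (p n).1 z = (p n).2 z := ae_all_iff.2 hp
  change q.1 =ᵐ[volume] q.2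
  filter_upwards [hae, hall] with z hz hz'
  have h3 : Tendsto (fun n => (p n).1 z) atTop (𝓝 (q.1 z)) := by
    rw [tendsto_iff_norm_sub_tendsto_zero]
    refine squeeze_zero (fun t => norm_nonneg _) (fun t => ?_)
      (tendsto_iff_norm_sub_tendsto_zero.1 h1)
    rw [← ZeroAtInftyContinuousMap.sub_apply]
    exact abs_apply_le_norm _ z
  have h4 := h3.comp hns.tendsto_atTop
  simp only [Function.comp_def, hz'] at h4
  exact tendsto_nhds_unique h4 hz

instance : CompleteSpace (zeroAtInftyLp N k r) :=
  isClosed_zeroAtInftyLp.completeSpace_coe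

/-- The inclusion of `C₀ ∩ Lʳ` into `C₀`. -/
def toZeroAtInfty (N k : ℕ) (r : ℝ≥0∞) [Fact (1 ≤ r)] :
    zeroAtInftyLp N k r →L[ℝ] C₀(Space N k, ℝ) :=
  (ContinuousLinearMap.fst ℝ _ _).comp (zeroAtInftyLp N k r).subtypeL

theorem toZeroAtInfty_apply (p : zeroAtInftyLp N k r) : toZeroAtInfty N k r p = p.1.1 := rfl

/-- Algebraic identities in `C₀ ∩ Lʳ`, such as linearity and the semigroup law, can therefore be
checked in `C₀`. -/
theorem toZeroAtInfty_injective : Function.Injective (toZeroAtInfty N k r) := by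
  intro p q h
  rw [toZeroAtInfty_apply, toZeroAtInfty_apply] at h
  refine Subtype.ext (Prod.ext h (Lp.ext ?_))
  have hp : p.1.1 =ᵐ[volume] p.1.2 := p.2
  have hq : q.1.1 =ᵐ[volume] q.1.2 := q.2
  rw [h] at hp
  exact hp.symm.trans hq

theorem memLp_toZeroAtInfty (p : zeroAtInftyLp N k r) : MemLp p.1.1 r volume :=
  (Lp.memLp p.1.2).ae_eq (EventuallyEq.symm (show p.1.1 =ᵐ[volume] p.1.2 from p.2))

theorem ofReal_norm_snd (p : zeroAtInftyLp N k r) :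
    ENNReal.ofReal ‖p.1.2‖ = eLpNorm p.1.1 r volume := by
  rw [Lp.norm_def, ENNReal.ofReal_toReal (Lp.eLpNorm_ne_top _)]
  exact eLpNorm_congr_ae (EventuallyEq.symm (show p.1.1 =ᵐ[volume] p.1.2 from p.2))

theorem norm_snd (p : zeroAtInftyLp N k r) : ‖p.1.2‖ = (eLpNorm p.1.1 r volume).toReal := by
  rw [← ofReal_norm_snd, ENNReal.toReal_ofReal (norm_nonneg _)]

theorem norm_zeroAtInftyLp (p : zeroAtInftyLp N k r) : ‖p‖ = max ‖p.1.1‖ ‖p.1.2‖ := rfl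

theorem norm_eq_max (p : zeroAtInftyLp N k r) : ‖p‖ = max ‖toZeroAtInfty N k r p‖
    (eLpNorm (toZeroAtInfty N k r p) r volume).toReal := by
  rw [norm_zeroAtInftyLp, norm_snd]
  rfl

/-- A function in `C₀ ∩ Lʳ` as an element of the intersection space. -/
def ofMemLp (f : C₀(Space N k, ℝ)) (hf : MemLp f r volume) : zeroAtInftyLp N k r :=
  ⟨(f, hf.toLp f), hf.coeFn_toLp.symm⟩

theorem toZeroAtInfty_ofMemLp (f : C₀(Space N k, ℝ)) (hf : MemLp f r volume) :
    toZeroAtInfty N k r (ofMemLp f hf) = f := rfl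

/-- The heat semigroup on `C₀ ∩ Lʳ`, as a map of sets. -/
def heatMapLp (hN : 1 ≤ N) (hk : 1 ≤ k) (hr : r ≠ ∞) (t : ℝ) (p : zeroAtInftyLp N k r) :
    zeroAtInftyLp N k r :=
  ofMemLp (heatSemigroup hN hk t p.1.1)
    (memLp_heatSemigroup hN hk t Fact.out hr (memLp_toZeroAtInfty p))

theorem toZeroAtInfty_heatMapLp (hN : 1 ≤ N) (hk : 1 ≤ k) (hr : r ≠ ∞) (t : ℝ)
    (p : zeroAtInftyLp N k r) : toZeroAtInfty N k r (heatMapLp hN hk hr t p)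
      = heatSemigroup hN hk t (toZeroAtInfty N k r p) := rfl

theorem norm_heatMapLp_le (hN : 1 ≤ N) (hk : 1 ≤ k) (hr : r ≠ ∞) (t : ℝ)
    (p : zeroAtInftyLp N k r) : ‖heatMapLp hN hk hr t p‖ ≤ ‖p‖ := by
  have h1 : ‖(heatMapLp hN hk hr t p).1.1‖ ≤ ‖p.1.1‖ := norm_heatSemigroup_le hN hk t p.1.1
  have h2 : ‖(heatMapLp hN hk hr t p).1.2‖ ≤ ‖p.1.2‖ := by
    rw [norm_snd, norm_snd]
    exact ENNReal.toReal_mono (memLp_toZeroAtInfty p).2.ne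
      (eLpNorm_heatSemigroup_le hN hk t p.1.1 Fact.out hr)
  rw [norm_zeroAtInftyLp, norm_zeroAtInftyLp]
  exact max_le_max h1 h2

theorem isLinearMap_heatMapLp (hN : 1 ≤ N) (hk : 1 ≤ k) (hr : r ≠ ∞) (t : ℝ) :
    IsLinearMap ℝ (heatMapLp hN hk hr t : zeroAtInftyLp N k r → _) where
  map_add p q := toZeroAtInfty_injective <| by
    simp only [ContinuousLinearMap.map_add, toZeroAtInfty_heatMapLp]
  map_smul c p := toZeroAtInfty_injective <| by
    rw [toZeroAtInfty_heatMapLp, ContinuousLinearMap.map_smul, ContinuousLinearMap.map_smul,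
      ContinuousLinearMap.map_smul, toZeroAtInfty_heatMapLp]

attribute [irreducible] heatMapLp

/-- The heat semigroup on `C₀ ∩ Lʳ`. -/
def heatSemigroupLp (hN : 1 ≤ N) (hk : 1 ≤ k) (hr : r ≠ ∞) (t : ℝ) :
    zeroAtInftyLp N k r →L[ℝ] zeroAtInftyLp N k r :=
  LinearMap.mkContinuous ((isLinearMap_heatMapLp hN hk hr t).mk' (heatMapLp hN hk hr t)) 1 fun p => by
    rw [one_mul]
    exact norm_heatMapLp_le hN hk hr t p

theorem heatSemigroupLp_apply (hN : 1 ≤ N) (hk : 1 ≤ k) (hr : r ≠ ∞) (t : ℝ)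
    (p : zeroAtInftyLp N k r) : heatSemigroupLp hN hk hr t p = heatMapLp hN hk hr t p := rfl

theorem toZeroAtInfty_heatSemigroupLp (hN : 1 ≤ N) (hk : 1 ≤ k) (hr : r ≠ ∞) (t : ℝ)
    (p : zeroAtInftyLp N k r) : toZeroAtInfty N k r (heatSemigroupLp hN hk hr t p)
      = heatSemigroup hN hk t (toZeroAtInfty N k r p) := by
  rw [heatSemigroupLp_apply, toZeroAtInfty_heatMapLp]

theorem norm_heatSemigroupLp_le (hN : 1 ≤ N) (hk : 1 ≤ k) (hr : r ≠ ∞) (t : ℝ)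
    (p : zeroAtInftyLp N k r) : ‖heatSemigroupLp hN hk hr t p‖ ≤ ‖p‖ := by
  rw [heatSemigroupLp_apply]
  exact norm_heatMapLp_le hN hk hr t p

theorem continuous_heatSemigroupLp (hN : 1 ≤ N) (hk : 1 ≤ k) (hr : r ≠ ∞)
    (p : zeroAtInftyLp N k r) : Continuous fun t => heatSemigroupLp hN hk hr t p := by
  refine continuous_of_semigroup (norm_heatSemigroupLp_le hN hk hr) (fun t ht p => ?_)
    (fun t s ht hs p => ?_) p ?_
  · apply toZeroAtInfty_injective
    rw [toZeroAtInfty_heatSemigroupLp, heatSemigroup_of_nonpos hN hk ht]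
  · apply toZeroAtInfty_injective
    simp only [toZeroAtInfty_heatSemigroupLp]
    rw [heatSemigroup_add hN hk ht hs]
  · rw [tendsto_iff_norm_sub_tendsto_zero]
    have h1 := tendsto_iff_norm_sub_tendsto_zero.1 (tendsto_heatSemigroup_zero hN hk p.1.1)
    have h2 := tendsto_eLpNorm_heatSemigroup_sub hN hk (Fact.out : 1 ≤ r) hr (memLp_toZeroAtInfty p)
    have h3 := (ENNReal.tendsto_toReal ENNReal.zero_ne_top).comp h2
    have h4 := h1.max h3
    rw [ENNReal.toReal_zero, max_self] at h4
    refine h4.congr fun t => ?_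
    have h5 : toZeroAtInfty N k r (heatSemigroupLp hN hk hr t p - p)
        = heatSemigroup hN hk t p.1.1 - p.1.1 := by
      change toZeroAtInfty N k r (heatSemigroupLp hN hk hr t p) - toZeroAtInfty N k r p = _
      rw [toZeroAtInfty_heatSemigroupLp, toZeroAtInfty_apply]
    rw [norm_eq_max (heatSemigroupLp hN hk hr t p - p), h5]
    rfl

/-- Composition with a Lipschitz function fixing `0`, on `C₀ ∩ Lʳ`. -/
def postcompLp {L : NNReal} {g : ℝ → ℝ} (hg : LipschitzWith L g) (h0 : g 0 = 0)
    (p : zeroAtInftyLp N k r) : zeroAtInftyLp N k r :=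
  ⟨(postcomp g hg.continuous h0 p.1.1, hg.compLp h0 p.1.2), by
    have h : p.1.1 =ᵐ[volume] p.1.2 := p.2
    change postcomp g hg.continuous h0 p.1.1 =ᵐ[volume] hg.compLp h0 p.1.2
    filter_upwards [h, hg.coeFn_compLp h0 p.1.2] with z h1 h2
    rw [h2, postcomp_apply, h1, Function.comp_apply]⟩

theorem lipschitzWith_postcomp {E : Type*} [TopologicalSpace E] {L : NNReal} {g : ℝ → ℝ}
    (hg : LipschitzWith L g) (h0 : g 0 = 0) :
    LipschitzWith L (postcomp g hg.continuous h0 : C₀(E, ℝ) → C₀(E, ℝ)) := by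
  refine LipschitzWith.of_dist_le_mul fun f f' => ?_
  rw [dist_eq_norm, dist_eq_norm]
  refine zeroAtInfty_norm_le (by positivity) fun z => ?_
  have h := hg.dist_le_mul (f z) (f' z)
  rw [Real.dist_eq, Real.dist_eq] at h
  refine h.trans (mul_le_mul_of_nonneg_left ?_ L.2)
  rw [← ZeroAtInftyContinuousMap.sub_apply]
  exact abs_apply_le_norm _ z

theorem lipschitzWith_postcompLp {L : NNReal} {g : ℝ → ℝ} (hg : LipschitzWith L g)
    (h0 : g 0 = 0) : LipschitzWith L (postcompLp hg h0 : zeroAtInftyLp N k r → _) := by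
  refine LipschitzWith.of_dist_le_mul fun p q => ?_
  have h1 := (lipschitzWith_postcomp hg h0).dist_le_mul p.1.1 q.1.1
  have h2 := (hg.lipschitzWith_compLp h0).dist_le_mul p.1.2 q.1.2
  rw [Subtype.dist_eq, Subtype.dist_eq, Prod.dist_eq, Prod.dist_eq (x := p.1)]
  exact max_le (h1.trans (mul_le_mul_of_nonneg_left (le_max_left _ _) L.2))
    (h2.trans (mul_le_mul_of_nonneg_left (le_max_right _ _) L.2))

end zeroAtInftyLp

/-! ### Truncated power nonlinearities -/

theorem power_of_nonneg {p a : ℝ} (hp : 1 < p) (ha : 0 ≤ a) : power p a = a ^ p := by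
  rw [power, abs_of_nonneg ha]
  rcases ha.eq_or_lt with rfl | ha
  · rw [mul_zero, Real.zero_rpow (by linarith)]
  · rw [Real.rpow_sub_one ha.ne', div_mul_cancel₀ _ ha.ne']

theorem power_neg (p a : ℝ) : power p (-a) = -power p a := by
  rw [power, power, abs_neg, mul_neg]

theorem power_zero (p : ℝ) : power p 0 = 0 := mul_zero _

theorem abs_power_sub_le_of_nonneg {p M a b : ℝ} (hp : 1 < p) (ha : a ∈ Icc 0 M)
    (hb : b ∈ Icc 0 M) : |power p a - power p b| ≤ p * M ^ (p - 1) * |a - b| := by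
  rw [power_of_nonneg hp ha.1, power_of_nonneg hp hb.1]
  refine Convex.norm_image_sub_le_of_norm_hasDerivWithin_le (s := Icc 0 M)
    (f := fun x : ℝ => x ^ p) (f' := fun x => p * x ^ (p - 1))
    (fun x _ => (Real.hasDerivAt_rpow_const (Or.inr hp.le)).hasDerivWithinAt) (fun x hx => ?_)
    (convex_Icc 0 M) hb ha
  rw [norm_mul, Real.norm_of_nonneg (by linarith),
    Real.norm_of_nonneg (Real.rpow_nonneg hx.1 _)]
  exact mul_le_mul_of_nonneg_left (Real.rpow_le_rpow hx.1 hx.2 (by linarith)) (by linarith)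

theorem abs_power_sub_le {p M a b : ℝ} (hp : 1 < p) (ha : a ∈ Icc (-M) M)
    (hb : b ∈ Icc (-M) M) : |power p a - power p b| ≤ p * M ^ (p - 1) * |a - b| := by
  have hM : (0 : ℝ) ∈ Icc 0 M := ⟨le_rfl, by linarith [ha.1, ha.2]⟩
  have hC : 0 ≤ p * M ^ (p - 1) := mul_nonneg (by linarith) (Real.rpow_nonneg hM.2 _)
  -- For opposite signs both values are compared with `power p 0 = 0`, and `|a - b| = |a| + |b|`.
  have hopp : ∀ {a b : ℝ}, a ∈ Icc 0 M → b ∈ Icc (-M) 0 →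
      |power p a - power p b| ≤ p * M ^ (p - 1) * |a - b| := fun {a b} ha hb => by
    have h1 := abs_power_sub_le_of_nonneg hp ha hM
    have h2 := abs_power_sub_le_of_nonneg hp (a := -b) (M := M)
      ⟨by linarith [hb.2], by linarith [hb.1]⟩ hM
    rw [power_zero, sub_zero, sub_zero] at h1 h2
    rw [power_neg, abs_neg] at h2
    rw [abs_of_nonneg ha.1] at h1
    rw [abs_of_nonneg (by linarith [hb.2] : 0 ≤ -b)] at h2
    rw [abs_of_nonneg (by linarith [hb.2, ha.1] : 0 ≤ a - b)]
    calc |power p a - power p b| ≤ |power p a| + |power p b| := abs_sub _ _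
      _ ≤ p * M ^ (p - 1) * a + p * M ^ (p - 1) * -b := add_le_add h1 h2
      _ = p * M ^ (p - 1) * (a - b) := by ring
  rcases le_total 0 a with h | h <;> rcases le_total 0 b with h' | h'
  · exact abs_power_sub_le_of_nonneg hp ⟨h, ha.2⟩ ⟨h', hb.2⟩
  · exact hopp ⟨h, ha.2⟩ ⟨hb.1, h'⟩
  · rw [abs_sub_comm, abs_sub_comm a]
    exact hopp ⟨h', hb.2⟩ ⟨ha.1, h⟩
  · have := abs_power_sub_le_of_nonneg hp (a := -a) (b := -b) (M := M)
      ⟨by linarith, by linarith [ha.1]⟩ ⟨by linarith, by linarith [hb.1]⟩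
    rw [power_neg, power_neg, neg_sub_neg, neg_sub_neg] at this
    rwa [abs_sub_comm, abs_sub_comm a]

/-- Truncation of a real number to `[-M, M]`. -/
def clamp (M : NNReal) (a : ℝ) : ℝ := max (-(M : ℝ)) (min a M)

theorem clamp_mem (M : NNReal) (a : ℝ) : clamp M a ∈ Icc (-(M : ℝ)) M :=
  ⟨le_max_left _ _, max_le (by linarith [M.2, M.coe_nonneg]) (min_le_right _ _)⟩

theorem clamp_of_abs_le {M : NNReal} {a : ℝ} (h : |a| ≤ M) : clamp M a = a := by
  rw [abs_le] at h
  rw [clamp, min_eq_left h.2, max_eq_right h.1]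

theorem clamp_nonneg {M : NNReal} {a : ℝ} (h : 0 ≤ a) : 0 ≤ clamp M a :=
  (le_min h M.2).trans (le_max_right _ _)

theorem lipschitzWith_clamp (M : NNReal) : LipschitzWith 1 (clamp M) :=
  (LipschitzWith.id.min_const (M : ℝ)).const_max _

/-- The power nonlinearity, truncated outside `[-M, M]`. -/
def truncPower (p : ℝ) (M : NNReal) (a : ℝ) : ℝ := power p (clamp M a)

theorem truncPower_of_abs_le {p a : ℝ} {M : NNReal} (h : |a| ≤ M) :
    truncPower p M a = power p a := by
  rw [truncPower, clamp_of_abs_le h]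

theorem truncPower_zero (p : ℝ) (M : NNReal) : truncPower p M 0 = 0 := by
  rw [truncPower_of_abs_le (by rw [abs_zero]; exact M.2), power_zero]

theorem truncPower_nonneg (p : ℝ) (M : NNReal) {a : ℝ} (ha : 0 ≤ a) : 0 ≤ truncPower p M a :=
  mul_nonneg (Real.rpow_nonneg (abs_nonneg _) _) (clamp_nonneg ha)

theorem lipschitzWith_truncPower {p : ℝ} (hp : 1 < p) (M : NNReal) :
    LipschitzWith (p.toNNReal * M ^ (p - 1)) (truncPower p M) := by
  refine LipschitzWith.of_dist_le_mul fun a b => ?_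
  rw [Real.dist_eq, Real.dist_eq, NNReal.coe_mul, NNReal.coe_rpow,
    Real.coe_toNNReal _ (by linarith)]
  refine (abs_power_sub_le hp (clamp_mem M a) (clamp_mem M b)).trans
    (mul_le_mul_of_nonneg_left ?_ (mul_nonneg (by linarith) (Real.rpow_nonneg M.2 _)))
  have h := (lipschitzWith_clamp M).dist_le_mul a b
  rwa [NNReal.coe_one, one_mul, Real.dist_eq, Real.dist_eq] at h

/-! ### The equation with Lipschitz nonlinearities -/

/-- The right-hand side of the integral equation with general nonlinearities `g₁` and `g₂`. -/
def duhamelOf (N k : ℕ) (k₁ k₂ γ : ℝ) (g₁ g₂ : ℝ → ℝ) (u₀ : C₀(Space N k, ℝ))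
    (u : ℝ → C₀(Space N k, ℝ)) (t : ℝ) (z : Space N k) : ℝ :=
  semigroup N k t u₀ z
    + k₁ * (∫ s in (0 : ℝ)..t,
        semigroup N k (t - s) (fun w => ∫ τ in (0 : ℝ)..s, (s - τ) ^ (-γ) * g₁ (u τ w)) z)
    + k₂ * (∫ s in (0 : ℝ)..t, semigroup N k (t - s) (fun w => g₂ (u s w)) z)

section

variable {N k : ℕ} {k₁ k₂ γ : ℝ} {g₁ g₂ h₁ h₂ : ℝ → ℝ}

theorem duhamelOf_power (p₁ p₂ : ℝ) (u₀ : C₀(Space N k, ℝ)) (u : ℝ → C₀(Space N k, ℝ)) (t : ℝ)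
    (z : Space N k) : duhamelOf N k k₁ k₂ γ (power p₁) (power p₂) u₀ u t z
      = duhamel N k k₁ k₂ γ p₁ p₂ u₀ u t z := rfl

/-- Function and nonlinearities may change together, as long as the compositions agree along the
trajectory. This permits exchanging the powers, their truncations and their positive-part versions.
-/
theorem duhamelOf_congr (u₀ : C₀(Space N k, ℝ)) {u v : ℝ → C₀(Space N k, ℝ)} {t : ℝ} (ht : 0 ≤ t)
    (e₁ : ∀ s ∈ Icc 0 t, ∀ w, g₁ (u s w) = h₁ (v s w))
    (e₂ : ∀ s ∈ Icc 0 t, ∀ w, g₂ (u s w) = h₂ (v s w)) (z : Space N k) :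
    duhamelOf N k k₁ k₂ γ g₁ g₂ u₀ u t z = duhamelOf N k k₁ k₂ γ h₁ h₂ u₀ v t z := by
  have i₁ : ∫ s in (0 : ℝ)..t,
        semigroup N k (t - s) (fun w => ∫ τ in (0 : ℝ)..s, (s - τ) ^ (-γ) * g₁ (u τ w)) z
      = ∫ s in (0 : ℝ)..t,
        semigroup N k (t - s) (fun w => ∫ τ in (0 : ℝ)..s, (s - τ) ^ (-γ) * h₁ (v τ w)) z := by
    refine intervalIntegral.integral_congr fun s hs => ?_
    rw [uIcc_of_le ht] at hs
    have e : (fun w => ∫ τ in (0 : ℝ)..s, (s - τ) ^ (-γ) * g₁ (u τ w))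
        = fun w => ∫ τ in (0 : ℝ)..s, (s - τ) ^ (-γ) * h₁ (v τ w) := by
      funext w
      refine intervalIntegral.integral_congr fun τ hτ => ?_
      rw [uIcc_of_le hs.1] at hτ
      rw [e₁ τ ⟨hτ.1, hτ.2.trans hs.2⟩ w]
    change semigroup N k (t - s) (fun w => ∫ τ in (0 : ℝ)..s, (s - τ) ^ (-γ) * g₁ (u τ w)) z = _
    rw [e]
  have i₂ : ∫ s in (0 : ℝ)..t, semigroup N k (t - s) (fun w => g₂ (u s w)) z
      = ∫ s in (0 : ℝ)..t, semigroup N k (t - s) (fun w => h₂ (v s w)) z := by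
    refine intervalIntegral.integral_congr fun s hs => ?_
    rw [uIcc_of_le ht] at hs
    simp only [e₂ s hs]
  rw [duhamelOf, duhamelOf, i₁, i₂]

theorem semigroup_nonneg (hN : 1 ≤ N) (hk : 1 ≤ k) (t : ℝ) {φ : Space N k → ℝ}
    (hφ : ∀ w, 0 ≤ φ w) (z : Space N k) : 0 ≤ semigroup N k t φ z := by
  rw [semigroup]
  split_ifs with ht
  · exact integral_nonneg fun w => mul_nonneg (kernel_nonneg hN hk ht z w) (hφ w)
  · exact hφ z

theorem duhamelOf_nonneg (hN : 1 ≤ N) (hk : 1 ≤ k) (hk₁ : 0 ≤ k₁) (hk₂ : 0 ≤ k₂)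
    (hg₁ : ∀ a, 0 ≤ g₁ a) (hg₂ : ∀ a, 0 ≤ g₂ a) {u₀ : C₀(Space N k, ℝ)} (hu₀ : ∀ z, 0 ≤ u₀ z)
    (u : ℝ → C₀(Space N k, ℝ)) {t : ℝ} (ht : 0 ≤ t) (z : Space N k) :
    0 ≤ duhamelOf N k k₁ k₂ γ g₁ g₂ u₀ u t z := by
  refine add_nonneg (add_nonneg (semigroup_nonneg hN hk t hu₀ z) (mul_nonneg hk₁ ?_))
    (mul_nonneg hk₂ ?_)
  · refine intervalIntegral.integral_nonneg ht fun s hs => semigroup_nonneg hN hk _ (fun w => ?_) z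
    exact intervalIntegral.integral_nonneg hs.1 fun τ hτ =>
      mul_nonneg (Real.rpow_nonneg (sub_nonneg.2 hτ.2) _) (hg₁ _)
  · exact intervalIntegral.integral_nonneg ht fun s _ =>
      semigroup_nonneg hN hk _ (fun w => hg₂ _) z

/-- The equation with memory in `C₀`, for Lipschitz nonlinearities. -/
def heatProblem (hN : 1 ≤ N) (hk : 1 ≤ k) (k₁ k₂ : ℝ) (hγ : γ < 1) {L : NNReal}
    (hg₁ : LipschitzWith L g₁) (hg₂ : LipschitzWith L g₂) (h0₁ : g₁ 0 = 0) (h0₂ : g₂ 0 = 0) :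
    MemoryProblem C₀(Space N k, ℝ) where
  S := heatSemigroup hN hk
  norm_le := norm_heatSemigroup_le hN hk
  cont := continuous_heatSemigroup hN hk
  k₁ := k₁
  k₂ := k₂
  γ := γ
  γ_lt := hγ
  F₁ := postcomp g₁ hg₁.continuous h0₁
  F₂ := postcomp g₂ hg₂.continuous h0₂
  L := L
  lip₁ := lipschitzWith_postcomp hg₁ h0₁
  lip₂ := lipschitzWith_postcomp hg₂ h0₂

/-- Evaluation at a point. -/
def evalCLM {E : Type*} [TopologicalSpace E] (z : E) : C₀(E, ℝ) →L[ℝ] ℝ :=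
  LinearMap.mkContinuous
    { toFun := fun f => f z
      map_add' := fun _ _ => rfl
      map_smul' := fun _ _ => rfl } 1 fun f => (abs_apply_le_norm f z).trans_eq (one_mul _).symm

theorem evalCLM_apply {E : Type*} [TopologicalSpace E] (z : E) (f : C₀(E, ℝ)) :
    evalCLM z f = f z := rfl

/-- Point evaluation is a bounded functional on `C₀` and commutes with the vector-valued integrals.
This connects the abstract equation with the pointwise Duhamel formula. -/
theorem heatProblem_rhs_apply (hN : 1 ≤ N) (hk : 1 ≤ k) (hγ : γ < 1) {L : NNReal}
    (hg₁ : LipschitzWith L g₁) (hg₂ : LipschitzWith L g₂) (h0₁ : g₁ 0 = 0) (h0₂ : g₂ 0 = 0)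
    (u₀ : C₀(Space N k, ℝ)) {u : ℝ → C₀(Space N k, ℝ)} {t : ℝ} (ht : 0 ≤ t)
    (hu : ContinuousOn u (Icc 0 t)) (z : Space N k) :
    (heatProblem hN hk k₁ k₂ hγ hg₁ hg₂ h0₁ h0₂).rhs u₀ u t z
      = duhamelOf N k k₁ k₂ γ g₁ g₂ u₀ u t z := by
  set U : ℝ → C₀(Space N k, ℝ) := IccExtend ht ((Icc 0 t).domRestrict u) with hU
  have hUc : Continuous U := (continuousOn_iff_continuous_domRestrict.1 hu).Icc_extend'
  have hUu : EqOn u U (Icc 0 t) := fun s hs => by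
    rw [hU, IccExtend_of_mem ht _ hs, domRestrict_apply]
  rw [MemoryProblem.rhs_congr _ u₀ ht hUu, duhamelOf_congr (h₁ := g₁) (h₂ := g₂) u₀ ht
    (fun s hs w => by rw [hUu hs]) (fun s hs w => by rw [hUu hs]), ← evalCLM_apply,
    MemoryProblem.map_rhs _ (evalCLM z) u₀ hUc ht, duhamelOf]
  have e₁ : ∫ s in (0 : ℝ)..t, evalCLM z (heatSemigroup hN hk (t - s)
        (memory γ (fun τ => postcomp g₁ hg₁.continuous h0₁ (U τ)) s))
      = ∫ s in (0 : ℝ)..t,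
        semigroup N k (t - s) (fun w => ∫ τ in (0 : ℝ)..s, (s - τ) ^ (-γ) * g₁ (U τ w)) z := by
    refine intervalIntegral.integral_congr fun s hs => ?_
    rw [uIcc_of_le ht] at hs
    have hc : Continuous fun τ => postcomp g₁ hg₁.continuous h0₁ (U τ) :=
      (lipschitzWith_postcomp hg₁ h0₁).continuous.comp hUc
    have e : ⇑(memory γ (fun τ => postcomp g₁ hg₁.continuous h0₁ (U τ)) s)
        = fun w => ∫ τ in (0 : ℝ)..s, (s - τ) ^ (-γ) * g₁ (U τ w) := by
      funext w
      rw [← evalCLM_apply, map_memory (evalCLM w) hγ hs.1 hc.continuousOn]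
      rfl
    change evalCLM z (heatSemigroup hN hk (t - s)
      (memory γ (fun τ => postcomp g₁ hg₁.continuous h0₁ (U τ)) s)) = _
    rw [evalCLM_apply, heatSemigroup_apply, e]
  have e₂ : ∀ s, evalCLM z (heatSemigroup hN hk (t - s) (postcomp g₂ hg₂.continuous h0₂ (U s)))
      = semigroup N k (t - s) (fun w => g₂ (U s w)) z := fun s => by
    rw [evalCLM_apply, heatSemigroup_apply]
    rfl
  have e₀ : evalCLM z (heatSemigroup hN hk t u₀) = semigroup N k t u₀ z := by
    rw [evalCLM_apply, heatSemigroup_apply]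
  simp only [heatProblem, e₀, e₁, e₂, smul_eq_mul]

/-- The equation with memory in `C₀ ∩ Lʳ`, for Lipschitz nonlinearities. -/
def heatProblemLp {r : ℝ≥0∞} [Fact (1 ≤ r)] (hr : r ≠ ∞) (hN : 1 ≤ N) (hk : 1 ≤ k) (k₁ k₂ : ℝ)
    (hγ : γ < 1) {L : NNReal} (hg₁ : LipschitzWith L g₁) (hg₂ : LipschitzWith L g₂)
    (h0₁ : g₁ 0 = 0) (h0₂ : g₂ 0 = 0) : MemoryProblem (zeroAtInftyLp N k r) where
  S := heatSemigroupLp hN hk hr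
  norm_le := norm_heatSemigroupLp_le hN hk hr
  cont := continuous_heatSemigroupLp hN hk hr
  k₁ := k₁
  k₂ := k₂
  γ := γ
  γ_lt := hγ
  F₁ := postcompLp hg₁ h0₁
  F₂ := postcompLp hg₂ h0₂
  L := L
  lip₁ := lipschitzWith_postcompLp hg₁ h0₁
  lip₂ := lipschitzWith_postcompLp hg₂ h0₂

theorem toZeroAtInfty_postcompLp {r : ℝ≥0∞} [Fact (1 ≤ r)] {L : NNReal} (hg : LipschitzWith L g₁)
    (h0 : g₁ 0 = 0) (p : zeroAtInftyLp N k r) : toZeroAtInfty N k r (postcompLp hg h0 p)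
      = postcomp g₁ hg.continuous h0 (toZeroAtInfty N k r p) := rfl

theorem toZeroAtInfty_rhs {r : ℝ≥0∞} [Fact (1 ≤ r)] (hr : r ≠ ∞) (hN : 1 ≤ N) (hk : 1 ≤ k)
    (hγ : γ < 1) {L : NNReal} (hg₁ : LipschitzWith L g₁) (hg₂ : LipschitzWith L g₂)
    (h0₁ : g₁ 0 = 0) (h0₂ : g₂ 0 = 0) (p : zeroAtInftyLp N k r) {U : ℝ → zeroAtInftyLp N k r}
    (hU : Continuous U) {t : ℝ} (ht : 0 ≤ t) :
    toZeroAtInfty N k r ((heatProblemLp hr hN hk k₁ k₂ hγ hg₁ hg₂ h0₁ h0₂).rhs p U t)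
      = (heatProblem hN hk k₁ k₂ hγ hg₁ hg₂ h0₁ h0₂).rhs (toZeroAtInfty N k r p)
        (fun s => toZeroAtInfty N k r (U s)) t := by
  refine MemoryProblem.map_rhs_of_intertwines
    (heatProblemLp hr hN hk k₁ k₂ hγ hg₁ hg₂ h0₁ h0₂)
    (heatProblem hN hk k₁ k₂ hγ hg₁ hg₂ h0₁ h0₂) (toZeroAtInfty N k r) rfl rfl rfl ?_ ?_ ?_ p hU ht
  · exact toZeroAtInfty_heatSemigroupLp hN hk hr
  · exact toZeroAtInfty_postcompLp hg₁ h0₁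
  · exact toZeroAtInfty_postcompLp hg₂ h0₂

/-- The Lipschitz problem is also globally solvable in `C₀ ∩ Lʳ`. The inclusion maps its solution to
one of the problem in `C₀`, and uniqueness there identifies it with `u`. -/
theorem exists_lift_Lp {r : ℝ≥0∞} [Fact (1 ≤ r)] (hr : r ≠ ∞) (hN : 1 ≤ N) (hk : 1 ≤ k)
    (hγ : γ < 1) {L : NNReal} (hg₁ : LipschitzWith L g₁) (hg₂ : LipschitzWith L g₂)
    (h0₁ : g₁ 0 = 0) (h0₂ : g₂ 0 = 0) {u₀ : C₀(Space N k, ℝ)} (hu₀ : MemLp u₀ r volume)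
    {u : ℝ → C₀(Space N k, ℝ)} (hu : Continuous u)
    (h : ∀ t, 0 ≤ t → u t = (heatProblem hN hk k₁ k₂ hγ hg₁ hg₂ h0₁ h0₂).rhs u₀ u t) :
    ∃ U : ℝ → zeroAtInftyLp N k r, Continuous U ∧ ∀ t, 0 ≤ t → toZeroAtInfty N k r (U t) = u t := by
  obtain ⟨U, hUc, hU⟩ :=
    (heatProblemLp hr hN hk k₁ k₂ hγ hg₁ hg₂ h0₁ h0₂).exists_eq_rhs (ofMemLp u₀ hu₀)
  have hc : Continuous fun s => toZeroAtInfty N k r (U s) :=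
    (toZeroAtInfty N k r).continuous.comp hUc
  have key : ∀ t, 0 ≤ t → toZeroAtInfty N k r (U t)
      = (heatProblem hN hk k₁ k₂ hγ hg₁ hg₂ h0₁ h0₂).rhs u₀
        (fun s => toZeroAtInfty N k r (U s)) t := fun t ht => by
    have e := toZeroAtInfty_rhs hr hN hk (k₁ := k₁) (k₂ := k₂) hγ hg₁ hg₂ h0₁ h0₂
      (ofMemLp u₀ hu₀) hUc ht
    rwa [toZeroAtInfty_ofMemLp, ← hU t ht] at e
  refine ⟨U, hUc, fun t ht => ?_⟩
  exact (heatProblem hN hk k₁ k₂ hγ hg₁ hg₂ h0₁ h0₂).eqOn_of_eq_rhs u₀ hc.continuousOn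
    hu.continuousOn (fun s hs => key s hs.1) (fun s hs => h s hs.1) (right_mem_Icc.2 ht)

end

/-! ### Maximal solutions from truncated problems -/

section maximal

variable {X : Type*} [NormedAddCommGroup X]

theorem Icc_subset_timeInterval {T : EReal} {t : ℝ} (ht : t ∈ timeInterval T) :
    Icc 0 t ⊆ timeInterval T := fun _ hs =>
  ⟨hs.1, (EReal.coe_le_coe_iff.2 hs.2).trans_lt ht.2⟩

theorem exists_gt_mem_timeInterval {T : EReal} {t : ℝ} (ht : t ∈ timeInterval T) :
    ∃ t' > t, t' ∈ timeInterval T := by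
  obtain ⟨t', h1, h2⟩ := EReal.lt_iff_exists_real_btwn.1 ht.2
  have h3 : t < t' := EReal.coe_lt_coe_iff.1 h1
  exact ⟨t', h3, ht.1.trans h3.le, h2⟩

/-- A family of globally defined functions `sol M`, each of which solves the local-in-time
equation `R` as long as its norm is at most `M`, and contains every solution of norm at most
`M`. -/
structure TruncatedSolutions (R : (ℝ → X) → ℝ → Prop) (sol : NNReal → ℝ → X) : Prop where
  congr : ∀ {u v : ℝ → X} {t : ℝ}, 0 ≤ t → EqOn u v (Icc 0 t) → R u t → R v t
  continuous : ∀ M, Continuous (sol M)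
  solves : ∀ {M : NNReal} {t : ℝ}, 0 ≤ t → (∀ s ∈ Icc 0 t, ‖sol M s‖ ≤ M) → R (sol M) t
  unique : ∀ {M : NNReal} {t : ℝ} {v : ℝ → X}, ContinuousOn v (Icc 0 t) →
    (∀ s ∈ Icc 0 t, ‖v s‖ ≤ M) → (∀ s ∈ Icc 0 t, R v s) → EqOn v (sol M) (Icc 0 t)
  initial : ∃ M : NNReal, ‖sol M 0‖ < M

namespace TruncatedSolutions

variable {R : (ℝ → X) → ℝ → Prop} {sol : NNReal → ℝ → X}

/-- The truncated solution at level `M` stays below `M` up to time `t`. -/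
def Good (sol : NNReal → ℝ → X) (M : NNReal) (t : ℝ) : Prop :=
  0 ≤ t ∧ ∀ s ∈ Icc 0 t, ‖sol M s‖ < M

theorem Good.mono {M : NNReal} {s t : ℝ} (h : Good sol M t) (hs : s ∈ Icc 0 t) :
    Good sol M s :=
  ⟨hs.1, fun τ hτ => h.2 τ ⟨hτ.1, hτ.2.trans hs.2⟩⟩

theorem Good.solves (hR : TruncatedSolutions R sol) {M : NNReal} {t : ℝ} (h : Good sol M t) :
    ∀ s ∈ Icc 0 t, R (sol M) s := fun _ hs =>
  hR.solves hs.1 fun τ hτ => ((h.mono hs).2 τ hτ).le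

/-- Both functions solve the true equation with norm at most `max M M'`, so both coincide with the
truncated solution at that level. -/
theorem Good.eq (hR : TruncatedSolutions R sol) {M M' : NNReal} {t : ℝ} (h : Good sol M t)
    (h' : Good sol M' t) : sol M t = sol M' t := by
  have e : ∀ {K : NNReal}, Good sol K t → K ≤ max M M' → sol K t = sol (max M M') t :=
    fun {K} hK hle => hR.unique (hR.continuous K).continuousOn
      (fun s hs => (hK.2 s hs).le.trans (NNReal.coe_le_coe.2 hle)) (hK.solves hR)
      (right_mem_Icc.2 hK.1)
  rw [e h (le_max_left _ _), e h' (le_max_right _ _)]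

/-- The bound in `Good` is strict, hence an open condition: a good time is never the last one. -/
theorem Good.exists_gt (hR : TruncatedSolutions R sol) {M : NNReal} {t : ℝ}
    (h : Good sol M t) : ∃ t' > t, Good sol M t' := by
  have h1 : ∀ᶠ s in 𝓝 t, ‖sol M s‖ < M :=
    ((hR.continuous M).norm.tendsto t).eventually (gt_mem_nhds (h.2 t (right_mem_Icc.2 h.1)))
  obtain ⟨ε, hε, h2⟩ := Metric.eventually_nhds_iff.1 h1
  refine ⟨t + ε / 2, by linarith, by linarith [h.1], fun s hs => ?_⟩
  rcases le_or_gt s t with h3 | h3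
  · exact h.2 s ⟨hs.1, h3⟩
  · refine h2 ?_
    rw [Real.dist_eq, abs_of_pos (by linarith)]
    linarith [hs.2]

theorem exists_good (hR : TruncatedSolutions R sol) {t : ℝ} (ht : 0 ≤ t) {v : ℝ → X}
    (hv : ContinuousOn v (Icc 0 t)) (hv' : ∀ s ∈ Icc 0 t, R v s) :
    ∃ M, Good sol M t ∧ EqOn v (sol M) (Icc 0 t) := by
  obtain ⟨C, hC⟩ := isCompact_Icc.exists_bound_of_continuousOn hv
  have hC0 : 0 ≤ C := (norm_nonneg _).trans (hC 0 (left_mem_Icc.2 ht))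
  -- The level exceeds the maximum of the norm by one in order to meet the strict bound.
  have hlt : C < (⟨C + 1, by linarith⟩ : NNReal) := by
    change C < C + 1
    linarith
  have he := hR.unique (M := ⟨C + 1, by linarith⟩) hv (fun s hs => (hC s hs).trans hlt.le) hv'
  exact ⟨_, ⟨ht, fun s hs => by rw [← he hs]; exact (hC s hs).trans_lt hlt⟩, he⟩

/-- Existence and uniqueness of a maximal solution, with the blow-up alternative. -/
theorem exists_maximal (hR : TruncatedSolutions R sol) :
    ∃ (Tmax : EReal) (u : ℝ → X), 0 < Tmax ∧ ContinuousOn u (timeInterval Tmax) ∧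
      (∀ t ∈ timeInterval Tmax, R u t) ∧
      (∀ (T : EReal) (v : ℝ → X), ContinuousOn v (timeInterval T) →
        (∀ t ∈ timeInterval T, R v t) → T ≤ Tmax ∧ ∀ t ∈ timeInterval T, v t = u t) ∧
      (∀ T : ℝ, Tmax = T → ∀ M : NNReal, ∃ t ∈ Ico 0 T, (M : ℝ) ≤ ‖u t‖) ∧
      ∀ t ∈ timeInterval Tmax, ∃ M : NNReal, ∀ s ∈ Icc 0 t, ‖sol M s‖ ≤ M ∧ u s = sol M s := by
  classical
  set u : ℝ → X := fun t => if h : ∃ M, Good sol M t then sol h.choose t else 0 with hu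
  set J : Set ℝ := {t | ∃ M, Good sol M t} with hJ
  set Tmax : EReal := sSup ((fun t : ℝ => (t : EReal)) '' J) with hT
  have hsol : ∀ {M t}, Good sol M t → EqOn u (sol M) (Icc 0 t) := fun {M t} h s hs => by
    have h' := h.mono hs
    have hex : ∃ M, Good sol M s := ⟨M, h'⟩
    rw [hu]
    simp only [dif_pos hex]
    exact hex.choose_spec.eq hR h'
  -- Good times are closed under passing to earlier times and have no largest element, so they form
  -- `[0, Tmax)`.
  have hJT : J = timeInterval Tmax := by
    ext t
    constructor
    · rintro ⟨M, h⟩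
      obtain ⟨t', htt', h'⟩ := h.exists_gt hR
      exact ⟨h.1, (EReal.coe_lt_coe_iff.2 htt').trans_le (le_sSup ⟨t', ⟨M, h'⟩, rfl⟩)⟩
    · rintro ⟨h0, hlt⟩
      obtain ⟨_, ⟨t', ⟨M, h'⟩, rfl⟩, hlt'⟩ := lt_sSup_iff.1 hlt
      exact ⟨M, h'.mono ⟨h0, (EReal.coe_lt_coe_iff.1 hlt').le⟩⟩
  have hgood : ∀ t ∈ timeInterval Tmax, ∃ M, Good sol M t := fun t ht => by
    rwa [← hJT] at ht
  have hzero : (0 : ℝ) ∈ timeInterval Tmax := by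
    rw [← hJT]
    obtain ⟨M, hM⟩ := hR.initial
    refine ⟨M, le_rfl, fun s hs => ?_⟩
    rwa [le_antisymm hs.2 hs.1]
  have hsolves : ∀ t ∈ timeInterval Tmax, R u t := fun t ht => by
    obtain ⟨M, h⟩ := hgood t ht
    exact hR.congr h.1 (hsol h).symm (h.solves hR t (right_mem_Icc.2 h.1))
  have hcont : ContinuousOn u (timeInterval Tmax) := fun t ht => by
    obtain ⟨t', htt', ht'⟩ := exists_gt_mem_timeInterval ht
    obtain ⟨M, h⟩ := hgood t' ht'
    refine ((hR.continuous M).continuousAt.continuousWithinAt (x := t)).congr_of_eventuallyEq ?_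
      (hsol h ⟨ht.1, htt'.le⟩)
    filter_upwards [self_mem_nhdsWithin, mem_nhdsWithin_of_mem_nhds (Iio_mem_nhds htt')] with s h1 h2
    exact hsol h ⟨h1.1, (mem_Iio.1 h2).le⟩
  refine ⟨Tmax, u, ?_, hcont, hsolves, fun T v hv hv' => ?_, fun T hTT M => ?_, fun t ht => ?_⟩
  · exact hzero.2
  · have key : ∀ t ∈ timeInterval T, t ∈ timeInterval Tmax ∧ v t = u t := fun t ht => by
      have hsub := Icc_subset_timeInterval ht
      obtain ⟨M, h, he⟩ := hR.exists_good ht.1 (hv.mono hsub) fun s hs => hv' s (hsub hs)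
      refine ⟨hJT ▸ ⟨M, h⟩, ?_⟩
      rw [he (right_mem_Icc.2 ht.1), hsol h (right_mem_Icc.2 ht.1)]
    refine ⟨le_of_not_gt fun hlt => ?_, fun t ht => (key t ht).2⟩
    obtain ⟨t, h1, h2⟩ := EReal.lt_iff_exists_real_btwn.1 hlt
    have h0 : (0 : ℝ) ≤ t := (EReal.coe_lt_coe_iff.1 (hzero.2.trans h1)).le
    exact absurd (key t ⟨h0, h2⟩).1.2 (not_lt.2 h1.le)
  -- If `‖u‖` stayed below `M` on `[0, T)`, the truncated solution at level `M + 1` would coincide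
  -- with `u` there. By continuity it would be bounded by `M` up to time `T` included, making `T` a
  -- good time.
  · by_contra! hcon
    have hTpos : 0 < T := by
      have := hzero.2
      rw [hTT] at this
      exact EReal.coe_lt_coe_iff.1 this
    have hmem : ∀ t ∈ Ico 0 T, t ∈ timeInterval Tmax := fun t ht =>
      ⟨ht.1, by rw [hTT]; exact EReal.coe_lt_coe_iff.2 ht.2⟩
    have hle : ∀ t ∈ Ico 0 T, ‖sol (M + 1) t‖ ≤ M := fun t ht => by
      have hsub := Icc_subset_timeInterval (hmem t ht)
      have he := hR.unique (M := M + 1) (hcont.mono hsub) (fun s hs => ?_)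
        (fun s hs => hsolves s (hsub hs)) (right_mem_Icc.2 ht.1)
      · rw [← he]
        exact (hcon t ht).le
      · rw [NNReal.coe_add, NNReal.coe_one]
        linarith [hcon s ⟨hs.1, hs.2.trans_lt ht.2⟩]
    have hle' : ∀ t ∈ Icc 0 T, ‖sol (M + 1) t‖ ≤ M := fun t ht => by
      have hcl : IsClosed {t | ‖sol (M + 1) t‖ ≤ M} :=
        isClosed_le (hR.continuous _).norm continuous_const
      rw [← closure_Ico hTpos.ne] at ht
      exact hcl.closure_subset_iff.2 hle ht
    have hTJ : T ∈ timeInterval Tmax := by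
      rw [← hJT]
      refine ⟨M + 1, hTpos.le, fun s hs => (hle' s hs).trans_lt ?_⟩
      rw [NNReal.coe_add, NNReal.coe_one]
      linarith
    have := hTJ.2
    rw [hTT] at this
    exact lt_irrefl _ this
  · obtain ⟨M, h⟩ := hgood t ht
    exact ⟨M, fun s hs => ⟨(h.2 s hs).le, hsol h hs⟩⟩

end TruncatedSolutions

end maximal

/-! ### The truncated heat equation -/

section truncated

variable {N k : ℕ} {k₁ k₂ γ p₁ p₂ : ℝ}

/-- A Lipschitz constant of both truncated nonlinearities. -/
def truncConst (p₁ p₂ : ℝ) (M : NNReal) : NNReal :=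
  max (p₁.toNNReal * M ^ (p₁ - 1)) (p₂.toNNReal * M ^ (p₂ - 1))

theorem lipschitzWith_truncPower_left (hp₁ : 1 < p₁) (p₂ : ℝ) (M : NNReal) :
    LipschitzWith (truncConst p₁ p₂ M) (truncPower p₁ M) :=
  (lipschitzWith_truncPower hp₁ M).weaken (le_max_left _ _)

theorem lipschitzWith_truncPower_right (p₁ : ℝ) (hp₂ : 1 < p₂) (M : NNReal) :
    LipschitzWith (truncConst p₁ p₂ M) (truncPower p₂ M) :=
  (lipschitzWith_truncPower hp₂ M).weaken (le_max_right _ _)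

/-- The equation with truncated power nonlinearities. -/
def truncProblem (hN : 1 ≤ N) (hk : 1 ≤ k) (k₁ k₂ : ℝ) (hγ : γ < 1) (hp₁ : 1 < p₁)
    (hp₂ : 1 < p₂) (M : NNReal) : MemoryProblem C₀(Space N k, ℝ) :=
  heatProblem hN hk k₁ k₂ hγ (lipschitzWith_truncPower_left hp₁ p₂ M)
    (lipschitzWith_truncPower_right p₁ hp₂ M) (truncPower_zero p₁ M) (truncPower_zero p₂ M)

theorem truncProblem_rhs_apply (hN : 1 ≤ N) (hk : 1 ≤ k) (hγ : γ < 1) (hp₁ : 1 < p₁)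
    (hp₂ : 1 < p₂) {M : NNReal} (u₀ : C₀(Space N k, ℝ)) {u : ℝ → C₀(Space N k, ℝ)} {t : ℝ}
    (ht : 0 ≤ t) (hu : ContinuousOn u (Icc 0 t)) (hM : ∀ s ∈ Icc 0 t, ‖u s‖ ≤ M)
    (z : Space N k) : (truncProblem hN hk k₁ k₂ hγ hp₁ hp₂ M).rhs u₀ u t z
      = duhamel N k k₁ k₂ γ p₁ p₂ u₀ u t z := by
  rw [truncProblem, heatProblem_rhs_apply _ _ _ _ _ _ _ _ ht hu, ← duhamelOf_power]
  exact duhamelOf_congr u₀ ht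
    (fun s hs w => truncPower_of_abs_le ((abs_apply_le_norm _ w).trans (hM s hs)))
    (fun s hs w => truncPower_of_abs_le ((abs_apply_le_norm _ w).trans (hM s hs))) z

theorem truncatedSolutions (hN : 1 ≤ N) (hk : 1 ≤ k) (hγ : γ < 1) (hp₁ : 1 < p₁)
    (hp₂ : 1 < p₂) (u₀ : C₀(Space N k, ℝ)) {sol : NNReal → ℝ → C₀(Space N k, ℝ)}
    (hc : ∀ M, Continuous (sol M))
    (hs : ∀ M t, 0 ≤ t → sol M t = (truncProblem hN hk k₁ k₂ hγ hp₁ hp₂ M).rhs u₀ (sol M) t) :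
    TruncatedSolutions (fun (u : ℝ → C₀(Space N k, ℝ)) t => ∀ z, u t z = duhamel N k k₁ k₂ γ p₁ p₂ u₀ u t z) sol where
  congr := fun {u v t} ht h hu z => by
    rw [← h (right_mem_Icc.2 ht), hu z, ← duhamelOf_power, ← duhamelOf_power]
    exact duhamelOf_congr u₀ ht (fun s hs w => by rw [h hs]) (fun s hs w => by rw [h hs]) z
  continuous := hc
  solves := fun {M t} ht h z => by
    rw [hs M t ht]
    rw [truncProblem_rhs_apply hN hk hγ hp₁ hp₂ u₀ ht (hc M).continuousOn h]
  unique := fun {M t v} hv hM hR => by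
    refine (truncProblem hN hk k₁ k₂ hγ hp₁ hp₂ M).eqOn_of_eq_rhs u₀ hv (hc M).continuousOn
      (fun s h => ?_) (fun s h => hs M s h.1)
    have hsub : Icc 0 s ⊆ Icc 0 t := Icc_subset_Icc_right h.2
    ext z
    rw [hR s h z, truncProblem_rhs_apply hN hk hγ hp₁ hp₂ u₀ h.1 (hv.mono hsub)
      fun τ hτ => hM τ (hsub hτ)]
  initial := by
    refine ⟨‖u₀‖₊ + 1, ?_⟩
    rw [hs _ 0 le_rfl, MemoryProblem.rhs, intervalIntegral.integral_same,
      intervalIntegral.integral_same, smul_zero, smul_zero, add_zero, add_zero]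
    refine ((truncProblem hN hk k₁ k₂ hγ hp₁ hp₂ _).norm_le 0 u₀).trans_lt ?_
    rw [NNReal.coe_add, coe_nnnorm, NNReal.coe_one]
    linarith

/-- Put `max a 0` inside both nonlinearities. They become nonnegative, so the Duhamel formula shows
that the solution `v` is nonnegative. Then `max (v s w) 0 = v s w`, so `v` solves the unmodified
problem and equals `u` by uniqueness. -/
theorem truncPower_sol_nonneg (hN : 1 ≤ N) (hk : 1 ≤ k) (hγ : γ < 1) (hp₁ : 1 < p₁)
    (hp₂ : 1 < p₂) (hk₁ : 0 ≤ k₁) (hk₂ : 0 ≤ k₂) {u₀ : C₀(Space N k, ℝ)} (hu₀ : ∀ z, 0 ≤ u₀ z)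
    {M : NNReal} {u : ℝ → C₀(Space N k, ℝ)} (hc : Continuous u)
    (hs : ∀ t, 0 ≤ t → u t = (truncProblem hN hk k₁ k₂ hγ hp₁ hp₂ M).rhs u₀ u t) {t : ℝ}
    (ht : 0 ≤ t) (z : Space N k) : 0 ≤ u t z := by
  have hL₁ : LipschitzWith (truncConst p₁ p₂ M) fun a => truncPower p₁ M (max a 0) := by
    simpa [Function.comp_def] using
      (lipschitzWith_truncPower_left hp₁ p₂ M).comp (LipschitzWith.id.max_const 0)
  have hL₂ : LipschitzWith (truncConst p₁ p₂ M) fun a => truncPower p₂ M (max a 0) := by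
    simpa [Function.comp_def] using
      (lipschitzWith_truncPower_right p₁ hp₂ M).comp (LipschitzWith.id.max_const 0)
  obtain ⟨v, hvc, hv⟩ := (heatProblem hN hk k₁ k₂ hγ hL₁ hL₂
    (by rw [max_self, truncPower_zero]) (by rw [max_self, truncPower_zero])).exists_eq_rhs u₀
  have hv' : ∀ s, 0 ≤ s → ∀ w, v s w = duhamelOf N k k₁ k₂ γ (fun a => truncPower p₁ M (max a 0))
      (fun a => truncPower p₂ M (max a 0)) u₀ v s w := fun s hs w => by
    conv_lhs => rw [hv s hs]
    rw [heatProblem_rhs_apply _ _ _ _ _ _ _ _ hs hvc.continuousOn]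
  have hpos : ∀ s, 0 ≤ s → ∀ w, 0 ≤ v s w := fun s hs w => by
    rw [hv' s hs w]
    exact duhamelOf_nonneg hN hk hk₁ hk₂ (fun a => truncPower_nonneg _ _ (le_max_right _ _))
      (fun a => truncPower_nonneg _ _ (le_max_right _ _)) hu₀ v hs w
  have huv : EqOn u v (Icc 0 t) := by
    refine (truncProblem hN hk k₁ k₂ hγ hp₁ hp₂ M).eqOn_of_eq_rhs u₀ hc.continuousOn
      hvc.continuousOn (fun s h => hs s h.1) fun s h => ?_
    ext w
    rw [hv' s h.1 w, truncProblem, heatProblem_rhs_apply _ _ _ _ _ _ _ _ h.1 hvc.continuousOn]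
    exact duhamelOf_congr u₀ h.1 (fun τ hτ w => by rw [max_eq_left (hpos τ hτ.1 w)])
      (fun τ hτ w => by rw [max_eq_left (hpos τ hτ.1 w)]) w
  rw [huv (right_mem_Icc.2 ht)]
  exact hpos t ht z

end truncated

/-! ### Properties of the maximal solution -/

section properties

variable {N k : ℕ}

theorem continuous_uncurry_zeroAtInfty {E : Type*} [TopologicalSpace E] {u : ℝ → C₀(E, ℝ)}
    (hu : Continuous u) : Continuous fun q : ℝ × E => u q.1 q.2 := by
  rw [continuous_iff_continuousAt]
  rintro ⟨t, z⟩
  have h1 : Tendsto (fun q : ℝ × E => ‖u q.1 - u t‖) (𝓝 (t, z)) (𝓝 0) := by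
    have : Continuous fun q : ℝ × E => ‖u q.1 - u t‖ := by fun_prop
    simpa using this.tendsto (t, z)
  have h2 : Tendsto (fun q : ℝ × E => (u q.1 - u t) q.2) (𝓝 (t, z)) (𝓝 0) :=
    squeeze_zero_norm (fun q => abs_apply_le_norm (u q.1 - u t) q.2) h1
  have h3 : Tendsto (fun q : ℝ × E => u t q.2) (𝓝 (t, z)) (𝓝 (u t z)) :=
    ((map_continuous (u t)).comp continuous_snd).tendsto (t, z)
  have h4 := h2.add h3
  rw [zero_add] at h4
  refine h4.congr fun q => ?_
  rw [ZeroAtInftyContinuousMap.sub_apply, sub_add_cancel]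

/-- By joint continuity of `v` the inequality `C < |v|` holds on an open set around `(t₀, z)`. This
set meets `(0, t) × ℝ^{N+k}` in positive measure, even for `t₀ = 0`, since `t₀` lies in the closure
of `(0, t)`. -/
theorem lt_spaceTimeNorm {u v : ℝ → C₀(Space N k, ℝ)} (hv : Continuous v) {t t₀ C : ℝ}
    (h : EqOn u v (Ico 0 t)) (ht₀ : t₀ ∈ Ico 0 t) (hC : 0 ≤ C) (hlt : C < ‖v t₀‖) :
    ENNReal.ofReal C < spaceTimeNorm N k u t := by
  obtain ⟨z, hz⟩ : ∃ z, C < |v t₀ z| := by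
    by_contra! hcon
    exact absurd hlt (not_lt.2 (zeroAtInfty_norm_le hC hcon))
  set W : Set (ℝ × Space N k) := {q | C < |v q.1 q.2|} with hW
  have hWo : IsOpen W := isOpen_lt continuous_const (continuous_uncurry_zeroAtInfty hv).abs
  have hD : IsOpen (Ioo 0 t ×ˢ (univ : Set (Space N k))) := isOpen_Ioo.prod isOpen_univ
  have hne : (W ∩ Ioo 0 t ×ˢ (univ : Set (Space N k))).Nonempty := by
    have hcl : (t₀, z) ∈ closure (Ioo 0 t ×ˢ (univ : Set (Space N k))) := by
      rw [closure_prod_eq, closure_Ioo (ht₀.1.trans_lt ht₀.2).ne, closure_univ]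
      exact ⟨⟨ht₀.1, ht₀.2.le⟩, mem_univ _⟩
    exact mem_closure_iff.1 hcl W hWo hz
  by_contra! hcon
  have hae := ae_le_eLpNormEssSup (f := fun q : ℝ × Space N k => u q.1 q.2)
    (μ := volume.restrict (Ioo (0 : ℝ) t ×ˢ (univ : Set (Space N k))))
  rw [spaceTimeNorm, eLpNorm_exponent_top] at hcon
  rw [ae_restrict_iff' hD.measurableSet] at hae
  refine ((hWo.inter hD).measure_pos volume hne).ne' (measure_mono_null (fun q hq => ?_) hae)
  intro hq'
  have h1 := (hq' hq.2).trans hcon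
  rw [Real.enorm_eq_ofReal_abs, ENNReal.ofReal_le_ofReal_iff hC,
    h ⟨hq.2.1.1.le, hq.2.1.2⟩] at h1
  exact absurd hq.1 (not_lt.2 h1)

theorem eLpNorm_sub_le_edist {r : ℝ≥0∞} [Fact (1 ≤ r)] (p q : zeroAtInftyLp N k r) :
    eLpNorm (fun z => toZeroAtInfty N k r p z - toZeroAtInfty N k r q z) r volume
      ≤ edist p q := by
  have hp : p.1.1 =ᵐ[volume] p.1.2 := p.2
  have hq : q.1.1 =ᵐ[volume] q.1.2 := q.2
  have h : eLpNorm (fun z => toZeroAtInfty N k r p z - toZeroAtInfty N k r q z) r volume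
      = edist p.1.2 q.1.2 := by
    rw [Lp.edist_def]
    exact eLpNorm_congr_ae (hp.sub hq)
  rw [h, Subtype.edist_eq, Prod.edist_eq]
  exact le_max_right _ _

theorem continuousInLp_of_lift {r : ℝ≥0∞} [Fact (1 ≤ r)] {T : EReal}
    {u : ℝ → C₀(Space N k, ℝ)} (h : ∀ t ∈ timeInterval T, ∃ U : ℝ → zeroAtInftyLp N k r,
      Continuous U ∧ ∀ s ∈ Icc 0 t, toZeroAtInfty N k r (U s) = u s) :
    ContinuousInLp N k r T u := by
  refine ⟨fun t ht => ?_, fun t ht => ?_⟩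
  · obtain ⟨U, -, hU⟩ := h t ht
    rw [← hU t (right_mem_Icc.2 ht.1)]
    exact memLp_toZeroAtInfty (U t)
  · obtain ⟨t', htt', ht'⟩ := exists_gt_mem_timeInterval ht
    obtain ⟨U, hUc, hU⟩ := h t' ht'
    have h1 : Tendsto (fun s => edist (U s) (U t)) (𝓝[timeInterval T] t) (𝓝 0) :=
      (tendsto_iff_edist_tendsto_0.1 (hUc.tendsto t)).mono_left nhdsWithin_le_nhds
    refine tendsto_of_tendsto_of_tendsto_of_le_of_le' tendsto_const_nhds h1
      (Eventually.of_forall fun _ => zero_le) ?_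
    filter_upwards [self_mem_nhdsWithin, mem_nhdsWithin_of_mem_nhds (Iio_mem_nhds htt')] with s h2 h3
    rw [← hU s ⟨h2.1, (mem_Iio.1 h3).le⟩, ← hU t ⟨ht.1, htt'.le⟩]
    exact eLpNorm_sub_le_edist (U s) (U t)

end properties

end Grushin

end

/-! ### The main theorem -/

theorem theorem3p2 (N k : ℕ) (hN : 1 ≤ N) (hk : 1 ≤ k) (k₁ k₂ γ p₁ p₂ : ℝ) (hγ : γ < 1)
    (hp₁ : 1 < p₁) (hp₂ : 1 < p₂) (u₀ : C₀(Grushin.Space N k, ℝ)) :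
    ∃ (Tmax : EReal) (u : ℝ → C₀(Grushin.Space N k, ℝ)),
      0 < Tmax ∧
      -- `u` is a mild solution on `[0, Tmax)`
      Grushin.IsMildSolution N k k₁ k₂ γ p₁ p₂ u₀ Tmax u ∧
      -- uniqueness and maximality: every mild solution is a restriction of `u`
      (∀ (T : EReal) (v : ℝ → C₀(Grushin.Space N k, ℝ)),
        Grushin.IsMildSolution N k k₁ k₂ γ p₁ p₂ u₀ T v →
          T ≤ Tmax ∧ ∀ t ∈ Grushin.timeInterval T, v t = u t) ∧
      -- blow-up alternative
      (∀ T : ℝ, Tmax = (T : EReal) →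
        Tendsto (Grushin.spaceTimeNorm N k u) (𝓝[<] T) (𝓝 ∞)) ∧
      -- persistence of integrability
      (∀ r : ℝ≥0∞, 1 ≤ r → r < ∞ → MemLp u₀ r volume →
        Grushin.ContinuousInLp N k r Tmax u) ∧
      -- nonnegativity
      ((∀ z, 0 ≤ u₀ z) → 0 ≤ k₁ → 0 ≤ k₂ →
        ∀ t ∈ Grushin.timeInterval Tmax, ∀ z, 0 ≤ u t z) := by
  choose sol hc hs using fun M =>
    (Grushin.truncProblem hN hk k₁ k₂ hγ hp₁ hp₂ M).exists_eq_rhs u₀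
  obtain ⟨Tmax, u, hpos, hu, hu', huniq, hblow, hsol⟩ :=
    (Grushin.truncatedSolutions hN hk hγ hp₁ hp₂ u₀ hc hs).exists_maximal
  refine ⟨Tmax, u, hpos, ⟨hu, hu'⟩, fun T v hv => huniq T v hv.continuousOn hv.eq_duhamel,
    fun T hT => ?_, fun r hr hr' hu₀ => ?_, fun hu₀ hk₁ hk₂ t ht z => ?_⟩
  · refine ENNReal.tendsto_nhds_top fun n => ?_
    -- The level `n + 1` gives the strict inequality `n < ‖u t₀‖`. It bounds the space-time norm
    -- from below for every later `t`, so the norm itself diverges, not merely along a sequence.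
    obtain ⟨t₀, ht₀, hn⟩ := hblow T hT (n + 1)
    filter_upwards [Ioo_mem_nhdsLT ht₀.2] with t ht
    have htT : t ∈ Grushin.timeInterval Tmax :=
      ⟨ht₀.1.trans ht.1.le, by rw [hT]; exact EReal.coe_lt_coe_iff.2 ht.2⟩
    obtain ⟨M, hM⟩ := hsol t htT
    have hlt : (n : ℝ) < ‖sol M t₀‖ := by
      rw [← (hM t₀ ⟨ht₀.1, ht.1.le⟩).2]
      push_cast at hn
      linarith
    have h := Grushin.lt_spaceTimeNorm (u := u) (hc M)
      (fun s hs => (hM s ⟨hs.1, hs.2.le⟩).2) ⟨ht₀.1, ht.1⟩ n.cast_nonneg hlt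
    rwa [ENNReal.ofReal_natCast] at h
  · have : Fact (1 ≤ r) := ⟨hr⟩
    refine Grushin.continuousInLp_of_lift fun t ht => ?_
    obtain ⟨M, hM⟩ := hsol t ht
    obtain ⟨U, hUc, hU⟩ := Grushin.exists_lift_Lp hr'.ne hN hk hγ
      (Grushin.lipschitzWith_truncPower_left hp₁ p₂ M)
      (Grushin.lipschitzWith_truncPower_right p₁ hp₂ M)
      (Grushin.truncPower_zero p₁ M) (Grushin.truncPower_zero p₂ M) hu₀ (hc M) (hs M)
    exact ⟨U, hUc, fun s hs => (hU s hs.1).trans (hM s hs).2.symm⟩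
  · obtain ⟨M, hM⟩ := hsol t ht
    rw [(hM t (right_mem_Icc.2 ht.1)).2]
    exact Grushin.truncPower_sol_nonneg hN hk hγ hp₁ hp₂ hk₁ hk₂ hu₀ (hc M) (hs M) ht.1 z
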